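/- Let $k\ge 0$ and let $\Lambda$ be a row-finite $k$-graph with no sources: a nonempty countable small category with a degree functor $d:\Lambda\to\mathbb N^k$ such that whenever $d(\lambda)=m+n$ there are unique $\mu,\nu$ with $\lambda=\mu\nu$, $d(\mu)=m$, $d(\nu)=n$, and such that for every vertex $v\in\Lambda^0=d^{-1}(0)$ and every $n\in\mathbb N^k$ the set $v\Lambda^n=\{\lambda: r(\lambda)=v,\ d(\lambda)=n\}$ is finite and nonempty. Let $\Lambda^\infty$ be the set of infinite paths of $\Lambda$, i.e. of degree-preserving functors $x$ from $\Omega_k=\{(m,n)\in\mathbb N^k\times\mathbb N^k: m\le n\}$ to $\Lambda$; write $r(x)=x(0,0)$ and let $\sigma^p$ denote the shift by $p\in\mathbb N^k$. Let $$\mathcal G_\Lambda=\{(x,\ell-m,y)\in\Lambda^\infty\times\mathbb Z^k\times\Lambda^\infty:\ \ell,m\in\mathbb N^k,\ \sigma^\ell x=\sigma^m y\}$$ be the path groupoid, with $r(x,n,y)=x$, $s(x,n,y)=y$, $(x,m,y)(y,n,z)=(x,m+n,z)$, $(x,n,y)^{-1}=(y,-n,x)$, and the topology generated by the sets $Z(\mu,\nu)=\{(\mu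 x,d(\mu)-d(\nu),\nu x): x\in\Lambda^\infty,\ r(x)=s(\mu)\}$, where $\mu,\nu\in\Lambda$ with $s(\mu)=s(\nu)$. Let $\mathcal P$ be a set of pairs $(\mu,\nu)$ with $s(\mu)=s(\nu)$ such that every $g\in\mathcal G_\Lambda$ lies in $Z(\mu,\nu)$ for exactly one pair $(\mu,\nu)\in\mathcal P$; call this pair $(\mu_g,\nu_g)$. Let $c$ be a normalised $\mathbb T$-valued $2$-cocycle on the category $\Lambda$, that is, $c(\mu,\nu)\in\mathbb T$ for $s(\mu)=r(\nu)$, $c(\mu,\nu)=1$ if $\mu$ or $\nu$ is a vertex, and $c(\lambda,\mu)c(\lambda\mu,\nu)=c(\mu,\nu)c(\lambda,\mu\nu)$ for composable $\lambda,\mu,\nu$. Let $\sigma_c$ be the continuous $\mathbb T$-valued $2$-cocycle on $\mathcal G_\Lambda$ given, for $s(g)=r(h)$, by $$\sigma_c(g,h)=c(\mu_g,\alpha)\,\overline{c(\nu_g,\alpha)}\;c(\mu_h,\beta)\,\overline{c(\nu_h,\beta)}\;\overline{c(\mu_{gh},\gamma)}\,c(\nu_{gh},\gamma),$$ where $\alpha,\beta,\gamma\in\Lambda$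 and $y\in\Lambda^\infty$ are any elements with $r(y)=s(\alpha)=s(\beta)=s(\gamma)$, $\mu_g\alpha=\mu_{gh}\gamma$, $\nu_h\beta=\nu_{gh}\gamma$, $\nu_g\alpha=\mu_h\beta$ and $$g=(\mu_g\alpha y,\,d(\mu_g)-d(\nu_g),\,\nu_g\alpha y),\quad h=(\mu_h\beta y,\,d(\mu_h)-d(\nu_h),\,\nu_h\beta y),\quad gh=(\mu_{gh}\gamma y,\,d(\mu_{gh})-d(\nu_{gh}),\,\nu_{gh}\gamma y)$$ (such elements exist and the value does not depend on their choice). Let $C^*(\Lambda,c)$ be the universal $C^*$-algebra generated by elements $t_\lambda$ $(\lambda\in\Lambda)$ such that the $t_v$ $(v\in\Lambda^0)$ are mutually orthogonal projections, $t_\mu t_\nu=c(\mu,\nu)t_{\mu\nu}$ whenever $s(\mu)=r(\nu)$, $t_\lambda^*t_\lambda=t_{s(\lambda)}$ for all $\lambda$, and $t_v=\sum_{\lambda\in v\Lambda^n}t_\lambda t_\lambda^*$ for all $v\in\Lambda^0$, $n\in\mathbb N^k$. Let $C^*(\mathcal G_\Lambda,\sigma_c)$ and $C^*_r(\mathcal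 G_\Lambda,\sigma_c)$ be the full and the reduced twisted groupoid $C^*$-algebras, i.e. the completions of $C_c(\mathcal G_\Lambda)$, with product $(f*f')(\gamma)=\sum_{\alpha\beta=\gamma}\sigma_c(\alpha,\beta)f(\alpha)f'(\beta)$ and involution $f^*(\gamma)=\overline{\sigma_c(\gamma^{-1},\gamma)}\,\overline{f(\gamma^{-1})}$, in the supremum of the norms $\|L(f)\|$ over all Hilbert space $*$-representations $L$ that are bounded by the $I$-norm, respectively over the left regular representations on $\ell^2(s^{-1}(x))$, $x\in\Lambda^\infty$. Then $$C^*(\Lambda,c)\;\cong\;C^*(\mathcal G_\Lambda,\sigma_c)\;\cong\;C^*_r(\mathcal G_\Lambda,\sigma_c).$$ -/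

import Mathlib

open scoped ENNReal CompactlySupported

noncomputable section

universe u

/-- The `C*`-subalgebra, generated by a set `S`, of the `ℓ^∞`-direct sum of the `C*`-algebras
`A i`. -/
def GeneratedCStar {ι : Type*} {A : ι → Type*} [∀ i, NonUnitalCStarAlgebra (A i)]
    (S : Set (lp A ∞)) : Type _ :=
  (NonUnitalStarAlgebra.adjoin ℂ S).topologicalClosure

instance {ι : Type*} {A : ι → Type*} [∀ i, NonUnitalCStarAlgebra (A i)] (S : Set (lp A ∞)) :
    NonUnitalCStarAlgebra (GeneratedCStar S) :=
  NonUnitalStarSubalgebra.nonUnitalCStarAlgebra (NonUnitalStarAlgebra.adjoin ℂ S).topologicalClosure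
    (h_closed := NonUnitalStarSubalgebra.isClosed_topologicalClosure _)

/-- A `k`-graph with set of morphisms `Λ`: a nonempty countable small category, presented by its
morphisms (objects are identified with their identity morphisms, `s` and `r` send a morphism to
the identity at its domain and codomain), with a degree functor `d` to `ℕ^k` satisfying the
factorisation property. The composite `comp μ ν = μν` is meaningful only when `s μ = r ν`;
nothing below looks at it otherwise. -/
structure KGraph (k : ℕ) (Λ : Type u) where
  countable : Countable Λ
  nonempty : Nonempty Λ
  /-- the range (codomain) map -/
  r : Λ → Λ
  /-- the source (domain) map -/
  s : Λ → Λ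
  /-- composition -/
  comp : Λ → Λ → Λ
  /-- the degree functor -/
  d : Λ → Fin k → ℕ
  r_r : ∀ v, r (r v) = r v
  s_r : ∀ v, s (r v) = r v
  r_s : ∀ v, r (s v) = s v
  s_s : ∀ v, s (s v) = s v
  r_comp : ∀ μ ν, s μ = r ν → r (comp μ ν) = r μ
  s_comp : ∀ μ ν, s μ = r ν → s (comp μ ν) = s ν
  r_comp_self : ∀ μ, comp (r μ) μ = μ
  comp_s_self : ∀ μ, comp μ (s μ) = μ
  assoc : ∀ l μ ν, s l = r μ → s μ = r ν → comp (comp l μ) ν = comp l (comp μ ν)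
  d_comp : ∀ μ ν, s μ = r ν → d (comp μ ν) = d μ + d ν
  factorisation : ∀ (l : Λ) (m n : Fin k → ℕ), d l = m + n →
    ∃! p : Λ × Λ, s p.1 = r p.2 ∧ d p.1 = m ∧ d p.2 = n ∧ l = comp p.1 p.2

namespace KGraph

variable {k : ℕ} {Λ : Type u}

/-- `Λ⁰ = d⁻¹(0)`. -/
def IsVertex (G : KGraph k Λ) (v : Λ) : Prop := G.d v = 0

/-- `vΛⁿ`. -/
def pathsFrom (G : KGraph k Λ) (v : Λ) (n : Fin k → ℕ) : Set Λ := {l | G.r l = v ∧ G.d l = n}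

def RowFinite (G : KGraph k Λ) : Prop :=
  ∀ v, G.IsVertex v → ∀ n, (G.pathsFrom v n).Finite

def NoSources (G : KGraph k Λ) : Prop :=
  ∀ v, G.IsVertex v → ∀ n, (G.pathsFrom v n).Nonempty

/-- A (normalised) categorical `2`-cocycle on `Λ` with values in the circle group. Only the
values at composable pairs are constrained, and only those are used. -/
structure TwoCocycle (G : KGraph k Λ) where
  toFun : Λ → Λ → Circle
  normalised : ∀ μ ν, G.s μ = G.r ν → G.IsVertex μ ∨ G.IsVertex ν → toFun μ ν = 1
  cocycle : ∀ l μ ν, G.s l = G.r μ → G.s μ = G.r ν →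
    toFun μ ν * (toFun (G.comp l μ) ν)⁻¹ * toFun l (G.comp μ ν) * (toFun l μ)⁻¹ = 1

instance (G : KGraph k Λ) : CoeFun G.TwoCocycle (fun _ => Λ → Λ → Circle) := ⟨TwoCocycle.toFun⟩

/-! ### The twisted `C*`-algebra of a `k`-graph -/

/-- A Cuntz-Krieger `(Λ, c)`-family in a `C*`-algebra `B`. -/
structure IsCuntzKriegerFamily (G : KGraph k Λ) (c : G.TwoCocycle) {B : Type*}
    [NonUnitalCStarAlgebra B] (t : Λ → B) : Prop where
  projection : ∀ v, G.IsVertex v → IsStarProjection (t v)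
  orthogonal : ∀ v w, G.IsVertex v → G.IsVertex w → v ≠ w → t v * t w = 0
  mul : ∀ μ ν, G.s μ = G.r ν → t μ * t ν = (c μ ν : ℂ) • t (G.comp μ ν)
  star_mul_self : ∀ l, star (t l) * t l = t (G.s l)
  sum : ∀ v, G.IsVertex v → ∀ n, t v = ∑ᶠ l ∈ G.pathsFrom v n, t l * star (t l)

/-- A `C*`-algebra with a Cuntz-Krieger `(Λ, c)`-family in it. -/
structure CuntzKriegerFamily (G : KGraph k Λ) (c : G.TwoCocycle) where
  B : Type u
  [inst : NonUnitalCStarAlgebra B]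
  t : Λ → B
  isFamily : G.IsCuntzKriegerFamily c t

attribute [instance] CuntzKriegerFamily.inst

theorem d_s (G : KGraph k Λ) (l : Λ) : G.d (G.s l) = 0 := by
  have h := G.d_comp l (G.s l) (G.r_s l).symm
  rw [G.comp_s_self] at h
  exact left_eq_add.mp h

theorem d_r (G : KGraph k Λ) (l : Λ) : G.d (G.r l) = 0 := by
  have h := G.d_comp (G.r l) l (G.s_r l)
  rw [G.r_comp_self] at h
  exact right_eq_add.mp h

theorem IsCuntzKriegerFamily.norm_le_one {G : KGraph k Λ} {c : G.TwoCocycle} {B : Type*}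
    [NonUnitalCStarAlgebra B] {t : Λ → B} (ht : G.IsCuntzKriegerFamily c t) (l : Λ) :
    ‖t l‖ ≤ 1 := by
  have hp := ht.projection (G.s l) (G.d_s l)
  have h1 : ‖t (G.s l)‖ * ‖t (G.s l)‖ = ‖t (G.s l)‖ := by
    rw [← CStarRing.norm_star_mul_self, hp.isSelfAdjoint.star_eq, hp.isIdempotentElem.eq]
  have h2 : ‖t l‖ * ‖t l‖ = ‖t (G.s l)‖ := by
    rw [← CStarRing.norm_star_mul_self, ht.star_mul_self]
  have h0 := norm_nonneg (t l)
  have h3 : ‖t (G.s l)‖ ≤ 1 := by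
    by_contra h
    nlinarith
  nlinarith

/-- The direct sum `λ ↦ (t_λ)` of all Cuntz-Krieger `(Λ, c)`-families `t`. -/
def universalFamily (G : KGraph k Λ) (c : G.TwoCocycle) (l : Λ) :
    lp (fun i : G.CuntzKriegerFamily c => i.B) ∞ :=
  ⟨fun i => i.t l, memℓp_infty ⟨1, by
    rintro _ ⟨i, rfl⟩
    exact i.isFamily.norm_le_one l⟩⟩

/-- The twisted `k`-graph algebra `C*(Λ, c)`: the universal `C*`-algebra generated by a
Cuntz-Krieger `(Λ, c)`-family, realised as the `C*`-algebra generated by the direct sum of all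
Cuntz-Krieger `(Λ, c)`-families. -/
abbrev TwistedAlgebra (G : KGraph k Λ) (c : G.TwoCocycle) : Type (u + 1) :=
  GeneratedCStar (Set.range (G.universalFamily c))

/-! ### The path groupoid -/

/-- An infinite path: a degree-preserving functor from `Ω_k = {(m, n) : m ≤ n}` to `Λ`. -/
@[ext]
structure InfinitePath (G : KGraph k Λ) where
  toFun : ∀ m n : Fin k → ℕ, m ≤ n → Λ
  r_toFun : ∀ m n h, G.r (toFun m n h) = toFun m m le_rfl
  s_toFun : ∀ m n h, G.s (toFun m n h) = toFun n n le_rfl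
  comp_toFun : ∀ m n p (h : m ≤ n) (h' : n ≤ p),
    G.comp (toFun m n h) (toFun n p h') = toFun m p (h.trans h')
  d_toFun : ∀ m n h, G.d (toFun m n h) = n - m

/-- The range `r(x) = x(0)` of an infinite path. -/
def InfinitePath.range {G : KGraph k Λ} (x : G.InfinitePath) : Λ := x.toFun 0 0 le_rfl

/-- The shift `(σ^p x)(m, n) = x(m + p, n + p)`. -/
def InfinitePath.shift {G : KGraph k Λ} (p : Fin k → ℕ) (x : G.InfinitePath) :
    G.InfinitePath where
  toFun m n h := x.toFun (m + p) (n + p) (add_le_add h le_rfl)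
  r_toFun _ _ _ := x.r_toFun _ _ _
  s_toFun _ _ _ := x.s_toFun _ _ _
  comp_toFun _ _ _ _ _ := x.comp_toFun _ _ _ _ _
  d_toFun m n h := by rw [x.d_toFun, add_tsub_add_eq_tsub_right]

/-- `x = μz`: the infinite path `x` is the concatenation of the path `μ` and the infinite path
`z`, that is, `x(0, d(μ)) = μ` and `σ^{d(μ)} x = z` (which forces `r(z) = s(μ)`). -/
def InfinitePath.IsConcat {G : KGraph k Λ} (x : G.InfinitePath) (μ : Λ) (z : G.InfinitePath) :
    Prop :=
  x.toFun 0 (G.d μ) zero_le = μ ∧ x.shift (G.d μ) = z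

/-- A degree in `ℕ^k` seen in `ℤ^k`. -/
def toInt (n : Fin k → ℕ) : Fin k → ℤ := fun i => (n i : ℤ)

/-- The path groupoid of `Λ`, with elements `(x, ℓ - m, y)` where `σ^ℓ x = σ^m y`. The units
`(x, 0, x)` are identified with the infinite paths `x`; the range of `(x, n, y)` is `x` and its
source is `y`. -/
@[ext]
structure PathGroupoid (G : KGraph k Λ) where
  rng : G.InfinitePath
  deg : Fin k → ℤ
  src : G.InfinitePath
  exists_shift : ∃ l m : Fin k → ℕ, deg = toInt l - toInt m ∧ rng.shift l = src.shift m

theorem InfinitePath.shift_shift {G : KGraph k Λ} (p q : Fin k → ℕ) (x : G.InfinitePath) :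
    (x.shift p).shift q = x.shift (q + p) := by
  ext m n h
  simp only [InfinitePath.shift, add_assoc]

/-- `(x, m, y)(y, n, z) = (x, m + n, z)`. -/
def PathGroupoid.mul {G : KGraph k Λ} (g h : G.PathGroupoid) (hgh : g.src = h.rng) :
    G.PathGroupoid where
  rng := g.rng
  deg := g.deg + h.deg
  src := h.src
  exists_shift := by
    obtain ⟨l, m, h1, h2⟩ := g.exists_shift
    obtain ⟨p, q, h3, h4⟩ := h.exists_shift
    refine ⟨p + l, m + q, ?_, ?_⟩
    · rw [h1, h3]
      funext i
      simp only [toInt, Pi.add_apply, Pi.sub_apply, Nat.cast_add]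
      ring
    · rw [← InfinitePath.shift_shift, h2, InfinitePath.shift_shift, add_comm p m,
        ← InfinitePath.shift_shift, hgh, h4, InfinitePath.shift_shift]

/-- `(x, n, y)⁻¹ = (y, -n, x)`. -/
def PathGroupoid.inv {G : KGraph k Λ} (g : G.PathGroupoid) : G.PathGroupoid where
  rng := g.src
  deg := -g.deg
  src := g.rng
  exists_shift := by
    obtain ⟨l, m, h1, h2⟩ := g.exists_shift
    exact ⟨m, l, by rw [h1, neg_sub], h2.symm⟩

/-- `Z(μ, ν) = {(μx, d(μ) - d(ν), νx) : x ∈ Λ^∞, r(x) = s(μ)}`. -/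
def cylinder (G : KGraph k Λ) (μ ν : Λ) : Set G.PathGroupoid :=
  {g | g.deg = toInt (G.d μ) - toInt (G.d ν) ∧
    ∃ x : G.InfinitePath, x.range = G.s μ ∧ g.rng.IsConcat μ x ∧ g.src.IsConcat ν x}

/-- The topology of the path groupoid, generated by the sets `Z(μ, ν)` with `s(μ) = s(ν)`. -/
instance (G : KGraph k Λ) : TopologicalSpace G.PathGroupoid :=
  TopologicalSpace.generateFrom {U | ∃ μ ν, G.s μ = G.s ν ∧ U = G.cylinder μ ν}

/-! ### The groupoid cocycle produced by a partition -/

/-- `P` is a set of pairs `(μ, ν)` with `s(μ) = s(ν)` and the family `Z(μ, ν)`, `(μ, ν) ∈ P`,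
partitions the path groupoid: each `g` lies in `Z(μ, ν)` for exactly one `(μ, ν) ∈ P`. -/
structure IsPartition (G : KGraph k Λ) (P : Set (Λ × Λ)) : Prop where
  s_eq : ∀ p ∈ P, G.s p.1 = G.s p.2
  existsUnique : ∀ g : G.PathGroupoid, ∃! p : Λ × Λ, p ∈ P ∧ g ∈ G.cylinder p.1 p.2

/-- The unique `(μ_g, ν_g) ∈ P` with `g ∈ Z(μ_g, ν_g)`. -/
def IsPartition.pair {G : KGraph k Λ} {P : Set (Λ × Λ)} (hP : G.IsPartition P)
    (g : G.PathGroupoid) : Λ × Λ := (hP.existsUnique g).choose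

theorem IsPartition.pair_mem {G : KGraph k Λ} {P : Set (Λ × Λ)} (hP : G.IsPartition P)
    (g : G.PathGroupoid) : g ∈ G.cylinder (hP.pair g).1 (hP.pair g).2 :=
  (hP.existsUnique g).choose_spec.1.2

/-- Paths `α, β, γ` and an infinite path `y` with `r(y) = s(α) = s(β) = s(γ)`,
`μ_g α = μ_{gh} γ`, `ν_h β = ν_{gh} γ`, `ν_g α = μ_h β`, and
`g = (μ_g α y, d(μ_g) - d(ν_g), ν_g α y)`, `h = (μ_h β y, d(μ_h) - d(ν_h), ν_h β y)`,
`gh = (μ_{gh} γ y, d(μ_{gh}) - d(ν_{gh}), ν_{gh} γ y)`. (The degrees are right by the choice of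
the pairs `(μ_g, ν_g)`.) -/
structure Refinement {G : KGraph k Λ} {P : Set (Λ × Λ)} (hP : G.IsPartition P)
    (g h : G.PathGroupoid) (hgh : g.src = h.rng) where
  α : Λ
  β : Λ
  γ : Λ
  y : G.InfinitePath
  r_α : G.r α = G.s (hP.pair g).1
  r_β : G.r β = G.s (hP.pair h).1
  r_γ : G.r γ = G.s (hP.pair (g.mul h hgh)).1
  s_α : G.s α = y.range
  s_β : G.s β = y.range
  s_γ : G.s γ = y.range
  rng_eq : G.comp (hP.pair g).1 α = G.comp (hP.pair (g.mul h hgh)).1 γ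
  src_eq : G.comp (hP.pair h).2 β = G.comp (hP.pair (g.mul h hgh)).2 γ
  mid_eq : G.comp (hP.pair g).2 α = G.comp (hP.pair h).1 β
  rng_g : g.rng.IsConcat (G.comp (hP.pair g).1 α) y
  src_g : g.src.IsConcat (G.comp (hP.pair g).2 α) y
  rng_h : h.rng.IsConcat (G.comp (hP.pair h).1 β) y
  src_h : h.src.IsConcat (G.comp (hP.pair h).2 β) y
  rng_gh : (g.mul h hgh).rng.IsConcat (G.comp (hP.pair (g.mul h hgh)).1 γ) y
  src_gh : (g.mul h hgh).src.IsConcat (G.comp (hP.pair (g.mul h hgh)).2 γ) y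

theorem InfinitePath.IsConcat.range_eq {G : KGraph k Λ} {x z : G.InfinitePath} {μ : Λ}
    (h : x.IsConcat μ z) : z.range = G.s μ := by
  obtain ⟨h1, rfl⟩ := h
  conv_rhs => rw [← h1, x.s_toFun]
  simp only [InfinitePath.range, InfinitePath.shift, zero_add]

theorem InfinitePath.IsConcat.extend {G : KGraph k Λ} {x z : G.InfinitePath} {μ : Λ}
    (h : x.IsConcat μ z) (p : Fin k → ℕ) :
    G.d (G.comp μ (z.toFun 0 p zero_le)) = G.d μ + p ∧
      x.IsConcat (G.comp μ (z.toFun 0 p zero_le)) (z.shift p) := by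
  have hd : G.d (G.comp μ (z.toFun 0 p zero_le)) = G.d μ + p := by
    rw [G.d_comp _ _ (by rw [← h.range_eq, z.r_toFun]; rfl), z.d_toFun, tsub_zero]
  refine ⟨hd, ?_, ?_⟩
  · obtain ⟨h1, rfl⟩ := h
    have h2 := x.comp_toFun 0 (0 + G.d μ) (p + G.d μ) (by simp) (add_le_add zero_le le_rfl)
    simp only [zero_add, h1] at h2
    simp only [InfinitePath.shift, zero_add, h2]
    congr 1
    rw [x.d_toFun, tsub_zero]
  · rw [hd, ← h.2, InfinitePath.shift_shift, add_comm]

theorem InfinitePath.IsConcat.unique {G : KGraph k Λ} {x y z : G.InfinitePath} {μ ν : Λ}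
    (h : x.IsConcat μ y) (h' : x.IsConcat ν z) (hd : G.d μ = G.d ν) : μ = ν ∧ y = z := by
  obtain ⟨h1, rfl⟩ := h
  obtain ⟨h2, rfl⟩ := h'
  refine ⟨?_, by rw [hd]⟩
  rw [← h1, ← h2]
  congr 1

theorem Refinement.nonempty {G : KGraph k Λ} {P : Set (Λ × Λ)} (hP : G.IsPartition P)
    (g h : G.PathGroupoid) (hgh : g.src = h.rng) : Nonempty (Refinement hP g h hgh) := by
  obtain ⟨dg, zg, rg, ag, bg⟩ := hP.pair_mem g
  obtain ⟨dh, zh, rh, ah, bh⟩ := hP.pair_mem h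
  obtain ⟨dk, zk, rk, ak, bk⟩ := hP.pair_mem (g.mul h hgh)
  generalize hpg : hP.pair g = pg at *
  generalize hph : hP.pair h = ph at *
  generalize hpk : hP.pair (g.mul h hgh) = pk at *
  obtain ⟨ag1, ag2⟩ := ag.extend (G.d pk.1 + G.d ph.1)
  obtain ⟨bg1, bg2⟩ := bg.extend (G.d pk.1 + G.d ph.1)
  obtain ⟨ah1, ah2⟩ := ah.extend (G.d pk.1 + G.d pg.2)
  obtain ⟨bh1, bh2⟩ := bh.extend (G.d pk.1 + G.d pg.2)
  obtain ⟨ak1, ak2⟩ := ak.extend (G.d pg.1 + G.d ph.1)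
  obtain ⟨bk1, bk2⟩ := bk.extend (G.d pg.1 + G.d ph.1)
  rw [hgh] at bg2
  obtain ⟨e1, y1⟩ := InfinitePath.IsConcat.unique (x := g.rng) ag2 ak2
    (by rw [ag1, ak1]; funext i; simp only [Pi.add_apply]; ring)
  obtain ⟨e2, y2⟩ := bg2.unique ah2
    (by rw [bg1, ah1]; funext i; simp only [Pi.add_apply]; ring)
  obtain ⟨e3, y3⟩ := InfinitePath.IsConcat.unique (x := h.src) bh2 bk2 (by
    rw [bh1, bk1]
    funext i
    have h1 := congrFun dg i
    have h2 := congrFun dh i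
    have h3 : g.deg i + h.deg i = _ := congrFun dk i
    simp only [Pi.add_apply, Pi.sub_apply, toInt] at *
    omega)
  exact ⟨{
    α := zg.toFun 0 (G.d pk.1 + G.d ph.1) zero_le
    β := zh.toFun 0 (G.d pk.1 + G.d pg.2) zero_le
    γ := zk.toFun 0 (G.d pg.1 + G.d ph.1) zero_le
    y := zg.shift (G.d pk.1 + G.d ph.1)
    r_α := by rw [hpg, zg.r_toFun]; exact rg
    r_β := by rw [hph, zh.r_toFun]; exact rh
    r_γ := by rw [hpk, zk.r_toFun]; exact rk
    s_α := by rw [zg.s_toFun]; simp only [InfinitePath.range, InfinitePath.shift, zero_add]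
    s_β := by
      rw [zh.s_toFun, y2]; simp only [InfinitePath.range, InfinitePath.shift, zero_add]
    s_γ := by
      rw [zk.s_toFun, y1]; simp only [InfinitePath.range, InfinitePath.shift, zero_add]
    rng_eq := by rw [hpg, hpk]; exact e1
    src_eq := by rw [hph, hpk]; exact e3
    mid_eq := by rw [hpg, hph]; exact e2
    rng_g := by rw [hpg]; exact ag2
    src_g := by rw [hpg, hgh]; exact bg2
    rng_h := by rw [hph, y2]; exact ah2
    src_h := by rw [hph, y2]; exact bh2
    rng_gh := by rw [hpk, y1]; exact ak2
    src_gh := by rw [hpk, y1]; exact bk2 }⟩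

/-- The value `c(μ_g, α) c(ν_g, α)⁻¹ c(μ_h, β) c(ν_h, β)⁻¹ (c(μ_{gh}, γ) c(ν_{gh}, γ)⁻¹)⁻¹`. It
is the same for all choices of `α, β, γ, y`. -/
def Refinement.value {G : KGraph k Λ} {P : Set (Λ × Λ)} {hP : G.IsPartition P}
    {g h : G.PathGroupoid} {hgh : g.src = h.rng} (R : Refinement hP g h hgh)
    (c : G.TwoCocycle) : Circle :=
  (c (hP.pair g).1 R.α * (c (hP.pair g).2 R.α)⁻¹) *
    (c (hP.pair h).1 R.β * (c (hP.pair h).2 R.β)⁻¹) *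
    (c (hP.pair (g.mul h hgh)).1 R.γ * (c (hP.pair (g.mul h hgh)).2 R.γ)⁻¹)⁻¹

/-- The groupoid `2`-cocycle `σ_c` produced from `c` by the partition `P`. -/
def groupoidCocycle {G : KGraph k Λ} {P : Set (Λ × Λ)} (hP : G.IsPartition P)
    (c : G.TwoCocycle) (g h : G.PathGroupoid) (hgh : g.src = h.rng) : Circle :=
  (Classical.choice (Refinement.nonempty hP g h hgh)).value c

/-! ### Twisted groupoid `C*`-algebras

Throughout, `σ` is a function on the composable pairs of the path groupoid with values in the
circle, in practice a continuous `2`-cocycle. -/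

/-- The twisted convolution `(f * f')(γ) = ∑_{αβ = γ} σ(α, β) f(α) f'(β)`. -/
def conv {G : KGraph k Λ} (σ : ∀ g h : G.PathGroupoid, g.src = h.rng → Circle)
    (f f' : G.PathGroupoid → ℂ) (γ : G.PathGroupoid) : ℂ :=
  ∑ᶠ p : {p : G.PathGroupoid × G.PathGroupoid // ∃ h : p.1.src = p.2.rng, p.1.mul p.2 h = γ},
    (σ p.1.1 p.1.2 p.2.choose : ℂ) * f p.1.1 * f' p.1.2

/-- The twisted involution `f^*(γ) = conj (σ(γ⁻¹, γ) f(γ⁻¹))`. -/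
def convStar {G : KGraph k Λ} (σ : ∀ g h : G.PathGroupoid, g.src = h.rng → Circle)
    (f : G.PathGroupoid → ℂ) (γ : G.PathGroupoid) : ℂ :=
  star (σ γ.inv γ rfl : ℂ) * star (f γ.inv)

/-- The `I`-norm: the larger of `sup_x ∑_{r(γ) = x} |f(γ)|` and `sup_x ∑_{s(γ) = x} |f(γ)|`. -/
def iNorm {G : KGraph k Λ} (f : G.PathGroupoid → ℂ) : ℝ≥0∞ :=
  max (⨆ x : G.InfinitePath, ∑' γ : {γ : G.PathGroupoid // γ.rng = x}, ‖f γ‖ₑ)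
    (⨆ x : G.InfinitePath, ∑' γ : {γ : G.PathGroupoid // γ.src = x}, ‖f γ‖ₑ)

/-- A bounded representation of the `*`-algebra `C_c(𝒢, σ)` on a Hilbert space: a linear map
`L : C_c(𝒢) → B(H)` with `L(f * f') = L(f) L(f')`, `L(f^*) = L(f)^*` and `‖L(f)‖ ≤ ‖f‖_I`. -/
structure BoundedRep {G : KGraph k Λ}
    (σ : ∀ g h : G.PathGroupoid, g.src = h.rng → Circle) where
  H : Type u
  [normed : NormedAddCommGroup H]
  [inner : InnerProductSpace ℂ H]
  [complete : CompleteSpace H]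
  L : C_c(G.PathGroupoid, ℂ) →ₗ[ℂ] (H →L[ℂ] H)
  map_conv : ∀ f f' F : C_c(G.PathGroupoid, ℂ), (∀ γ, F γ = conv σ f f' γ) → L F = L f * L f'
  map_star : ∀ f F : C_c(G.PathGroupoid, ℂ), (∀ γ, F γ = convStar σ f γ) → L F = star (L f)
  bounded : ∀ f : C_c(G.PathGroupoid, ℂ), ‖L f‖ₑ ≤ iNorm f

attribute [instance] BoundedRep.normed BoundedRep.inner BoundedRep.complete

/-- The full twisted groupoid algebra `C*(𝒢, σ)`, the completion of `C_c(𝒢, σ)` in the norm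
`‖f‖ = sup ‖L(f)‖` over all bounded representations `L`: the closure of the image of `C_c(𝒢, σ)`
under the direct sum of all bounded representations. -/
abbrev FullAlgebra {G : KGraph k Λ} (σ : ∀ g h : G.PathGroupoid, g.src = h.rng → Circle) :
    Type (u + 1) :=
  GeneratedCStar {a : lp (fun i : BoundedRep σ => i.H →L[ℂ] i.H) ∞ |
    ∃ f : C_c(G.PathGroupoid, ℂ), ∀ i, a i = i.L f}

/-- `ℓ²(𝒢_x)`, where `𝒢_x` is the set of elements of the groupoid with source `x`. -/
def FibreSpace (G : KGraph k Λ) (x : G.InfinitePath) : Type u :=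
  lp (fun _ : {γ : G.PathGroupoid // γ.src = x} => ℂ) 2

instance (G : KGraph k Λ) (x : G.InfinitePath) : NormedAddCommGroup (G.FibreSpace x) :=
  inferInstanceAs (NormedAddCommGroup (lp (fun _ : {γ : G.PathGroupoid // γ.src = x} => ℂ) 2))

instance (G : KGraph k Λ) (x : G.InfinitePath) : InnerProductSpace ℂ (G.FibreSpace x) :=
  inferInstanceAs (InnerProductSpace ℂ (lp (fun _ : {γ : G.PathGroupoid // γ.src = x} => ℂ) 2))

instance (G : KGraph k Λ) (x : G.InfinitePath) : CompleteSpace (G.FibreSpace x) :=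
  inferInstanceAs (CompleteSpace (lp (fun _ : {γ : G.PathGroupoid // γ.src = x} => ℂ) 2))

instance (G : KGraph k Λ) (x : G.InfinitePath) :
    CoeFun (G.FibreSpace x) (fun _ => {γ : G.PathGroupoid // γ.src = x} → ℂ) :=
  ⟨fun ξ => ξ.1⟩

/-- The operator `T` on `ℓ²(𝒢_x)` is left `σ`-convolution by `f`:
`(T ξ)(γ) = ∑_{αβ = γ} σ(α, β) f(α) ξ(β)`. -/
def IsLeftConv {G : KGraph k Λ} (σ : ∀ g h : G.PathGroupoid, g.src = h.rng → Circle)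
    (f : G.PathGroupoid → ℂ) (x : G.InfinitePath)
    (T : G.FibreSpace x →L[ℂ] G.FibreSpace x) : Prop :=
  ∀ (ξ : G.FibreSpace x) (γ : {γ : G.PathGroupoid // γ.src = x}),
    T ξ γ =
      ∑ᶠ p : {p : G.PathGroupoid × {β : G.PathGroupoid // β.src = x} //
          ∃ h : p.1.src = p.2.1.rng, p.1.mul p.2.1 h = γ.1},
        (σ p.1.1 p.1.2.1 p.2.choose : ℂ) * f p.1.1 * ξ p.1.2

/-- The reduced twisted groupoid algebra `C*_r(𝒢, σ)`: the closure of the image of `C_c(𝒢, σ)`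
under the direct sum over the units `x` of the left regular representations on `ℓ²(𝒢_x)`. -/
abbrev ReducedAlgebra {G : KGraph k Λ} (σ : ∀ g h : G.PathGroupoid, g.src = h.rng → Circle) :
    Type u :=
  GeneratedCStar {a : lp (fun x : G.InfinitePath => G.FibreSpace x →L[ℂ] G.FibreSpace x) ∞ |
    ∃ f : C_c(G.PathGroupoid, ℂ), ∀ x, IsLeftConv σ f x (a x)}

end KGraph

end

noncomputable section

namespace KGraph

variable {k : ℕ} {Λ : Type u} {G : KGraph k Λ}

/-! ### Paths -/

/-! The function on the groupoid that plays the role of `t_μ t_ν^*` is not the indicator of `Z(μ,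
ν)` but that indicator multiplied by a locally constant circle-valued phase (`phase`, `cylFun`). The
phase compares `(μ, ν)` with the partition pair of `g` through a common refinement, by the ratio
`c(μ, α) c(ν, α)⁻¹`. The cocycle identity of `c` makes it independent of the refinement
(`IsCommon.ratio_eq`). The central computation is `phase_mul_phase`: on composable elements of `Z(a,
b)` and `Z(b, e)`, the cocycle `σ_c` is the coboundary of the phases. From it follow the cocycle
identity of `σ_c` and the matrix-unit relations of the functions `cylFun` (`conv_cylFun`,
`convStar_cylFun`). Hence every bounded representation of `C_c` carries a Cuntz-Krieger family
(`isFamily_rep`).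

All three algebras are generated inside `ℓ^∞`-direct sums, so the comparison maps are restrictions
of the index set: from all families to those given by representations (`toFull`), and from all
representations to the regular ones (`toReduced`). These are contractive homomorphisms. They have
the right dense ranges because the span of the functions `cylCc` is dense in the `I`-norm
(`exists_iNorm_sub_le`).

It remains to see that the composite is isometric, and then each factor is. This is a
gauge-invariant uniqueness argument (`norm_le_of_gauge`) that uses finite averages instead of
integration over the torus. A polynomial `a` in the generators has bounded degree spread, so summing
the translates of its `m`-th iterated square over sufficiently many roots of unity leaves a multiple
of its degree-zero part `q`. The sum consists of positive elements and so dominates each of them,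
which costs a factor polynomial in the degree spread. On degree zero, matrix units show that
families with nonzero vertex projections control all norms (`norm_le_of_deg_zero`). The C*-identity
turns the estimate into one for `‖a‖ ^ 2 ^ m`, and taking roots removes the polynomial factor
(`le_of_forall_pow_le`). The regular families meet the hypotheses: infinite paths start at every
vertex, and the gauge action is implemented by diagonal unitaries (`exists_gauge_unitary`). -/

theorem comp_inj {μ α ν β : Λ} (h1 : G.s μ = G.r α) (h2 : G.s ν = G.r β) (hd : G.d μ = G.d ν)
    (h : G.comp μ α = G.comp ν β) : μ = ν ∧ α = β := by
  have e : G.d α = G.d β := by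
    have := congrArg G.d h
    rw [G.d_comp _ _ h1, G.d_comp _ _ h2, hd] at this
    exact add_left_cancel this
  obtain ⟨p, -, hp⟩ := G.factorisation (G.comp μ α) (G.d μ) (G.d α) (G.d_comp _ _ h1)
  have a := hp (μ, α) ⟨h1, rfl, rfl, rfl⟩
  have b := hp (ν, β) ⟨h2, hd.symm, e.symm, h⟩
  exact Prod.ext_iff.mp (a.trans b.symm)

theorem comp_left_cancel {μ α β : Λ} (h1 : G.s μ = G.r α) (h2 : G.s μ = G.r β)
    (h : G.comp μ α = G.comp μ β) : α = β :=
  (comp_inj h1 h2 rfl h).2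

theorem exists_factor (l : Λ) (n : Fin k → ℕ) (h : n ≤ G.d l) :
    ∃ α β, G.s α = G.r β ∧ G.d α = n ∧ G.d β = G.d l - n ∧ l = G.comp α β := by
  obtain ⟨p, hp, -⟩ := G.factorisation l n (G.d l - n) (add_tsub_cancel_of_le h).symm
  exact ⟨p.1, p.2, hp⟩

/-- Both `r(v) v` and `v s(v)` factor `v` into paths of degree zero, so unique factorisation
identifies their first factors. Thus paths of degree zero are identities. -/
theorem IsVertex.r_eq {v : Λ} (hv : G.IsVertex v) : G.r v = v := by
  have := comp_inj (G := G) (μ := G.r v) (α := v) (ν := v) (β := G.s v) (G.s_r v) (G.r_s v).symm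
    (by rw [G.d_r]; exact hv.symm) (by rw [G.r_comp_self, G.comp_s_self])
  exact this.1

theorem IsVertex.s_eq {v : Λ} (hv : G.IsVertex v) : G.s v = v := by
  have := G.s_r v
  rwa [hv.r_eq] at this

theorem isVertex_s (l : Λ) : G.IsVertex (G.s l) := G.d_s l

theorem isVertex_r (l : Λ) : G.IsVertex (G.r l) := G.d_r l

theorem comp_vertex {μ v : Λ} (hv : G.IsVertex v) (h : G.s μ = G.r v) : G.comp μ v = μ := by
  have : v = G.s μ := by rw [h, hv.r_eq]
  rw [this, G.comp_s_self]

/-! ### Infinite paths -/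

namespace InfinitePath

/-- The initial segment `x(0, n)`. -/
def init (x : G.InfinitePath) (n : Fin k → ℕ) : Λ := x.toFun 0 n zero_le

theorem toFun_congr (x : G.InfinitePath) {m m' n n' : Fin k → ℕ} (h : m ≤ n) (hm : m = m')
    (hn : n = n') : x.toFun m n h = x.toFun m' n' (hm ▸ hn ▸ h) := by
  subst hm hn
  rfl

theorem d_init (x : G.InfinitePath) (n : Fin k → ℕ) : G.d (x.init n) = n := by
  rw [init, x.d_toFun, tsub_zero]

theorem r_init (x : G.InfinitePath) (n : Fin k → ℕ) : G.r (x.init n) = x.range := x.r_toFun _ _ _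

theorem init_zero (x : G.InfinitePath) : x.init 0 = x.range := rfl

theorem isVertex_range (x : G.InfinitePath) : G.IsVertex x.range := x.d_init 0

theorem s_init (x : G.InfinitePath) (n : Fin k → ℕ) : G.s (x.init n) = (x.shift n).range := by
  rw [init, x.s_toFun]
  simp only [range, shift, zero_add]

theorem shift_zero (x : G.InfinitePath) : x.shift 0 = x := by
  ext m n h
  simp only [shift, add_zero]

theorem init_shift (x : G.InfinitePath) (m n : Fin k → ℕ) :
    (x.shift m).init n = x.toFun m (m + n) le_self_add :=
  x.toFun_congr _ (zero_add m) (add_comm n m)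

theorem init_add (x : G.InfinitePath) (m n : Fin k → ℕ) :
    x.init (m + n) = G.comp (x.init m) ((x.shift m).init n) := by
  rw [init_shift, init, init, x.comp_toFun]

theorem s_init_eq (x : G.InfinitePath) (m n : Fin k → ℕ) :
    G.s (x.init m) = G.r ((x.shift m).init n) := by
  rw [r_init, s_init]

/-- Cancelling `x(0, m)` on the left of `x(0, m + p)` recovers `x(m, m + p)`. -/
theorem ext_init {x y : G.InfinitePath} (h : ∀ n, x.init n = y.init n) : x = y := by
  ext m n hmn
  obtain ⟨p, rfl⟩ := le_iff_exists_add.mp hmn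
  have h1 := h (m + p)
  rw [init_add, init_add, h m] at h1
  have h2 := comp_left_cancel (h m ▸ x.s_init_eq m p) (y.s_init_eq m p) h1
  rwa [init_shift, init_shift] at h2

theorem isConcat_iff {x z : G.InfinitePath} {μ : Λ} :
    x.IsConcat μ z ↔ x.init (G.d μ) = μ ∧ x.shift (G.d μ) = z := Iff.rfl

theorem isConcat_init (x : G.InfinitePath) (n : Fin k → ℕ) :
    x.IsConcat (x.init n) (x.shift n) := by
  rw [isConcat_iff, d_init]
  exact ⟨rfl, rfl⟩

theorem isConcat_range (x : G.InfinitePath) : x.IsConcat x.range x := by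
  have := x.isConcat_init 0
  rwa [shift_zero] at this

theorem IsConcat.s_eq_r {x z : G.InfinitePath} {μ : Λ} (h : x.IsConcat μ z) (n : Fin k → ℕ) :
    G.s μ = G.r (z.init n) := by
  rw [r_init, h.range_eq]

theorem IsConcat.init_add {x z : G.InfinitePath} {μ : Λ} (h : x.IsConcat μ z) (n : Fin k → ℕ) :
    x.init (G.d μ + n) = G.comp μ (z.init n) := by
  have := x.init_add (G.d μ) n
  rwa [(isConcat_iff.mp h).1, h.2] at this

/-- The segments of degree `d(μ) + n` agree, both being `μ z(0, n)`; cutting them at degree `n`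
instead of `d(μ)` compares the initial segments of degree `n`. -/
theorem IsConcat.inj {x y z : G.InfinitePath} {μ : Λ} (h : x.IsConcat μ z)
    (h' : y.IsConcat μ z) : x = y := by
  refine ext_init fun n => ?_
  have e := (h.init_add n).trans (h'.init_add n).symm
  rw [add_comm, x.init_add, y.init_add] at e
  exact (comp_inj (x.s_init_eq _ _) (y.s_init_eq _ _) (by rw [d_init, d_init]) e).1

theorem isConcat_comp {x z : G.InfinitePath} {μ α : Λ} (hs : G.s μ = G.r α) :
    x.IsConcat (G.comp μ α) z ↔ ∃ w, x.IsConcat μ w ∧ w.IsConcat α z := by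
  constructor
  · intro h
    have h1 := h.1
    change x.init _ = _ at h1
    rw [G.d_comp _ _ hs, x.init_add] at h1
    obtain ⟨e1, e2⟩ := comp_inj (x.s_init_eq _ _) hs (x.d_init _) h1
    refine ⟨x.shift (G.d μ), ⟨e1, rfl⟩, e2, ?_⟩
    rw [shift_shift, ← h.2, G.d_comp _ _ hs, add_comm]
  · rintro ⟨w, h1, h2⟩
    have h3 := h1.init_add (G.d α)
    rw [← G.d_comp _ _ hs, (isConcat_iff.mp h2).1] at h3
    refine ⟨h3, ?_⟩
    rw [← h2.2, ← h1.2, shift_shift, G.d_comp _ _ hs, add_comm]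

end InfinitePath

/-! ### Existence of infinite paths -/

/-- A coherent family of paths of all degrees gives an infinite path. -/
theorem exists_infinitePath_of_coherent (C : (Fin k → ℕ) → Λ) (hd : ∀ n, G.d (C n) = n)
    (hC : ∀ m n, m ≤ n → ∃ β, G.s (C m) = G.r β ∧ C n = G.comp (C m) β) :
    ∃ x : G.InfinitePath, ∀ n, x.init n = C n := by
  -- The segment from `m` to `n` is the factor `b m n` with `C n = C m · b m n`; every functor law
  -- follows by cancelling `C m`.
  choose b hb1 hb2 using hC
  have hs : ∀ m n h, G.s (b m n h) = G.s (C n) := fun m n h => by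
    conv_rhs => rw [hb2 m n h, G.s_comp _ _ (hb1 m n h)]
  have hself : ∀ m, b m m le_rfl = G.s (C m) := fun m =>
    comp_left_cancel (hb1 m m le_rfl) (G.r_s _).symm (by rw [← hb2, G.comp_s_self])
  refine ⟨⟨b, ?_, ?_, ?_, ?_⟩, ?_⟩
  · intro m n h
    rw [hself, hb1]
  · intro m n h
    rw [hself, hs]
  · intro m n p h h'
    have hc : G.s (b m n h) = G.r (b n p h') := by rw [hs, hb1 n p h']
    refine comp_left_cancel (μ := C m) ?_ (hb1 m p _) ?_
    · rw [G.r_comp _ _ hc, hb1 m n h]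
    · rw [← G.assoc _ _ _ (hb1 m n h) hc, ← hb2, ← hb2, ← hb2]
  · intro m n h
    have h1 := G.d_comp _ _ (hb1 m n h)
    rw [← hb2 m n h, hd, hd] at h1
    exact eq_tsub_of_add_eq (by rw [add_comm]; exact h1.symm)
  · intro n
    have h0 : G.IsVertex (C 0) := hd 0
    have h1 := hb1 0 n zero_le
    rw [h0.s_eq] at h1
    change b 0 n _ = C n
    conv_rhs => rw [hb2 0 n zero_le, h1, G.r_comp_self]

/-- An increasing family of paths of cofinal degrees gives an infinite path. -/
theorem exists_infinitePath_of_increasing (L : (Fin k → ℕ) → Λ) (hd : ∀ n, n ≤ G.d (L n))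
    (hL : ∀ m n, m ≤ n → ∃ β, G.s (L m) = G.r β ∧ L n = G.comp (L m) β) :
    ∃ x : G.InfinitePath, ∀ n, x.init (G.d (L n)) = L n := by
  -- `C n` is the truncation of `L n` to degree exactly `n`, and `D n` is what is cut off.
  choose C D hCD hdC _ hL' using fun n => exists_factor (L n) n (hd n)
  obtain ⟨x, hx⟩ := exists_infinitePath_of_coherent C hdC (by
    intro m n hmn
    obtain ⟨β, hβ, e⟩ := hL m n hmn
    obtain ⟨γ, δ, h1, h2, -, h4⟩ := exists_factor (C n) m (by rw [hdC]; exact hmn)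
    have hDβ : G.s (D m) = G.r β := by rw [← hβ, hL' m, G.s_comp _ _ (hCD m)]
    have hδD : G.s δ = G.r (D n) := by rw [← hCD n, h4, G.s_comp _ _ h1]
    have e' : G.comp γ (G.comp δ (D n)) = G.comp (C m) (G.comp (D m) β) := by
      rw [← G.assoc _ _ _ h1 hδD, ← G.assoc _ _ _ (hCD m) hDβ, ← h4, ← hL' n, ← hL' m, e]
    have := (comp_inj (by rw [G.r_comp _ _ hδD, h1]) (by rw [G.r_comp _ _ hDβ, hCD])
      (by rw [h2, hdC]) e').1
    exact ⟨δ, this ▸ h1, this ▸ h4⟩)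
  refine ⟨x, fun n => ?_⟩
  set m := G.d (L n) with hm
  -- Since `m = d(L n)` is at least `n`, the path `L m` extends `L n`, so its truncation to degree
  -- `m` is `L n` itself.
  obtain ⟨β, hβ, e⟩ := hL n m (hd n)
  rw [hx]
  have hDβ : G.comp (C m) (D m) = G.comp (L n) β := by rw [← hL', e]
  exact (comp_inj (hCD m) hβ (by rw [hdC]) hDβ).1

/-- The concatenation `μy` exists. -/
theorem exists_isConcat (μ : Λ) (y : G.InfinitePath) (h : y.range = G.s μ) :
    ∃ x : G.InfinitePath, x.IsConcat μ y := by
  have hc : ∀ n, G.s μ = G.r (y.init n) := fun n => by rw [y.r_init, h]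
  have hd : ∀ n, G.d (G.comp μ (y.init n)) = G.d μ + n := fun n => by
    rw [G.d_comp _ _ (hc n), y.d_init]
  obtain ⟨x, hx⟩ := exists_infinitePath_of_increasing (G := G) (fun n => G.comp μ (y.init n))
    (fun n => by rw [hd]; exact le_add_self) (by
      intro m n hmn
      obtain ⟨p, rfl⟩ := le_iff_exists_add.mp hmn
      refine ⟨(y.shift m).init p, ?_, ?_⟩
      · rw [G.s_comp _ _ (hc m), y.s_init_eq m p]
      · rw [y.init_add, G.assoc _ _ _ (hc m) (y.s_init_eq m p)])
  have h0 : G.s μ = G.r y.range := by rw [y.isVertex_range.r_eq, h]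
  have h1 : x.init (G.d μ) = μ := by
    have := hx 0
    rwa [hd, add_zero, y.init_zero, comp_vertex y.isVertex_range h0] at this
  refine ⟨x, h1, InfinitePath.ext_init fun n => ?_⟩
  have h2 := hx n
  rw [hd, x.init_add, h1] at h2
  exact comp_left_cancel (by rw [← x.s_init_eq _ n, h1]) (hc n) h2

theorem exists_path_add (hsrc : G.NoSources) (v : Λ) (hv : G.IsVertex v) :
    ∃ L : ℕ → Λ, (∀ n, G.d (L n) = fun _ => n) ∧ (∀ n, G.r (L n) = v) ∧
      ∀ n p, ∃ β, G.s (L n) = G.r β ∧ L (n + p) = G.comp (L n) β := by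
  choose e he using fun l : Λ => hsrc (G.s l) (isVertex_s l) 1
  have he1 : ∀ l, G.s l = G.r (e l) := fun l => (he l).1.symm
  let L : ℕ → Λ := fun n => Nat.rec v (fun _ l => G.comp l (e l)) n
  have hL : ∀ n, L (n + 1) = G.comp (L n) (e (L n)) := fun n => rfl
  refine ⟨L, fun n => ?_, fun n => ?_, fun n p => ?_⟩
  · induction n with
    | zero => exact hv
    | succ n ih =>
      rw [hL, G.d_comp _ _ (he1 _), ih, (he _).2]
      funext i
      simp
  · induction n with
    | zero => exact hv.r_eq
    | succ n ih => rw [hL, G.r_comp _ _ (he1 _), ih]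
  · induction p with
    | zero => exact ⟨G.s (L n), (G.r_s _).symm, (G.comp_s_self _).symm⟩
    | succ p ih =>
      obtain ⟨β, h1, h2⟩ := ih
      have h3 : G.s β = G.r (e (L (n + p))) := by
        rw [← he1, h2, G.s_comp _ _ h1]
      refine ⟨G.comp β (e (L (n + p))), by rw [G.r_comp _ _ h3, h1], ?_⟩
      rw [← add_assoc, hL, ← G.assoc _ _ _ h1 h3, ← h2]

theorem exists_infinitePath (hsrc : G.NoSources) (v : Λ) (hv : G.IsVertex v) :
    ∃ x : G.InfinitePath, x.range = v := by
  obtain ⟨L, h1, h2, h3⟩ := exists_path_add hsrc v hv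
  -- The path `L` has diagonal degrees; the index `∑ i, n i` is monotone in `n` and bounds every
  -- coordinate of `n`.
  obtain ⟨x, hx⟩ := exists_infinitePath_of_increasing (G := G) (fun n => L (∑ i, n i))
    (fun n i => by
      rw [h1]
      exact Finset.single_le_sum (f := n) (fun _ _ => Nat.zero_le _) (Finset.mem_univ i))
    (fun m n hmn => by
      obtain ⟨p, hp⟩ := le_iff_exists_add.mp
        (Finset.sum_le_sum fun i _ => hmn i : ∑ i, m i ≤ ∑ i, n i)
      rw [hp]
      exact h3 _ p)
  refine ⟨x, ?_⟩
  rw [← x.r_init (G.d (L (∑ i, (0 : Fin k → ℕ) i))), hx, h2]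

/-! ### Cylinder sets -/

theorem mem_cylinder {μ ν : Λ} {g : G.PathGroupoid} :
    g ∈ G.cylinder μ ν ↔ g.deg = toInt (G.d μ) - toInt (G.d ν) ∧
      ∃ x : G.InfinitePath, g.rng.IsConcat μ x ∧ g.src.IsConcat ν x :=
  ⟨fun ⟨h, x, _, h1, h2⟩ => ⟨h, x, h1, h2⟩, fun ⟨h, x, h1, h2⟩ => ⟨h, x, h1.range_eq, h1, h2⟩⟩

theorem s_eq_of_mem_cylinder {μ ν : Λ} {g : G.PathGroupoid} (h : g ∈ G.cylinder μ ν) :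
    G.s μ = G.s ν := by
  obtain ⟨_, x, h1, h2, h3⟩ := h
  rw [← h1, h3.range_eq]

theorem toInt_add (m n : Fin k → ℕ) : toInt (m + n) = toInt m + toInt n := by
  funext i
  simp [toInt]

theorem toInt_injective : Function.Injective (toInt : (Fin k → ℕ) → Fin k → ℤ) := fun m n h =>
  funext fun i => by simpa [toInt] using congrFun h i

theorem d_src_eq {μ ν μ' ν' : Λ} {g : G.PathGroupoid} (h : g ∈ G.cylinder μ ν)
    (h' : g ∈ G.cylinder μ' ν') (hd : G.d μ = G.d μ') : G.d ν = G.d ν' := by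
  have := h.1.symm.trans h'.1
  rw [hd] at this
  exact toInt_injective (sub_right_inj.mp this)

/-- Every element of a cylinder set lies in arbitrarily small cylinder sets. -/
theorem exists_mem_cylinder_comp {μ ν : Λ} {g : G.PathGroupoid} (h : g ∈ G.cylinder μ ν)
    (p : Fin k → ℕ) : ∃ α, G.d α = p ∧ G.s μ = G.r α ∧ G.s ν = G.r α ∧
      g ∈ G.cylinder (G.comp μ α) (G.comp ν α) := by
  obtain ⟨hd, x, h1, h2⟩ := mem_cylinder.mp h
  refine ⟨x.init p, x.d_init p, h1.s_eq_r p, h2.s_eq_r p, mem_cylinder.mpr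
    ⟨?_, x.shift p, (h1.extend p).2, (h2.extend p).2⟩⟩
  rw [hd, G.d_comp _ _ (h1.s_eq_r p), G.d_comp _ _ (h2.s_eq_r p), toInt_add, toInt_add,
    add_sub_add_right_eq_sub]

theorem eq_of_mem_cylinder {μ ν μ' ν' : Λ} {g : G.PathGroupoid} (h : g ∈ G.cylinder μ ν)
    (h' : g ∈ G.cylinder μ' ν') (hd : G.d μ = G.d μ') : μ = μ' ∧ ν = ν' := by
  obtain ⟨_, x, h1, h2⟩ := mem_cylinder.mp h
  obtain ⟨_, y, h3, h4⟩ := mem_cylinder.mp h'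
  exact ⟨(h1.unique h3 hd).1, (h2.unique h4 (d_src_eq h h' hd)).1⟩

/-- Cylinder sets which meet are nested as soon as their degrees are comparable. -/
theorem exists_comp_of_mem_cylinder {μ ν a b : Λ} {g : G.PathGroupoid} (h : g ∈ G.cylinder a b)
    (h' : g ∈ G.cylinder μ ν) (hd : G.d μ ≤ G.d a) :
    ∃ α, G.s μ = G.r α ∧ G.s ν = G.r α ∧ a = G.comp μ α ∧ b = G.comp ν α := by
  obtain ⟨α, h1, h2, h3, h4⟩ := exists_mem_cylinder_comp h' (G.d a - G.d μ)
  obtain ⟨e1, e2⟩ := eq_of_mem_cylinder h h4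
    (by rw [G.d_comp _ _ h2, h1, add_tsub_cancel_of_le hd])
  exact ⟨α, h2, h3, e1, e2⟩

theorem cylinder_comp_subset {μ ν α : Λ} (h1 : G.s μ = G.r α) (h2 : G.s ν = G.r α) :
    G.cylinder (G.comp μ α) (G.comp ν α) ⊆ G.cylinder μ ν := by
  intro g hg
  obtain ⟨hd, x, h3, h4⟩ := mem_cylinder.mp hg
  obtain ⟨w, h5, h6⟩ := (InfinitePath.isConcat_comp h1).mp h3
  obtain ⟨w', h7, h8⟩ := (InfinitePath.isConcat_comp h2).mp h4
  obtain rfl := h6.inj h8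
  refine mem_cylinder.mpr ⟨?_, w, h5, h7⟩
  rw [hd, G.d_comp _ _ h1, G.d_comp _ _ h2, toInt_add, toInt_add, add_sub_add_right_eq_sub]

/-- Cylinder sets are bisections: the range map is injective on them. -/
theorem eq_of_rng_eq {μ ν : Λ} {g h : G.PathGroupoid} (hg : g ∈ G.cylinder μ ν)
    (hh : h ∈ G.cylinder μ ν) (e : g.rng = h.rng) : g = h := by
  obtain ⟨d1, x, h1, h2⟩ := mem_cylinder.mp hg
  obtain ⟨d2, y, h3, h4⟩ := mem_cylinder.mp hh
  rw [e] at h1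
  obtain rfl := (h1.unique h3 rfl).2
  exact PathGroupoid.ext e (d1.trans d2.symm) (h2.inj h4)

theorem eq_of_src_eq {μ ν : Λ} {g h : G.PathGroupoid} (hg : g ∈ G.cylinder μ ν)
    (hh : h ∈ G.cylinder μ ν) (e : g.src = h.src) : g = h := by
  obtain ⟨d1, x, h1, h2⟩ := mem_cylinder.mp hg
  obtain ⟨d2, y, h3, h4⟩ := mem_cylinder.mp hh
  rw [e] at h2
  obtain rfl := (h2.unique h4 rfl).2
  exact PathGroupoid.ext (h1.inj h3) (d1.trans d2.symm) e

/-- The element `(μx, d(μ) - d(ν), νx)`. -/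
theorem exists_groupoid_elem {μ ν : Λ} {x y z : G.InfinitePath} (h1 : x.IsConcat μ z)
    (h2 : y.IsConcat ν z) : ∃ g ∈ G.cylinder μ ν, g.rng = x ∧ g.src = y :=
  ⟨⟨x, _, y, G.d μ, G.d ν, rfl, h1.2.trans h2.2.symm⟩, mem_cylinder.mpr ⟨rfl, z, h1, h2⟩, rfl, rfl⟩

theorem mul_mem_cylinder {μ ν κ : Λ} {g h : G.PathGroupoid} (hg : g ∈ G.cylinder μ ν)
    (hh : h ∈ G.cylinder ν κ) (e : g.src = h.rng) : g.mul h e ∈ G.cylinder μ κ := by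
  obtain ⟨d1, x, h1, h2⟩ := mem_cylinder.mp hg
  obtain ⟨d2, y, h3, h4⟩ := mem_cylinder.mp hh
  rw [e] at h2
  obtain rfl := (h2.unique h3 rfl).2
  refine mem_cylinder.mpr ⟨?_, x, h1, h4⟩
  change g.deg + h.deg = _
  rw [d1, d2, sub_add_sub_cancel]

theorem inv_mem_cylinder {μ ν : Λ} {g : G.PathGroupoid} (hg : g ∈ G.cylinder μ ν) :
    g.inv ∈ G.cylinder ν μ := by
  obtain ⟨d1, x, h1, h2⟩ := mem_cylinder.mp hg
  refine mem_cylinder.mpr ⟨?_, x, h2, h1⟩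
  change -g.deg = _
  rw [d1, neg_sub]

theorem PathGroupoid.inv_inv (g : G.PathGroupoid) : g.inv.inv = g :=
  PathGroupoid.ext rfl (neg_neg g.deg) rfl

theorem inv_mem_cylinder_iff {μ ν : Λ} {g : G.PathGroupoid} :
    g.inv ∈ G.cylinder ν μ ↔ g ∈ G.cylinder μ ν :=
  ⟨fun h => g.inv_inv ▸ inv_mem_cylinder h, inv_mem_cylinder⟩

theorem exists_mem_cylinder (g : G.PathGroupoid) : ∃ μ ν, g ∈ G.cylinder μ ν := by
  obtain ⟨l, m, h1, h2⟩ := g.exists_shift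
  refine ⟨g.rng.init l, g.src.init m, mem_cylinder.mpr ⟨?_, g.rng.shift l, g.rng.isConcat_init l,
    h2 ▸ g.src.isConcat_init m⟩⟩
  rw [InfinitePath.d_init, InfinitePath.d_init, h1]

/-! ### The topology of the path groupoid -/

/-- Extending `(a, b)` along `g` by a path of degree `d(μ)` gives a cylinder around `g` long enough
to be nested in both given ones. -/
theorem isTopologicalBasis_cylinder : TopologicalSpace.IsTopologicalBasis
    {U : Set G.PathGroupoid | ∃ μ ν, G.s μ = G.s ν ∧ U = G.cylinder μ ν} where
  exists_subset_inter := by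
    rintro _ ⟨a, b, -, rfl⟩ _ ⟨μ, ν, -, rfl⟩ g ⟨h1, h2⟩
    obtain ⟨α, e1, e2, e3, e4⟩ := exists_mem_cylinder_comp h1 (G.d μ)
    obtain ⟨β, f1, f2, f3, f4⟩ := exists_comp_of_mem_cylinder e4 h2
      (by rw [G.d_comp _ _ e2, e1]; exact le_add_self)
    refine ⟨_, ⟨_, _, s_eq_of_mem_cylinder e4, rfl⟩, e4,
      Set.subset_inter (cylinder_comp_subset e2 e3) ?_⟩
    rw [f3, f4]
    exact cylinder_comp_subset f1 f2
  sUnion_eq := by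
    refine Set.eq_univ_of_forall fun g => ?_
    obtain ⟨μ, ν, h⟩ := exists_mem_cylinder g
    exact ⟨_, ⟨μ, ν, s_eq_of_mem_cylinder h, rfl⟩, h⟩
  eq_generateFrom := rfl

theorem isOpen_cylinder (μ ν : Λ) : IsOpen (G.cylinder μ ν) := by
  by_cases h : G.s μ = G.s ν
  · exact isTopologicalBasis_cylinder.isOpen ⟨μ, ν, h, rfl⟩
  · convert isOpen_empty
    exact Set.eq_empty_of_forall_notMem fun g hg => h (s_eq_of_mem_cylinder hg)

theorem exists_cylinder_subset {U : Set G.PathGroupoid} (hU : IsOpen U) {g : G.PathGroupoid}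
    (hg : g ∈ U) : ∃ a b, g ∈ G.cylinder a b ∧ G.cylinder a b ⊆ U := by
  obtain ⟨_, ⟨a, b, -, rfl⟩, h1, h2⟩ := isTopologicalBasis_cylinder.exists_subset_of_mem_open hg hU
  exact ⟨a, b, h1, h2⟩

/-- A cylinder `Z(aα, bα)` with `d(α) = d(μ)` that meets `Z(μ, ν)` is contained in it. So a point
outside has such a cylinder as a neighbourhood disjoint from `Z(μ, ν)`. -/
theorem isClosed_cylinder (μ ν : Λ) : IsClosed (G.cylinder μ ν) := by
  rw [← isOpen_compl_iff, isOpen_iff_forall_mem_open]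
  intro g hg
  obtain ⟨a, b, h⟩ := exists_mem_cylinder g
  obtain ⟨α, h1, h2, h3, h4⟩ := exists_mem_cylinder_comp h (G.d μ)
  refine ⟨_, fun g' hg' hn => hg ?_, isOpen_cylinder _ _, h4⟩
  obtain ⟨β, f1, f2, f3, f4⟩ := exists_comp_of_mem_cylinder hg' hn
    (by rw [G.d_comp _ _ h2, h1]; exact le_add_self)
  rw [f3, f4] at h4
  exact cylinder_comp_subset f1 f2 h4

/-- For every degree `n`, the cylinder is a finite union of the `Z(μα, να)` with `d(α) = n`, and an
ultrafilter selects one `α`. The selected paths cohere into an infinite path `y`, and the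
ultrafilter converges to the element with range `μy` and source `νy`. -/
theorem isCompact_cylinder (hfin : G.RowFinite) (μ ν : Λ) : IsCompact (G.cylinder μ ν) := by
  rw [isCompact_iff_ultrafilter_le_nhds]
  intro U hU
  have hZ : G.cylinder μ ν ∈ U := Filter.le_principal_iff.mp hU
  have hex : ∀ n, ∃ α, G.d α = n ∧ G.s μ = G.r α ∧ G.s ν = G.r α ∧
      G.cylinder (G.comp μ α) (G.comp ν α) ∈ U := by
    intro n
    have hf := hfin (G.s μ) (isVertex_s μ) n
    have hsub : G.cylinder μ ν ⊆ ⋃ α ∈ G.pathsFrom (G.s μ) n,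
        G.cylinder (G.comp μ α) (G.comp ν α) := by
      intro g hg
      obtain ⟨α, h1, h2, h3, h4⟩ := exists_mem_cylinder_comp hg n
      exact Set.mem_biUnion (show α ∈ G.pathsFrom (G.s μ) n from ⟨h2.symm, h1⟩) h4
    obtain ⟨α, hα, h⟩ := (Ultrafilter.finite_biUnion_mem_iff hf).mp (U.mem_of_superset hZ hsub)
    obtain ⟨g, hg⟩ := U.nonempty_of_mem hZ
    exact ⟨α, hα.2, hα.1.symm, (s_eq_of_mem_cylinder hg).symm.trans hα.1.symm, h⟩
  choose A hA1 hA2 hA3 hA4 using hex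
  have hnest : ∀ m n, m ≤ n → ∃ β, G.s (A m) = G.r β ∧ A n = G.comp (A m) β := by
    intro m n hmn
    obtain ⟨g, hg1, hg2⟩ := U.nonempty_of_mem (Filter.inter_mem (hA4 m) (hA4 n))
    obtain ⟨β, h1, h2, h3, h4⟩ := exists_comp_of_mem_cylinder hg2 hg1 (by
      rw [G.d_comp _ _ (hA2 m), G.d_comp _ _ (hA2 n), hA1, hA1]
      exact add_le_add le_rfl hmn)
    rw [G.s_comp _ _ (hA2 m)] at h1
    rw [G.assoc _ _ _ (hA2 m) h1] at h3
    exact ⟨β, h1, comp_left_cancel (hA2 n) (by rw [G.r_comp _ _ h1]; exact hA2 m) h3⟩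
  obtain ⟨y, hy⟩ := exists_infinitePath_of_coherent A hA1 hnest
  have hry : y.range = G.s μ := by rw [← y.r_init 0, hy, hA2 0]
  have hry' : y.range = G.s ν := by rw [← y.r_init 0, hy, hA3 0]
  obtain ⟨x, hx⟩ := exists_isConcat μ y hry
  obtain ⟨z, hz⟩ := exists_isConcat ν y hry'
  obtain ⟨g, hg, rfl, rfl⟩ := exists_groupoid_elem hx hz
  refine ⟨g, hg, fun V hV => ?_⟩
  obtain ⟨W, hWV, hW, hgW⟩ := mem_nhds_iff.mp hV
  obtain ⟨a, b, h1, h2⟩ := exists_cylinder_subset hW hgW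
  have hgA : g ∈ G.cylinder (G.comp μ (A (G.d a))) (G.comp ν (A (G.d a))) := by
    rw [← hy]
    refine mem_cylinder.mpr ⟨?_, _, (hx.extend (G.d a)).2, (hz.extend (G.d a)).2⟩
    rw [hg.1, G.d_comp _ _ (hx.s_eq_r _), G.d_comp _ _ (hz.s_eq_r _), toInt_add, toInt_add,
      add_sub_add_right_eq_sub]
  -- The selected path of degree `d(a)` is long enough for its cylinder to fit into the basic
  -- neighbourhood `Z(a, b)`.
  obtain ⟨β, e1, e2, e3, e4⟩ := exists_comp_of_mem_cylinder hgA h1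
    (by rw [G.d_comp _ _ (hA2 _), hA1]; exact le_add_self)
  refine U.mem_of_superset (hA4 (G.d a)) (Set.Subset.trans ?_ (h2.trans hWV))
  rw [e3, e4]
  exact cylinder_comp_subset e1 e2

end KGraph

namespace KGraph

variable {k : ℕ} {Λ : Type u} {G : KGraph k Λ}

/-! ### Phases -/

/-- `c(a, α) c(b, α)⁻¹`. -/
def TwoCocycle.ratio (c : G.TwoCocycle) (a b α : Λ) : Circle := c a α * (c b α)⁻¹

theorem TwoCocycle.apply_comp (c : G.TwoCocycle) {a α δ : Λ} (h1 : G.s a = G.r α)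
    (h3 : G.s α = G.r δ) :
    c a (G.comp α δ) = c a α * c (G.comp a α) δ * (c α δ)⁻¹ := by
  have h := c.cocycle a α δ h1 h3
  rw [mul_inv_eq_one] at h
  rw [← h]
  calc c a (G.comp α δ) = c a (G.comp α δ) * (c α δ * (c α δ)⁻¹) *
        (c (G.comp a α) δ * (c (G.comp a α) δ)⁻¹) := by
          rw [mul_inv_cancel, mul_inv_cancel, mul_one, mul_one]
    _ = _ := by ac_rfl

/-- The factor `c(α, δ)` in the cocycle identity does not involve the first path, so it cancels in
the quotient. -/
theorem TwoCocycle.ratio_comp (c : G.TwoCocycle) {a b α δ : Λ} (h1 : G.s a = G.r α)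
    (h2 : G.s b = G.r α) (h3 : G.s α = G.r δ) :
    c.ratio a b (G.comp α δ) = c.ratio a b α * c.ratio (G.comp a α) (G.comp b α) δ := by
  rw [ratio, ratio, ratio, c.apply_comp h1 h3, c.apply_comp h2 h3]
  simp only [mul_inv, inv_inv]
  rw [show c a α * c (G.comp a α) δ * (c α δ)⁻¹ * ((c b α)⁻¹ * (c (G.comp b α) δ)⁻¹ * c α δ) =
    c a α * (c b α)⁻¹ * (c (G.comp a α) δ * (c (G.comp b α) δ)⁻¹) * ((c α δ)⁻¹ * c α δ) by
      ac_rfl, inv_mul_cancel, mul_one]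

theorem TwoCocycle.ratio_self (c : G.TwoCocycle) (a α : Λ) : c.ratio a a α = 1 :=
  mul_inv_cancel _

theorem TwoCocycle.ratio_mul (c : G.TwoCocycle) (a b e α : Λ) :
    c.ratio a b α * c.ratio b e α = c.ratio a e α := by
  simp only [ratio, mul_assoc, inv_mul_cancel_left]

/-- `g` lies in `Z(aα, bα) = Z(μβ, νβ)`. -/
structure IsCommon (g : G.PathGroupoid) (a b μ ν α β : Λ) : Prop where
  r_left : G.s a = G.r α
  r_left' : G.s b = G.r α
  r_right : G.s μ = G.r β
  r_right' : G.s ν = G.r β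
  eq : G.comp a α = G.comp μ β
  eq' : G.comp b α = G.comp ν β
  mem : g ∈ G.cylinder (G.comp a α) (G.comp b α)

theorem exists_isCommon {g : G.PathGroupoid} {a b μ ν : Λ} (h : g ∈ G.cylinder a b)
    (h' : g ∈ G.cylinder μ ν) : ∃ α β, IsCommon g a b μ ν α β := by
  obtain ⟨α, e1, e2, e3, e4⟩ := exists_mem_cylinder_comp h (G.d μ)
  obtain ⟨β, f1, f2, f3, f4⟩ := exists_comp_of_mem_cylinder e4 h'
    (by rw [G.d_comp _ _ e2, e1]; exact le_add_self)
  exact ⟨α, β, e2, e3, f1, f2, f3, f4, e4⟩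

/-- Refining further by `δ` multiplies both ratios by the same number, because `aα = μβ` and `bα =
νβ`; hence their quotient is unchanged. Any two common refinements at `g` have a common further one.
-/
theorem IsCommon.ratio_eq {g : G.PathGroupoid} {a b μ ν α β α' β' : Λ}
    (h : IsCommon g a b μ ν α β) (h' : IsCommon g a b μ ν α' β') (c : G.TwoCocycle) :
    c.ratio a b α * (c.ratio μ ν β)⁻¹ = c.ratio a b α' * (c.ratio μ ν β')⁻¹ := by
  obtain ⟨δ, e1, e2, e3, e4⟩ := exists_mem_cylinder_comp h.mem (G.d (G.comp a α'))
  obtain ⟨δ', f1, f2, f3, f4⟩ := exists_comp_of_mem_cylinder e4 h'.mem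
    (by rw [G.d_comp _ _ e2, e1]; exact le_add_self)
  have sα : G.s α = G.r δ := by rw [← e2, G.s_comp _ _ h.r_left]
  have sα' : G.s α' = G.r δ' := by rw [← f1, G.s_comp _ _ h'.r_left]
  have sβ : G.s β = G.r δ := by rw [← e2, h.eq, G.s_comp _ _ h.r_right]
  have sβ' : G.s β' = G.r δ' := by rw [← f1, h'.eq, G.s_comp _ _ h'.r_right]
  have k1 : G.comp α δ = G.comp α' δ' := by
    refine comp_left_cancel (G := G) (μ := a) ?_ ?_ ?_
    · rw [G.r_comp _ _ sα, h.r_left]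
    · rw [G.r_comp _ _ sα', h'.r_left]
    · rw [← G.assoc _ _ _ h.r_left sα, f3, G.assoc _ _ _ h'.r_left sα']
  have k2 : G.comp β δ = G.comp β' δ' := by
    refine comp_left_cancel (G := G) (μ := μ) ?_ ?_ ?_
    · rw [G.r_comp _ _ sβ, h.r_right]
    · rw [G.r_comp _ _ sβ', h'.r_right]
    · rw [← G.assoc _ _ _ h.r_right sβ, ← h.eq, f3, h'.eq, G.assoc _ _ _ h'.r_right sβ']
  have aux : ∀ {α β δ : Λ}, IsCommon g a b μ ν α β → G.s α = G.r δ → G.s β = G.r δ →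
      c.ratio a b (G.comp α δ) * (c.ratio μ ν (G.comp β δ))⁻¹ =
        c.ratio a b α * (c.ratio μ ν β)⁻¹ := by
    intro α β δ h s1 s2
    rw [c.ratio_comp h.r_left h.r_left' s1, c.ratio_comp h.r_right h.r_right' s2, h.eq, h.eq',
      mul_inv, mul_mul_mul_comm, mul_inv_cancel, mul_one]
  rw [← aux h sα sβ, ← aux h' sα' sβ', k1, k2]

variable {P : Set (Λ × Λ)}

open Classical in
/-- The phase `c(a, α) c(b, α)⁻¹ (c(μ_g, β) c(ν_g, β)⁻¹)⁻¹` of `g ∈ Z(a, b)`, where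
`g ∈ Z(aα, bα) = Z(μ_g β, ν_g β)`. -/
def phase (hP : G.IsPartition P) (c : G.TwoCocycle) (a b : Λ) (g : G.PathGroupoid) : Circle :=
  if h : ∃ p : Λ × Λ, IsCommon g a b (hP.pair g).1 (hP.pair g).2 p.1 p.2 then
    c.ratio a b h.choose.1 * (c.ratio (hP.pair g).1 (hP.pair g).2 h.choose.2)⁻¹ else 1

theorem IsCommon.phase_eq {hP : G.IsPartition P} {g : G.PathGroupoid} {a b α β : Λ}
    (h : IsCommon g a b (hP.pair g).1 (hP.pair g).2 α β) (c : G.TwoCocycle) :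
    phase hP c a b g = c.ratio a b α * (c.ratio (hP.pair g).1 (hP.pair g).2 β)⁻¹ := by
  have hex : ∃ p : Λ × Λ, IsCommon g a b (hP.pair g).1 (hP.pair g).2 p.1 p.2 := ⟨(α, β), h⟩
  rw [phase, dif_pos hex]
  exact hex.choose_spec.ratio_eq h c

/-- A common refinement for `(aα, bα)` is one for `(a, b)` with the same partition side, so only the
ratio of `a` and `b` changes. This matches the expansion of `t_a t_b^*` over longer paths. -/
theorem phase_eq_ratio_mul (hP : G.IsPartition P) (c : G.TwoCocycle) {a b α : Λ}
    {g : G.PathGroupoid} (h1 : G.s a = G.r α) (h2 : G.s b = G.r α)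
    (hg : g ∈ G.cylinder (G.comp a α) (G.comp b α)) :
    phase hP c a b g = c.ratio a b α * phase hP c (G.comp a α) (G.comp b α) g := by
  obtain ⟨δ, β, h⟩ := exists_isCommon hg (hP.pair_mem g)
  have hδ : G.s α = G.r δ := by rw [← h.r_left, G.s_comp _ _ h1]
  have h' : IsCommon g a b (hP.pair g).1 (hP.pair g).2 (G.comp α δ) β :=
    { r_left := by rw [G.r_comp _ _ hδ, h1]
      r_left' := by rw [G.r_comp _ _ hδ, h2]
      r_right := h.r_right
      r_right' := h.r_right'
      eq := by rw [← G.assoc _ _ _ h1 hδ, h.eq]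
      eq' := by rw [← G.assoc _ _ _ h2 hδ, h.eq']
      mem := by rw [← G.assoc _ _ _ h1 hδ, ← G.assoc _ _ _ h2 hδ]; exact h.mem }
  rw [h'.phase_eq, h.phase_eq, c.ratio_comp h1 h2 hδ, mul_assoc]

theorem IsPartition.pair_eq (hP : G.IsPartition P) {g g' : G.PathGroupoid}
    (h : g' ∈ G.cylinder (hP.pair g).1 (hP.pair g).2) : hP.pair g' = hP.pair g :=
  ((hP.existsUnique g').choose_spec.2 _ ⟨(hP.existsUnique g).choose_spec.1.1, h⟩).symm

/-- The phase is locally constant. -/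
theorem exists_phase_eq (hP : G.IsPartition P) (c : G.TwoCocycle) {a b : Λ} {g : G.PathGroupoid}
    (h : g ∈ G.cylinder a b) : ∃ α, G.s a = G.r α ∧ G.s b = G.r α ∧
      g ∈ G.cylinder (G.comp a α) (G.comp b α) ∧
      ∀ g' ∈ G.cylinder (G.comp a α) (G.comp b α), phase hP c a b g' = phase hP c a b g := by
  obtain ⟨α, β, h⟩ := exists_isCommon h (hP.pair_mem g)
  refine ⟨α, h.r_left, h.r_left', h.mem, fun g' hg' => ?_⟩
  -- The refined cylinder lies inside the partition set of `g`, where the partition pair is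
  -- constant.
  have hp : hP.pair g' = hP.pair g := by
    refine hP.pair_eq (cylinder_comp_subset h.r_right h.r_right' ?_)
    rwa [← h.eq, ← h.eq']
  have h' : IsCommon g' a b (hP.pair g').1 (hP.pair g').2 α β := by
    rw [hp]
    exact { h with mem := hg' }
  rw [h'.phase_eq, h.phase_eq, hp]

/-- Elements of `Z(b, b)` have degree zero, so their partition pair has legs of equal degree; equal
extensions then force equal legs, and both ratios are `1`. -/
theorem phase_unit (hP : G.IsPartition P) (c : G.TwoCocycle) {b : Λ} {g : G.PathGroupoid}
    (hg : g ∈ G.cylinder b b) : phase hP c b b g = 1 := by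
  obtain ⟨α, β, h⟩ := exists_isCommon hg (hP.pair_mem g)
  have e : (hP.pair g).1 = (hP.pair g).2 :=
    (comp_inj h.r_right h.r_right' (by
      have h1 := (hP.pair_mem g).1
      rw [hg.1, sub_self] at h1
      exact toInt_injective (sub_eq_zero.mp h1.symm)) (h.eq.symm.trans h.eq')).1
  rw [h.phase_eq, e, c.ratio_self, c.ratio_self, inv_one, mul_one]

/-- On matched cylinders `σ_c` is a coboundary. All phases are computed on one refinement that
passes through the paths `α, β, γ` defining `σ_c`; the remaining ratios telescope. -/
theorem phase_mul_phase (hP : G.IsPartition P) (c : G.TwoCocycle) {a b e : Λ}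
    {g h : G.PathGroupoid} (hg : g ∈ G.cylinder a b) (hh : h ∈ G.cylinder b e)
    (hgh : g.src = h.rng) :
    phase hP c a b g * phase hP c b e h * groupoidCocycle hP c g h hgh =
      phase hP c a e (g.mul h hgh) := by
  rw [groupoidCocycle]
  generalize Classical.choice (Refinement.nonempty hP g h hgh) = R
  have mg := hP.pair_mem g
  have mh := hP.pair_mem h
  have mk := hP.pair_mem (g.mul h hgh)
  obtain ⟨dg, x, hx1, hx2⟩ := mem_cylinder.mp hg
  obtain ⟨dh, x', hx3, hx4⟩ := mem_cylinder.mp hh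
  rw [hgh] at hx2
  obtain rfl := (hx2.unique hx3 rfl).2
  have mk' := mul_mem_cylinder hg hh hgh
  have Mg : g ∈ G.cylinder (G.comp (hP.pair g).1 R.α) (G.comp (hP.pair g).2 R.α) := by
    refine mem_cylinder.mpr ⟨?_, R.y, R.rng_g, R.src_g⟩
    rw [mg.1, G.d_comp _ _ R.r_α.symm, G.d_comp _ _ (by rw [R.r_α, s_eq_of_mem_cylinder mg]),
      toInt_add, toInt_add, add_sub_add_right_eq_sub]
  have Mh : h ∈ G.cylinder (G.comp (hP.pair h).1 R.β) (G.comp (hP.pair h).2 R.β) := by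
    refine mem_cylinder.mpr ⟨?_, R.y, R.rng_h, R.src_h⟩
    rw [mh.1, G.d_comp _ _ R.r_β.symm, G.d_comp _ _ (by rw [R.r_β, s_eq_of_mem_cylinder mh]),
      toInt_add, toInt_add, add_sub_add_right_eq_sub]
  set μg := (hP.pair g).1
  set νg := (hP.pair g).2
  set μh := (hP.pair h).1
  set νh := (hP.pair h).2
  set μk := (hP.pair (g.mul h hgh)).1 with hμk
  set νk := (hP.pair (g.mul h hgh)).2 with hνk
  have rα : G.s μg = G.r R.α := R.r_α.symm
  have rα' : G.s νg = G.r R.α := by rw [← s_eq_of_mem_cylinder mg, rα]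
  have rβ : G.s μh = G.r R.β := R.r_β.symm
  have rβ' : G.s νh = G.r R.β := by rw [← s_eq_of_mem_cylinder mh, rβ]
  have rγ : G.s μk = G.r R.γ := R.r_γ.symm
  have rγ' : G.s νk = G.r R.γ := by rw [← s_eq_of_mem_cylinder mk, rγ]
  -- a common extension
  set p := G.d (G.comp μg R.α) + G.d (G.comp μh R.β) with hp
  set t := x.init p with ht
  have ta : G.s a = G.r t := hx1.s_eq_r p
  have tb : G.s b = G.r t := hx2.s_eq_r p
  have te : G.s e = G.r t := hx4.s_eq_r p
  have ng : g ∈ G.cylinder (G.comp a t) (G.comp b t) := by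
    refine mem_cylinder.mpr ⟨?_, _, (hx1.extend p).2, hgh ▸ (hx2.extend p).2⟩
    rw [dg, G.d_comp _ _ ta, G.d_comp _ _ tb, toInt_add, toInt_add, add_sub_add_right_eq_sub]
  have nh : h ∈ G.cylinder (G.comp b t) (G.comp e t) := by
    refine mem_cylinder.mpr ⟨?_, _, (hx3.extend p).2, (hx4.extend p).2⟩
    rw [dh, G.d_comp _ _ tb, G.d_comp _ _ te, toInt_add, toInt_add, add_sub_add_right_eq_sub]
  have nk := mul_mem_cylinder ng nh hgh
  have dt : G.d t = p := x.d_init p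
  obtain ⟨δ, g1, g2, g3, g4⟩ := exists_comp_of_mem_cylinder ng Mg (by
    rw [G.d_comp _ _ ta, dt, hp]
    exact le_add_left le_self_add)
  obtain ⟨δ', l1, l2, l3, l4⟩ := exists_comp_of_mem_cylinder nh Mh (by
    rw [G.d_comp _ _ tb, dt, hp]
    exact le_add_left le_add_self)
  -- The extensions obtained from `g` and from `h` coincide because both continue the same middle
  -- path `ν_g α = μ_h β`.
  obtain rfl : δ = δ' := by
    refine comp_left_cancel g2 ?_ (g4.symm.trans (l3.trans ?_))
    · rw [R.mid_eq]; exact l1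
    · rw [R.mid_eq]
  have sα : G.s R.α = G.r δ := by rw [← g1, G.s_comp _ _ rα]
  have sβ : G.s R.β = G.r δ := by rw [← l1, G.s_comp _ _ rβ]
  have sγ : G.s R.γ = G.r δ := by
    rw [R.s_γ, ← R.s_α, sα]
  have cg : IsCommon g a b μg νg t (G.comp R.α δ) :=
    { r_left := ta
      r_left' := tb
      r_right := by rw [G.r_comp _ _ sα, rα]
      r_right' := by rw [G.r_comp _ _ sα, rα']
      eq := by rw [g3, G.assoc _ _ _ rα sα]
      eq' := by rw [g4, G.assoc _ _ _ rα' sα]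
      mem := ng }
  have ch : IsCommon h b e μh νh t (G.comp R.β δ) :=
    { r_left := tb
      r_left' := te
      r_right := by rw [G.r_comp _ _ sβ, rβ]
      r_right' := by rw [G.r_comp _ _ sβ, rβ']
      eq := by rw [l3, G.assoc _ _ _ rβ sβ]
      eq' := by rw [l4, G.assoc _ _ _ rβ' sβ]
      mem := nh }
  have ck : IsCommon (g.mul h hgh) a e μk νk t (G.comp R.γ δ) :=
    { r_left := ta
      r_left' := te
      r_right := by rw [G.r_comp _ _ sγ, rγ]
      r_right' := by rw [G.r_comp _ _ sγ, rγ']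
      eq := by rw [g3, R.rng_eq, G.assoc _ _ _ rγ sγ]
      eq' := by rw [l4, R.src_eq, G.assoc _ _ _ rγ' sγ]
      mem := nk }
  have hv : R.value c = c.ratio μg νg R.α * c.ratio μh νh R.β * (c.ratio μk νk R.γ)⁻¹ := rfl
  rw [cg.phase_eq, ch.phase_eq, ck.phase_eq, hv, ← hμk, ← hνk, c.ratio_comp rα rα' sα,
    c.ratio_comp rβ rβ' sβ, c.ratio_comp rγ rγ' sγ, ← c.ratio_mul a b e]
  -- The ratio for `gh` telescopes through the shared middle path.
  have k1 : c.ratio (G.comp μk R.γ) (G.comp νk R.γ) δ =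
      c.ratio (G.comp μg R.α) (G.comp νg R.α) δ * c.ratio (G.comp μh R.β) (G.comp νh R.β) δ := by
    have e1 : G.comp μk R.γ = G.comp μg R.α := R.rng_eq.symm
    have e2 : G.comp νk R.γ = G.comp νh R.β := R.src_eq.symm
    have e3 : G.comp νg R.α = G.comp μh R.β := R.mid_eq
    rw [e1, e2, e3, c.ratio_mul]
  rw [k1]
  have key : ∀ A B C D E F H : Circle, A * (C * D)⁻¹ * (B * (E * F)⁻¹) * (C * E * H⁻¹) =
      A * B * (H * (D * F))⁻¹ := by
    intro A B C D E F H
    have hC := mul_inv_cancel C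
    have hE := mul_inv_cancel E
    calc A * (C * D)⁻¹ * (B * (E * F)⁻¹) * (C * E * H⁻¹) =
        A * B * (H * (D * F))⁻¹ * (C * C⁻¹) * (E * E⁻¹) := by
          simp only [mul_inv]; ac_rfl
      _ = _ := by rw [hC, hE, mul_one, mul_one]
  exact key _ _ _ _ _ _ _

/-! ### The cocycle identity -/

theorem exists_mem_cylinder_init (g : G.PathGroupoid) : ∃ n₀, ∀ n, n₀ ≤ n →
    ∃ a, g ∈ G.cylinder a (g.src.init n) := by
  obtain ⟨μ, ν, h⟩ := exists_mem_cylinder g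
  refine ⟨G.d ν, fun n hn => ?_⟩
  obtain ⟨p, rfl⟩ := le_iff_exists_add.mp hn
  obtain ⟨α, h1, h2, h3, h4⟩ := exists_mem_cylinder_comp h p
  obtain ⟨_, y, k1, k2⟩ := mem_cylinder.mp h4
  have k3 := (InfinitePath.isConcat_iff.mp k2).1
  rw [G.d_comp _ _ h3, h1] at k3
  exact ⟨_, k3 ▸ h4⟩

theorem exists_mem_cylinder_init' (g : G.PathGroupoid) : ∃ n₀, ∀ n, n₀ ≤ n →
    ∃ b, g ∈ G.cylinder (g.rng.init n) b := by
  obtain ⟨n₀, h⟩ := exists_mem_cylinder_init g.inv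
  exact ⟨n₀, fun n hn => (h n hn).imp fun b hb => inv_mem_cylinder_iff.mp hb⟩

/-- The coboundary formula needs cylinders with matching legs. The middle element is refined until
both its legs are long enough to serve as legs for its neighbours. -/
theorem exists_mem_cylinder_three {g h l : G.PathGroupoid} (h1 : g.src = h.rng)
    (h2 : h.src = l.rng) : ∃ a b e f, g ∈ G.cylinder a b ∧ h ∈ G.cylinder b e ∧
      l ∈ G.cylinder e f := by
  obtain ⟨μ, ν, hh⟩ := exists_mem_cylinder h
  obtain ⟨m, hm⟩ := exists_mem_cylinder_init g
  obtain ⟨n, hn⟩ := exists_mem_cylinder_init' l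
  obtain ⟨α, k1, k2, k3, k4⟩ := exists_mem_cylinder_comp hh (m + n)
  obtain ⟨_, y, l1, l2⟩ := mem_cylinder.mp k4
  obtain ⟨a, ha⟩ := hm (G.d (G.comp μ α)) (by
    rw [G.d_comp _ _ k2, k1]; exact le_add_left le_self_add)
  obtain ⟨f, hf⟩ := hn (G.d (G.comp ν α)) (by
    rw [G.d_comp _ _ k3, k1]; exact le_add_left le_add_self)
  rw [h1, (InfinitePath.isConcat_iff.mp l1).1] at ha
  rw [← h2, (InfinitePath.isConcat_iff.mp l2).1] at hf
  exact ⟨a, _, _, f, ha, k4, hf⟩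

theorem PathGroupoid.mul_assoc {g h l : G.PathGroupoid} (h1 : g.src = h.rng) (h2 : h.src = l.rng) :
    (g.mul h h1).mul l h2 = g.mul (h.mul l h2) h1 :=
  PathGroupoid.ext rfl (add_assoc g.deg h.deg l.deg) rfl

/-- The cocycle identity. -/
theorem groupoidCocycle_mul (hP : G.IsPartition P) (c : G.TwoCocycle) {g h l : G.PathGroupoid}
    (h1 : g.src = h.rng) (h2 : h.src = l.rng) :
    groupoidCocycle hP c g h h1 * groupoidCocycle hP c (g.mul h h1) l h2 =
      groupoidCocycle hP c h l h2 * groupoidCocycle hP c g (h.mul l h2) h1 := by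
  obtain ⟨a, b, e, f, ma, mb, me⟩ := exists_mem_cylinder_three h1 h2
  have k1 := phase_mul_phase hP c ma mb h1
  have k2 := phase_mul_phase hP c (mul_mem_cylinder ma mb h1) me h2
  have k3 := phase_mul_phase hP c mb me h2
  have k4 := phase_mul_phase hP c ma (mul_mem_cylinder mb me h2) h1
  rw [PathGroupoid.mul_assoc, ← k4, ← k3, ← k1] at k2
  -- After multiplication by the three phases, both sides equal the phase of the triple product.
  refine mul_left_cancel (a := phase hP c a b g * phase hP c b e h * phase hP c e f l) ?_
  calc _ = _ := ?_
    _ = _ := k2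
    _ = _ := ?_
  all_goals ac_rfl

end KGraph

namespace KGraph

variable {k : ℕ} {Λ : Type u} {G : KGraph k Λ}

/-! ### Functions supported on cylinder sets -/

variable {P : Set (Λ × Λ)}

/-- The function supported on `Z(μ, ν)` that corresponds to `t_μ t_ν^*`. -/
def cylFun (hP : G.IsPartition P) (c : G.TwoCocycle) (μ ν : Λ) : G.PathGroupoid → ℂ :=
  (G.cylinder μ ν).indicator fun g => (phase hP c μ ν g : ℂ)

theorem cylFun_of_mem (hP : G.IsPartition P) (c : G.TwoCocycle) {μ ν : Λ} {g : G.PathGroupoid}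
    (h : g ∈ G.cylinder μ ν) : cylFun hP c μ ν g = phase hP c μ ν g :=
  Set.indicator_of_mem h _

theorem cylFun_of_notMem (hP : G.IsPartition P) (c : G.TwoCocycle) {μ ν : Λ}
    {g : G.PathGroupoid} (h : g ∉ G.cylinder μ ν) : cylFun hP c μ ν g = 0 :=
  Set.indicator_of_notMem h _

theorem mem_of_cylFun_ne_zero {hP : G.IsPartition P} {c : G.TwoCocycle} {μ ν : Λ}
    {g : G.PathGroupoid} (h : cylFun hP c μ ν g ≠ 0) : g ∈ G.cylinder μ ν :=
  Set.mem_of_indicator_ne_zero h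

theorem isLocallyConstant_cylFun (hP : G.IsPartition P) (c : G.TwoCocycle) (μ ν : Λ) :
    IsLocallyConstant (cylFun hP c μ ν) := by
  rw [IsLocallyConstant.iff_exists_open]
  intro g
  by_cases hg : g ∈ G.cylinder μ ν
  · obtain ⟨α, h1, h2, h3, h4⟩ := exists_phase_eq hP c hg
    refine ⟨_, isOpen_cylinder _ _, h3, fun g' hg' => ?_⟩
    rw [cylFun_of_mem hP c hg, cylFun_of_mem hP c (cylinder_comp_subset h1 h2 hg'), h4 g' hg']
  · refine ⟨_, (isClosed_cylinder μ ν).isOpen_compl, hg, fun g' hg' => ?_⟩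
    rw [cylFun_of_notMem hP c hg, cylFun_of_notMem hP c hg']

/-- `cylFun` as an element of `C_c(𝒢)`. -/
def cylCc (hfin : G.RowFinite) (hP : G.IsPartition P) (c : G.TwoCocycle) (μ ν : Λ) :
    C_c(G.PathGroupoid, ℂ) where
  toFun := cylFun hP c μ ν
  continuous_toFun := (isLocallyConstant_cylFun hP c μ ν).continuous
  hasCompactSupport' := HasCompactSupport.intro' (isCompact_cylinder hfin μ ν)
    (isClosed_cylinder μ ν) fun _ h => cylFun_of_notMem hP c h

theorem coe_cylCc (hfin : G.RowFinite) (hP : G.IsPartition P) (c : G.TwoCocycle) (μ ν : Λ) :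
    ⇑(cylCc hfin hP c μ ν) = cylFun hP c μ ν := rfl

/-- The product `γ⁻¹γ` is a unit and has phase `1`, so the coboundary formula makes `σ(γ⁻¹, γ)`
times the phase of `γ⁻¹` the inverse of the phase of `γ`. -/
theorem convStar_cylFun (hP : G.IsPartition P) (c : G.TwoCocycle) (μ ν : Λ) :
    convStar (groupoidCocycle hP c) (cylFun hP c μ ν) = cylFun hP c ν μ := by
  funext γ
  rw [convStar]
  by_cases h : γ ∈ G.cylinder ν μ
  · have h' := inv_mem_cylinder h
    rw [cylFun_of_mem hP c h, cylFun_of_mem hP c h']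
    have hu := phase_mul_phase hP c h' h rfl
    rw [phase_unit hP c (mul_mem_cylinder h' h rfl)] at hu
    have e : groupoidCocycle hP c γ.inv γ rfl * phase hP c μ ν γ.inv = (phase hP c ν μ γ)⁻¹ := by
      rw [eq_inv_iff_mul_eq_one, ← hu]
      ac_rfl
    rw [← star_mul', ← Circle.coe_mul, e, Circle.coe_inv_eq_conj, ← Complex.star_def, star_star]
  · rw [cylFun_of_notMem hP c h, cylFun_of_notMem hP c (fun h' => h (inv_mem_cylinder_iff.mp h')),
      star_zero, mul_zero]

theorem conv_eq_zero {σ : ∀ g h : G.PathGroupoid, g.src = h.rng → Circle}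
    {f f' : G.PathGroupoid → ℂ} {γ : G.PathGroupoid}
    (h : ∀ g g' (e : g.src = g'.rng), g.mul g' e = γ → f g ≠ 0 → f' g' ≠ 0 → False) :
    conv σ f f' γ = 0 := by
  rw [conv, ← finsum_zero (α := {p : G.PathGroupoid × G.PathGroupoid //
    ∃ h : p.1.src = p.2.rng, p.1.mul p.2 h = γ})]
  refine finsum_congr fun ⟨⟨g, g'⟩, e1, e2⟩ => ?_
  by_cases h1 : f g = 0
  · simp [h1]
  by_cases h2 : f' g' = 0
  · simp [h2]
  exact (h g g' e1 e2 h1 h2).elim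

theorem conv_eq_single {σ : ∀ g h : G.PathGroupoid, g.src = h.rng → Circle}
    {f f' : G.PathGroupoid → ℂ} {γ g₀ h₀ : G.PathGroupoid} (e₀ : g₀.src = h₀.rng)
    (hγ : g₀.mul h₀ e₀ = γ)
    (h : ∀ g g' (e : g.src = g'.rng), g.mul g' e = γ → f g ≠ 0 → f' g' ≠ 0 → g = g₀ ∧ g' = h₀) :
    conv σ f f' γ = σ g₀ h₀ e₀ * f g₀ * f' h₀ := by
  rw [conv]
  refine finsum_eq_single _ (⟨(g₀, h₀), e₀, hγ⟩ : {p : G.PathGroupoid × G.PathGroupoid //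
    ∃ h : p.1.src = p.2.rng, p.1.mul p.2 h = γ}) ?_
  rintro ⟨⟨g, g'⟩, e1, e2⟩ hne
  by_cases h1 : f g = 0
  · simp [h1]
  by_cases h2 : f' g' = 0
  · simp [h2]
  obtain ⟨rfl, rfl⟩ := h g g' e1 e2 h1 h2
  exact (hne rfl).elim

/-- Cylinders are bisections, so at most one factorisation contributes at each `γ`, and the
coboundary formula evaluates it. The source condition ensures that the middle infinite path `νy`
exists. -/
theorem conv_cylFun (hP : G.IsPartition P) (c : G.TwoCocycle) {μ ν κ : Λ} (hs : G.s ν = G.s μ) :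
    conv (groupoidCocycle hP c) (cylFun hP c μ ν) (cylFun hP c ν κ) = cylFun hP c μ κ := by
  funext γ
  by_cases hγ : γ ∈ G.cylinder μ κ
  · obtain ⟨hd, y, h1, h2⟩ := mem_cylinder.mp hγ
    obtain ⟨z, hz⟩ := exists_isConcat ν y (by rw [h1.range_eq, hs])
    obtain ⟨g, hg, eg1, eg2⟩ := exists_groupoid_elem h1 hz
    obtain ⟨h, hh, eh1, eh2⟩ := exists_groupoid_elem hz h2
    have e : g.src = h.rng := eg2.trans eh1.symm
    have emul : g.mul h e = γ := eq_of_rng_eq (mul_mem_cylinder hg hh e) hγ eg1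
    rw [conv_eq_single e emul, cylFun_of_mem hP c hg, cylFun_of_mem hP c hh,
      cylFun_of_mem hP c hγ, ← Circle.coe_mul, ← Circle.coe_mul, ← emul,
      ← phase_mul_phase hP c hg hh e]
    · congr 1
      ac_rfl
    · intro g' h' e' emul' hg' hh'
      have mg := mem_of_cylFun_ne_zero hg'
      have mh := mem_of_cylFun_ne_zero hh'
      have k1 := congrArg PathGroupoid.rng emul'
      have k2 := congrArg PathGroupoid.src emul'
      exact ⟨eq_of_rng_eq mg hg (k1.trans eg1.symm), eq_of_src_eq mh hh (k2.trans eh2.symm)⟩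
  · rw [cylFun_of_notMem hP c hγ]
    refine conv_eq_zero fun g h e emul hg hh => hγ ?_
    rw [← emul]
    exact mul_mem_cylinder (mem_of_cylFun_ne_zero hg) (mem_of_cylFun_ne_zero hh) e

/-- An infinite path has only one initial segment of each degree, so no element of the first
cylinder composes with one of the second. -/
theorem conv_cylFun_eq_zero (hP : G.IsPartition P) (c : G.TwoCocycle) {μ ν κ ρ : Λ}
    (hd : G.d ν = G.d κ) (hne : ν ≠ κ) :
    conv (groupoidCocycle hP c) (cylFun hP c μ ν) (cylFun hP c κ ρ) = 0 := by
  funext γ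
  refine conv_eq_zero fun g h e _ hg hh => hne ?_
  obtain ⟨_, x, _, h1⟩ := mem_cylinder.mp (mem_of_cylFun_ne_zero hg)
  obtain ⟨_, y, h2, _⟩ := mem_cylinder.mp (mem_of_cylFun_ne_zero hh)
  rw [e] at h1
  exact (h1.unique h2 hd).1

/-- The cylinders `Z(μα, να)` with `d(α) = n` partition `Z(μ, ν)`, and on each of them the phases
differ by the ratio. -/
theorem cylCc_eq_sum (hfin : G.RowFinite) (hP : G.IsPartition P) (c : G.TwoCocycle) {μ ν : Λ}
    (hs : G.s μ = G.s ν) (n : Fin k → ℕ) :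
    cylCc hfin hP c μ ν = ∑ α ∈ (hfin (G.s μ) (isVertex_s μ) n).toFinset,
      (c.ratio μ ν α : ℂ) • cylCc hfin hP c (G.comp μ α) (G.comp ν α) := by
  classical
  ext g
  rw [CompactlySupportedContinuousMap.sum_apply]
  simp only [CompactlySupportedContinuousMap.smul_apply, coe_cylCc, smul_eq_mul]
  have hr : ∀ α ∈ (hfin (G.s μ) (isVertex_s μ) n).toFinset,
      G.s μ = G.r α ∧ G.s ν = G.r α ∧ G.d α = n := by
    intro α hα
    rw [Set.Finite.mem_toFinset] at hα
    exact ⟨hα.1.symm, hs ▸ hα.1.symm, hα.2⟩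
  by_cases hg : g ∈ G.cylinder μ ν
  · obtain ⟨α, h1, h2, h3, h4⟩ := exists_mem_cylinder_comp hg n
    rw [Finset.sum_eq_single α, cylFun_of_mem hP c hg, cylFun_of_mem hP c h4,
      phase_eq_ratio_mul hP c h2 h3 h4, Circle.coe_mul]
    · intro β hβ hne
      rw [cylFun_of_notMem, mul_zero]
      intro h5
      obtain ⟨k1, k2, k3⟩ := hr β hβ
      exact hne (comp_left_cancel k1 h2 (eq_of_mem_cylinder h5 h4
        (by rw [G.d_comp _ _ h2, G.d_comp _ _ k1, h1, k3])).1)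
    · intro hn
      exact (hn ((Set.Finite.mem_toFinset _).mpr ⟨h2.symm, h1⟩)).elim
  · rw [cylFun_of_notMem hP c hg]
    refine (Finset.sum_eq_zero fun α hα => ?_).symm
    obtain ⟨k1, k2, k3⟩ := hr α hα
    rw [cylFun_of_notMem hP c fun h => hg (cylinder_comp_subset k1 k2 h), mul_zero]

/-! ### Estimates in the `I`-norm -/

theorem tsum_enorm_indicator_le {X : Type*} (f : X → ℂ) {ε : ℝ≥0∞} (hε : ∀ x, ‖f x‖ₑ ≤ ε)
    {ι : Type*} (T : Finset ι) (Z : ι → Set X) (hsub : ∀ i ∈ T, (Z i).Subsingleton)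
    (hf : ∀ x, f x ≠ 0 → ∃ i ∈ T, x ∈ Z i) : ∑' x, ‖f x‖ₑ ≤ T.card * ε := by
  classical
  calc ∑' x, ‖f x‖ₑ ≤ ∑' x, ∑ i ∈ T, (Z i).indicator (fun _ => ε) x := by
        refine ENNReal.tsum_le_tsum fun x => ?_
        by_cases h : f x = 0
        · simp [h]
        obtain ⟨i, hi, hx⟩ := hf x h
        refine (hε x).trans ?_
        refine le_trans ?_ (Finset.single_le_sum (fun _ _ => zero_le) hi)
        rw [Set.indicator_of_mem hx]
    _ = ∑ i ∈ T, ∑' x, (Z i).indicator (fun _ => ε) x :=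
        Summable.tsum_finsetSum fun i _ => ENNReal.summable
    _ ≤ ∑ _i ∈ T, ε := by
        refine Finset.sum_le_sum fun i hi => ?_
        rcases (hsub i hi).eq_empty_or_singleton with h | ⟨a, h⟩
        · simp [h]
        · rw [h, tsum_eq_single a]
          · simp
          · intro b hb
            simp [hb]
    _ = T.card * ε := by rw [Finset.sum_const, nsmul_eq_mul]

/-- A cylinder meets each fibre of the range and source maps at most once. So uniform smallness on a
support covered by a fixed finite family gives smallness in the `I`-norm. -/
theorem iNorm_le_of_support (f : G.PathGroupoid → ℂ) {ε : ℝ≥0∞} (hε : ∀ x, ‖f x‖ₑ ≤ ε)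
    (T : Finset (Λ × Λ)) (hf : ∀ g, f g ≠ 0 → ∃ p ∈ T, g ∈ G.cylinder p.1 p.2) :
    iNorm f ≤ T.card * ε := by
  refine max_le (iSup_le fun x => ?_) (iSup_le fun x => ?_)
  · refine tsum_enorm_indicator_le (fun γ : {γ : G.PathGroupoid // γ.rng = x} => f γ)
      (fun γ => hε γ) T (fun p => {γ | γ.1 ∈ G.cylinder p.1 p.2}) ?_ fun γ hγ => hf γ hγ
    intro p _ γ hγ γ' hγ'
    exact Subtype.ext (eq_of_rng_eq hγ hγ' (γ.2.trans γ'.2.symm))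
  · refine tsum_enorm_indicator_le (fun γ : {γ : G.PathGroupoid // γ.src = x} => f γ)
      (fun γ => hε γ) T (fun p => {γ | γ.1 ∈ G.cylinder p.1 p.2}) ?_ fun γ hγ => hf γ hγ
    intro p _ γ hγ γ' hγ'
    exact Subtype.ext (eq_of_src_eq hγ hγ' (γ.2.trans γ'.2.symm))

theorem exists_finset_cylinder {K : Set G.PathGroupoid} (hK : IsCompact K) :
    ∃ T : Finset (Λ × Λ), ∀ g ∈ K, ∃ p ∈ T, g ∈ G.cylinder p.1 p.2 := by
  classical
  refine hK.induction_on ⟨∅, by simp⟩ ?_ ?_ ?_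
  · rintro s t hst ⟨T, hT⟩
    exact ⟨T, fun g hg => hT g (hst hg)⟩
  · rintro s t ⟨T, hT⟩ ⟨T', hT'⟩
    refine ⟨T ∪ T', fun g hg => ?_⟩
    rcases hg with hg | hg
    · obtain ⟨p, h1, h2⟩ := hT g hg
      exact ⟨p, Finset.mem_union_left _ h1, h2⟩
    · obtain ⟨p, h1, h2⟩ := hT' g hg
      exact ⟨p, Finset.mem_union_right _ h1, h2⟩
  · intro g _
    obtain ⟨μ, ν, h⟩ := exists_mem_cylinder g
    exact ⟨_, mem_nhdsWithin_of_mem_nhds ((isOpen_cylinder μ ν).mem_nhds h), {(μ, ν)},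
      fun g' hg' => ⟨(μ, ν), Finset.mem_singleton_self _, hg'⟩⟩

theorem exists_finset_support (f : C_c(G.PathGroupoid, ℂ)) :
    ∃ T : Finset (Λ × Λ), ∀ g, f g ≠ 0 → ∃ p ∈ T, g ∈ G.cylinder p.1 p.2 := by
  obtain ⟨T, hT⟩ := exists_finset_cylinder f.hasCompactSupport
  exact ⟨T, fun g hg => hT g (subset_tsupport _ hg)⟩

theorem iNorm_ne_top (f : C_c(G.PathGroupoid, ℂ)) : iNorm f ≠ ∞ := by
  obtain ⟨T, hT⟩ := exists_finset_support f
  obtain ⟨C, hC⟩ := f.hasCompactSupport.exists_bound_of_continuous f.continuous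
  refine ne_top_of_le_ne_top ?_ (iNorm_le_of_support f (ε := ENNReal.ofReal C) (fun x => ?_) T hT)
  · exact ENNReal.mul_ne_top (ENNReal.natCast_ne_top _) ENNReal.ofReal_ne_top
  · rw [← ofReal_norm]
    exact ENNReal.ofReal_le_ofReal (hC x)

/-! ### Density of the cylinder functions in the `I`-norm -/

/-- The span of the functions `cylCc μ ν`. -/
def cylSpan (hfin : G.RowFinite) (hP : G.IsPartition P) (c : G.TwoCocycle) :
    Submodule ℂ C_c(G.PathGroupoid, ℂ) :=
  Submodule.span ℂ (Set.range fun p : Λ × Λ => cylCc hfin hP c p.1 p.2)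

/-- Multiplication by the indicator function of `U` maps the span of the `cylCc μ ν` to itself. -/
def IsMultiplier (hfin : G.RowFinite) (hP : G.IsPartition P) (c : G.TwoCocycle)
    (U : Set G.PathGroupoid) : Prop :=
  ∀ w ∈ cylSpan hfin hP c, ∃ w' ∈ cylSpan hfin hP c, ∀ g, w' g = U.indicator w g

section

variable {hfin : G.RowFinite} {hP : G.IsPartition P} {c : G.TwoCocycle}

theorem cylCc_mem_cylSpan (μ ν : Λ) : cylCc hfin hP c μ ν ∈ cylSpan hfin hP c :=
  Submodule.subset_span ⟨(μ, ν), rfl⟩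

theorem isMultiplier_empty : IsMultiplier hfin hP c ∅ :=
  fun _ _ => ⟨0, Submodule.zero_mem _, fun g => by simp⟩

theorem IsMultiplier.union {U V : Set G.PathGroupoid} (hU : IsMultiplier hfin hP c U)
    (hV : IsMultiplier hfin hP c V) : IsMultiplier hfin hP c (U ∪ V) := by
  classical
  intro w hw
  obtain ⟨w1, h1, e1⟩ := hU w hw
  obtain ⟨w2, h2, e2⟩ := hV w hw
  obtain ⟨w3, h3, e3⟩ := hU w2 h2
  -- Inclusion-exclusion: `1_{U ∪ V} = 1_U + 1_V - 1_U 1_V`.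
  refine ⟨w1 + w2 - w3, Submodule.sub_mem _ (Submodule.add_mem _ h1 h2) h3, fun g => ?_⟩
  rw [CompactlySupportedContinuousMap.sub_apply, CompactlySupportedContinuousMap.add_apply, e1, e3]
  by_cases hgU : g ∈ U <;> by_cases hgV : g ∈ V <;> simp [Set.indicator, hgU, hgV, e2]

/-- Expanding `cylCc μ ν` over paths of degree `d(a)` gives pieces supported inside `Z(a, b)` or
disjoint from it; the pieces that meet it are kept. -/
theorem isMultiplier_cylinder (a b : Λ) : IsMultiplier hfin hP c (G.cylinder a b) := by
  classical
  set W := cylSpan hfin hP c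
  intro w hw
  refine Submodule.span_induction (p := fun (w : C_c(G.PathGroupoid, ℂ)) _ => ∃ w' ∈ W, ∀ g, w' g =
    (G.cylinder a b).indicator w g) ?_ ?_ ?_ ?_ hw
  · rintro _ ⟨⟨μ, ν⟩, rfl⟩
    by_cases hs : G.s μ = G.s ν
    · refine ⟨∑ α ∈ (hfin (G.s μ) (isVertex_s μ) (G.d a)).toFinset,
        if (G.cylinder (G.comp μ α) (G.comp ν α) ∩ G.cylinder a b).Nonempty then
          (c.ratio μ ν α : ℂ) • cylCc hfin hP c (G.comp μ α) (G.comp ν α) else 0, ?_, ?_⟩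
      · refine Submodule.sum_mem _ fun α _ => ?_
        split_ifs
        · exact Submodule.smul_mem _ _ (cylCc_mem_cylSpan _ _)
        · exact Submodule.zero_mem _
      · intro g
        change _ = (G.cylinder a b).indicator (cylCc hfin hP c μ ν) g
        rw [cylCc_eq_sum hfin hP c hs (G.d a), CompactlySupportedContinuousMap.sum_apply]
        by_cases hg : g ∈ G.cylinder a b
        · rw [Set.indicator_of_mem hg, CompactlySupportedContinuousMap.sum_apply]
          refine Finset.sum_congr rfl fun α _ => ?_
          by_cases hgα : g ∈ G.cylinder (G.comp μ α) (G.comp ν α)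
          · rw [if_pos ⟨g, hgα, hg⟩]
          · rw [CompactlySupportedContinuousMap.smul_apply, coe_cylCc, cylFun_of_notMem hP c hgα,
              smul_zero]
            split_ifs
            · rw [CompactlySupportedContinuousMap.smul_apply, coe_cylCc,
                cylFun_of_notMem hP c hgα, smul_zero]
            · rfl
        · rw [Set.indicator_of_notMem hg]
          refine Finset.sum_eq_zero fun α hα => ?_
          rw [Set.Finite.mem_toFinset] at hα
          split_ifs with hne
          · obtain ⟨g', h1, h2⟩ := hne
            obtain ⟨β, e1, e2, e3, e4⟩ := exists_comp_of_mem_cylinder h1 h2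
              (by rw [G.d_comp _ _ hα.1.symm, hα.2]; exact le_add_self)
            rw [CompactlySupportedContinuousMap.smul_apply, coe_cylCc, cylFun_of_notMem,
              smul_zero]
            rw [e3, e4]
            exact fun h => hg (cylinder_comp_subset e1 e2 h)
          · rfl
    · refine ⟨0, Submodule.zero_mem _, fun g => ?_⟩
      have : cylCc hfin hP c μ ν g = 0 :=
        cylFun_of_notMem hP c fun h => hs (s_eq_of_mem_cylinder h)
      simp [Set.indicator, this]
  · exact ⟨0, Submodule.zero_mem _, fun g => by simp⟩
  · rintro x y _ _ ⟨x', hx, ex⟩ ⟨y', hy, ey⟩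
    refine ⟨x' + y', Submodule.add_mem _ hx hy, fun g => ?_⟩
    rw [CompactlySupportedContinuousMap.add_apply, ex, ey]
    by_cases hg : g ∈ G.cylinder a b <;> simp [hg]
  · rintro t x _ ⟨x', hx, ex⟩
    refine ⟨t • x', Submodule.smul_mem _ _ hx, fun g => ?_⟩
    rw [CompactlySupportedContinuousMap.smul_apply, ex]
    by_cases hg : g ∈ G.cylinder a b <;> simp [hg]

theorem isMultiplier_biUnion (T : Finset (Λ × Λ)) :
    IsMultiplier hfin hP c (⋃ p ∈ T, G.cylinder p.1 p.2) := by
  classical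
  induction T using Finset.induction_on with
  | empty => simpa using isMultiplier_empty
  | insert p T _ ih =>
    rw [Finset.set_biUnion_insert]
    exact (isMultiplier_cylinder _ _).union ih

variable (hfin hP c) in
/-- The span of the functions `cylCc μ ν` is dense in `C_c(𝒢)` in the `I`-norm. -/
theorem exists_iNorm_sub_le (f : C_c(G.PathGroupoid, ℂ)) {ε : ℝ} (hε : 0 < ε) :
    ∃ h ∈ cylSpan hfin hP c, iNorm ⇑(f - h) ≤ ENNReal.ofReal ε := by
  classical
  obtain ⟨T, hT⟩ := exists_finset_support f
  -- The uniform error is multiplied by the number of cylinders in `T`; the added `1` in the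
  -- denominator covers empty `T`.
  obtain ⟨δ, hδ, hδε⟩ : ∃ δ > 0, T.card * δ ≤ ε := by
    refine ⟨ε / (T.card + 1), by positivity, ?_⟩
    rw [mul_div_assoc', div_le_iff₀ (by positivity)]
    nlinarith
  have key : ∃ U, tsupport f ⊆ U ∧ IsMultiplier hfin hP c U ∧ ∃ h ∈ cylSpan hfin hP c,
      (∀ g ∈ U, ‖f g - h g‖ ≤ δ) ∧ ∀ g ∉ U, h g = 0 := by
    refine IsCompact.induction_on (p := fun S => ∃ U, S ⊆ U ∧ IsMultiplier hfin hP c U ∧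
      ∃ h ∈ cylSpan hfin hP c, (∀ g ∈ U, ‖f g - h g‖ ≤ δ) ∧ ∀ g ∉ U, h g = 0)
      f.hasCompactSupport ?_ ?_ ?_ ?_
    · exact ⟨∅, subset_rfl, isMultiplier_empty, 0, Submodule.zero_mem _, by simp, by simp⟩
    · rintro s t hst ⟨U, hU, h⟩
      exact ⟨U, hst.trans hU, h⟩
    · rintro s t ⟨U, hU, mU, h, hh, h1, h2⟩ ⟨V, hV, mV, h', hh', h1', h2'⟩
      -- Gluing: keep `h` on `U` and use `h'` only off `U`, which needs the indicator of `U` to be a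
      -- multiplier.
      obtain ⟨w, hw, ew⟩ := mU h' hh'
      refine ⟨U ∪ V, Set.union_subset_union hU hV, mU.union mV, h + (h' - w),
        Submodule.add_mem _ hh (Submodule.sub_mem _ hh' hw), ?_, ?_⟩
      · intro g hg
        rw [CompactlySupportedContinuousMap.add_apply, CompactlySupportedContinuousMap.sub_apply,
          ew]
        by_cases hgU : g ∈ U
        · simpa [hgU] using h1 g hgU
        · simpa [hgU, h2 g hgU] using h1' g (hg.resolve_left hgU)
      · intro g hg
        have hgU : g ∉ U := fun h => hg (Or.inl h)
        have hgV : g ∉ V := fun h => hg (Or.inr h)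
        rw [CompactlySupportedContinuousMap.add_apply, CompactlySupportedContinuousMap.sub_apply,
          ew]
        simp [hgU, h2 g hgU, h2' g hgV]
    · intro g _
      have hopen : IsOpen {g' | ‖f g' - f g‖ < δ} :=
        isOpen_lt (by fun_prop) continuous_const
      obtain ⟨a, b, ha, hab⟩ := exists_cylinder_subset hopen
        (show g ∈ {g' | ‖f g' - f g‖ < δ} by simpa using hδ)
      -- On a smaller cylinder the phase is constant, so `cylCc a b` cut down to it and divided by
      -- the phase at `g` is an indicator function, which is scaled by `f g`.
      obtain ⟨α, h1, h2, h3, h4⟩ := exists_phase_eq hP c ha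
      obtain ⟨w, hw, ew⟩ := isMultiplier_cylinder (hfin := hfin) (hP := hP) (c := c)
        (G.comp a α) (G.comp b α) _ (cylCc_mem_cylSpan a b)
      refine ⟨_, mem_nhdsWithin_of_mem_nhds ((isOpen_cylinder _ _).mem_nhds h3), _, subset_rfl,
        isMultiplier_cylinder _ _, (f g * ((phase hP c a b g)⁻¹ : Circle)) • w,
        Submodule.smul_mem _ _ hw, ?_, ?_⟩
      · intro g' hg'
        have hg'' := cylinder_comp_subset h1 h2 hg'
        rw [CompactlySupportedContinuousMap.smul_apply, ew, Set.indicator_of_mem hg', coe_cylCc,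
          cylFun_of_mem hP c hg'', h4 g' hg', smul_eq_mul, mul_assoc, ← Circle.coe_mul,
          inv_mul_cancel, Circle.coe_one, mul_one]
        exact (hab hg'').le
      · intro g' hg'
        rw [CompactlySupportedContinuousMap.smul_apply, ew, Set.indicator_of_notMem hg', smul_zero]
  obtain ⟨U, hU, -, h, hh, h1, h2⟩ := key
  -- `U` may exceed the cylinders that fixed `δ`; cutting back to them restores the bound on the
  -- number of terms.
  obtain ⟨w, hw, ew⟩ := isMultiplier_biUnion (c := c) (hP := hP) T h hh
  refine ⟨w, hw, ?_⟩
  refine (iNorm_le_of_support _ (ε := ENNReal.ofReal δ) (fun g => ?_) T fun g hg => ?_).trans ?_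
  · rw [← ofReal_norm]
    refine ENNReal.ofReal_le_ofReal ?_
    rw [CompactlySupportedContinuousMap.sub_apply, ew]
    by_cases hgV : g ∈ ⋃ p ∈ T, G.cylinder p.1 p.2
    · rw [Set.indicator_of_mem hgV]
      by_cases hgU : g ∈ U
      · exact h1 g hgU
      · rw [h2 g hgU, image_eq_zero_of_notMem_tsupport fun h => hgU (hU h), sub_zero, norm_zero]
        exact hδ.le
    · rw [Set.indicator_of_notMem hgV, sub_zero]
      by_cases hf : f g = 0
      · rw [hf, norm_zero]
        exact hδ.le
      · exact (hgV (by simpa using hT g hf)).elim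
  · by_contra hcon
    have hgV : g ∉ ⋃ p ∈ T, G.cylinder p.1 p.2 := by simpa using hcon
    rw [CompactlySupportedContinuousMap.sub_apply, ew, Set.indicator_of_notMem hgV, sub_zero] at hg
    exact hcon (hT g hg)
  · rw [← ENNReal.ofReal_natCast, ← ENNReal.ofReal_mul (Nat.cast_nonneg _)]
    exact ENNReal.ofReal_le_ofReal hδε

end

end KGraph

/-! ### Operators on `ℓ²` given by kernels -/

open Classical in
/-- The standard basis vectors of `ℓ²`. -/
def l2Basis {I : Type*} (β : I) : lp (fun _ : I => ℂ) 2 := lp.single 2 β 1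

/-- The kernel `K` has finite rows, and the `ℓ¹`-norms of its rows and columns are at most `C`. -/
structure IsSchurKernel {I : Type*} (K : I → I → ℂ) (C : ℝ) : Prop where
  nonneg : 0 ≤ C
  finite : ∀ γ, (Function.support (K γ)).Finite
  row : ∀ γ (S : Finset I), ∑ β ∈ S, ‖K γ β‖ ≤ C
  col : ∀ β (S : Finset I), ∑ γ ∈ S, ‖K γ β‖ ≤ C

namespace IsSchurKernel

variable {I : Type*} {K : I → I → ℂ} {C : ℝ}

theorem finsum_eq (h : IsSchurKernel K C) (ξ : I → ℂ) {γ : I} {S : Finset I}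
    (hS : (h.finite γ).toFinset ⊆ S) : ∑ᶠ β, K γ β * ξ β = ∑ β ∈ S, K γ β * ξ β := by
  refine finsum_eq_sum_of_support_subset _ fun β hβ => hS ?_
  rw [Set.Finite.mem_toFinset]
  exact left_ne_zero_of_mul hβ

/-- Schur's test: Cauchy-Schwarz with weights `‖K γ β‖` uses one row bound, and exchanging the sums
uses one column bound. -/
theorem sum_le (h : IsSchurKernel K C) (ξ : lp (fun _ : I => ℂ) 2) (s : Finset I) :
    ∑ γ ∈ s, ‖∑ᶠ β, K γ β * ξ β‖ ^ (2 : ℝ≥0∞).toReal ≤ (C * ‖ξ‖) ^ (2 : ℝ≥0∞).toReal := by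
  classical
  set S := s.biUnion fun γ => (h.finite γ).toFinset with hS
  have h2 : (2 : ℝ≥0∞).toReal = 2 := by norm_num
  have hξ := lp.sum_rpow_le_norm_rpow (by norm_num) ξ S
  simp only [h2, Real.rpow_two] at hξ ⊢
  have hrow : ∀ γ ∈ s, ‖∑ᶠ β, K γ β * ξ β‖ ^ 2 ≤ C * ∑ β ∈ S, ‖K γ β‖ * ‖ξ β‖ ^ 2 := by
    intro γ hγ
    rw [h.finsum_eq ξ (S := S) (Finset.subset_biUnion_of_mem
      (fun γ => (h.finite γ).toFinset) hγ)]
    have h1 : ‖∑ β ∈ S, K γ β * ξ β‖ ≤ ∑ β ∈ S, ‖K γ β‖ * ‖ξ β‖ :=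
      (norm_sum_le _ _).trans_eq (Finset.sum_congr rfl fun _ _ => norm_mul _ _)
    calc ‖∑ β ∈ S, K γ β * ξ β‖ ^ 2 ≤ (∑ β ∈ S, ‖K γ β‖ * ‖ξ β‖) ^ 2 := by gcongr
      _ ≤ (∑ β ∈ S, ‖K γ β‖) * ∑ β ∈ S, ‖K γ β‖ * ‖ξ β‖ ^ 2 :=
        Finset.sum_sq_le_sum_mul_sum_of_sq_le_mul _ (fun _ _ => norm_nonneg _)
          (fun _ _ => by positivity) fun _ _ => by
            apply le_of_eq
            ring
      _ ≤ _ := by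
        gcongr
        exact h.row γ S
  calc ∑ γ ∈ s, ‖∑ᶠ β, K γ β * ξ β‖ ^ 2
      ≤ ∑ γ ∈ s, C * ∑ β ∈ S, ‖K γ β‖ * ‖ξ β‖ ^ 2 := Finset.sum_le_sum hrow
    _ = C * ∑ β ∈ S, (∑ γ ∈ s, ‖K γ β‖) * ‖ξ β‖ ^ 2 := by
        rw [← Finset.mul_sum, Finset.sum_comm]
        simp only [Finset.sum_mul]
    _ ≤ C * ∑ β ∈ S, C * ‖ξ β‖ ^ 2 := by
        have := h.nonneg
        gcongr with β _
        exact h.col β s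
    _ = C ^ 2 * ∑ β ∈ S, ‖ξ β‖ ^ 2 := by
        rw [← Finset.mul_sum]
        ring
    _ ≤ C ^ 2 * ‖ξ‖ ^ 2 := by gcongr
    _ = _ := by ring

/-- The operator on `ℓ²` given by a kernel. -/
def op (h : IsSchurKernel K C) : lp (fun _ : I => ℂ) 2 →L[ℂ] lp (fun _ : I => ℂ) 2 :=
  LinearMap.mkContinuous
    { toFun := fun ξ => ⟨fun γ => ∑ᶠ β, K γ β * ξ β, memℓp_gen' (h.sum_le ξ)⟩
      map_add' := fun ξ η => by
        ext γ
        change ∑ᶠ β, K γ β * (⇑ξ + ⇑η) β = (∑ᶠ β, K γ β * ξ β) + ∑ᶠ β, K γ β * η β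
        rw [h.finsum_eq _ subset_rfl, h.finsum_eq _ subset_rfl, h.finsum_eq _ subset_rfl,
          ← Finset.sum_add_distrib]
        simp only [Pi.add_apply, mul_add]
      map_smul' := fun t ξ => by
        ext γ
        change ∑ᶠ β, K γ β * (t • ⇑ξ) β = t * ∑ᶠ β, K γ β * ξ β
        rw [h.finsum_eq _ subset_rfl, h.finsum_eq _ subset_rfl, Finset.mul_sum]
        simp only [Pi.smul_apply, smul_eq_mul, mul_left_comm] }
    C fun ξ => lp.norm_le_of_forall_sum_le (by norm_num)
      (mul_nonneg h.nonneg (norm_nonneg _)) (h.sum_le ξ)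

theorem op_apply (h : IsSchurKernel K C) (ξ : lp (fun _ : I => ℂ) 2) (γ : I) :
    h.op ξ γ = ∑ᶠ β, K γ β * ξ β := rfl

theorem norm_op_le (h : IsSchurKernel K C) : ‖h.op‖ ≤ C :=
  LinearMap.mkContinuous_norm_le _ h.nonneg _

theorem op_basis (h : IsSchurKernel K C) (γ β : I) : h.op (l2Basis β) γ = K γ β := by
  rw [op_apply, finsum_eq_single _ β]
  · simp [l2Basis]
  · intro δ hδ
    simp [l2Basis, lp.single_apply, hδ]

end IsSchurKernel

/-- An operator on `ℓ²` is determined by its matrix. -/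
theorem l2_ext {I : Type*} {S T : lp (fun _ : I => ℂ) 2 →L[ℂ] lp (fun _ : I => ℂ) 2}
    (h : ∀ γ β, S (l2Basis β) γ = T (l2Basis β) γ) : S = T := by
  classical
  refine lp.ext_continuousLinearMap (by norm_num) fun β => ?_
  ext γ
  exact h γ β

open Classical in
theorem star_basis_apply {I : Type*} (T : lp (fun _ : I => ℂ) 2 →L[ℂ] lp (fun _ : I => ℂ) 2)
    (γ β : I) : (star T) (l2Basis β) γ = star (T (l2Basis γ) β) := by
  have h1 := lp.inner_single_left (𝕜 := ℂ) γ (1 : ℂ) ((star T) (lp.single 2 β (1 : ℂ)))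
  have h2 := lp.inner_single_right (𝕜 := ℂ) β (1 : ℂ) (T (lp.single 2 γ (1 : ℂ)))
  rw [ContinuousLinearMap.star_eq_adjoint] at h1 ⊢
  rw [ContinuousLinearMap.adjoint_inner_right, h2] at h1
  simpa [l2Basis] using h1.symm

/-- The diagonal kernel given by a circle valued function. -/
theorem isSchurKernel_diagonal {I : Type*} [DecidableEq I] (w : I → Circle) :
    IsSchurKernel (fun γ β => if γ = β then (w γ : ℂ) else 0) 1 where
  nonneg := zero_le_one
  finite γ := (Set.finite_singleton γ).subset fun β hβ => by
    by_contra hne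
    exact hβ (if_neg fun h => hne h.symm)
  row γ S := by
    simp only [apply_ite norm, norm_zero, Circle.norm_coe, Finset.sum_ite_eq]
    split_ifs <;> norm_num
  col β S := by
    simp only [apply_ite norm, norm_zero, Circle.norm_coe, Finset.sum_ite_eq']
    split_ifs <;> norm_num

open Classical in
/-- Multiplication by a circle valued function on `ℓ²`. -/
def diagOp {I : Type*} (w : I → Circle) : lp (fun _ : I => ℂ) 2 →L[ℂ] lp (fun _ : I => ℂ) 2 :=
  (isSchurKernel_diagonal w).op

theorem diagOp_apply {I : Type*} (w : I → Circle) (ξ : lp (fun _ : I => ℂ) 2) (γ : I) :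
    diagOp w ξ γ = w γ * ξ γ := by
  classical
  rw [diagOp, IsSchurKernel.op_apply, finsum_eq_single _ γ]
  · simp
  · intro β hβ
    simp [hβ.symm]

theorem norm_diagOp_le {I : Type*} (w : I → Circle) : ‖diagOp w‖ ≤ 1 := by
  classical
  exact (isSchurKernel_diagonal w).norm_op_le

open Classical in
theorem diagOp_conj_basis {I : Type*} (w w' : I → Circle)
    (T : lp (fun _ : I => ℂ) 2 →L[ℂ] lp (fun _ : I => ℂ) 2) (γ β : I) :
    (diagOp w * T * diagOp w') (l2Basis β) γ =
      w γ * w' β * T (l2Basis β) γ := by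
  have h : diagOp w' (l2Basis β) = (w' β : ℂ) • l2Basis β := by
    ext δ
    rw [diagOp_apply, lp.coeFn_smul, Pi.smul_apply, l2Basis, lp.single_apply, Pi.single_apply]
    split_ifs with h
    · rw [h, smul_eq_mul]
    · simp
  change diagOp w (T (diagOp w' _)) γ = _
  rw [h, diagOp_apply, map_smul, lp.coeFn_smul, Pi.smul_apply, smul_eq_mul, mul_assoc]

namespace KGraph

variable {k : ℕ} {Λ : Type u} {G : KGraph k Λ}

/-! ### The regular representations -/

/-- `σ` is a normalised `2`-cocycle on the path groupoid. -/
structure IsGroupoidCocycle (σ : ∀ g h : G.PathGroupoid, g.src = h.rng → Circle) : Prop where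
  mul : ∀ (g h l : G.PathGroupoid) (h1 : g.src = h.rng) (h2 : h.src = l.rng),
    σ g h h1 * σ (g.mul h h1) l h2 = σ h l h2 * σ g (h.mul l h2) h1
  inv_mul : ∀ (g h : G.PathGroupoid) (e : g.src = h.rng), σ (g.inv.mul g rfl) h e = 1

theorem isGroupoidCocycle_groupoidCocycle {P : Set (Λ × Λ)} (hP : G.IsPartition P)
    (c : G.TwoCocycle) : IsGroupoidCocycle (groupoidCocycle hP c) where
  mul _ _ _ h1 h2 := groupoidCocycle_mul hP c h1 h2
  inv_mul g h e := by
    obtain ⟨a, b, b', f, h1, h2, h3⟩ := exists_mem_cylinder_three (g := g.inv) (h := g) rfl e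
    obtain rfl : a = b' := (eq_of_mem_cylinder (inv_mem_cylinder_iff.mp h1) h2 rfl).2
    have hu := mul_mem_cylinder h1 h2 rfl
    have hk := phase_mul_phase hP c hu h3 e
    have he : (g.inv.mul g rfl).mul h e = h := PathGroupoid.ext e
      (show -g.deg + g.deg + h.deg = h.deg by rw [neg_add_cancel, zero_add]) rfl
    rw [phase_unit hP c hu, he, one_mul] at hk
    exact mul_eq_left.mp hk

/-- The fibre `𝒢_x` of the source map. -/
abbrev Fibre (G : KGraph k Λ) (x : G.InfinitePath) : Type u := {γ : G.PathGroupoid // γ.src = x}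

variable {x : G.InfinitePath}

/-- `γβ⁻¹`. -/
def Fibre.div (γ β : G.Fibre x) : G.PathGroupoid := γ.1.mul β.1.inv (γ.2.trans β.2.symm)

theorem Fibre.div_mul (γ β : G.Fibre x) : (γ.div β).mul β.1 rfl = γ.1 :=
  PathGroupoid.ext rfl (neg_add_cancel_right γ.1.deg β.1.deg) (β.2.trans γ.2.symm)

theorem Fibre.div_mul_div (γ δ β : G.Fibre x) : (γ.div δ).mul (δ.div β) rfl = γ.div β :=
  PathGroupoid.ext rfl (show γ.1.deg + -δ.1.deg + (δ.1.deg + -β.1.deg) = γ.1.deg + -β.1.deg by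
    abel) rfl

theorem Fibre.div_inv (γ β : G.Fibre x) : (γ.div β).inv = β.div γ :=
  PathGroupoid.ext rfl (show -(γ.1.deg + -β.1.deg) = β.1.deg + -γ.1.deg by abel) rfl

theorem Fibre.div_injective (γ : G.Fibre x) : Function.Injective γ.div := by
  intro β β' h
  refine Subtype.ext (PathGroupoid.ext (congrArg PathGroupoid.src h) ?_ (β.2.trans β'.2.symm))
  have : γ.1.deg + -β.1.deg = γ.1.deg + -β'.1.deg := congrArg PathGroupoid.deg h
  exact neg_injective (add_left_cancel this)

theorem Fibre.div_injective' (β : G.Fibre x) : Function.Injective fun γ : G.Fibre x => γ.div β := by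
  intro γ γ' h
  refine Subtype.ext (PathGroupoid.ext (show (γ.div β).rng = (γ'.div β).rng from
    congrArg PathGroupoid.rng h) ?_ (γ.2.trans γ'.2.symm))
  have : γ.1.deg + -β.1.deg = γ'.1.deg + -β.1.deg := congrArg PathGroupoid.deg h
  exact add_right_cancel this

/-- A factorisation of `γ` is determined by its right factor `β`, the left one being `γβ⁻¹`. This
rewrites left convolution as an operator with a kernel. -/
theorem Fibre.bijective_div (γ : G.Fibre x) : Function.Bijective
    (fun β : G.Fibre x => (⟨(γ.div β, β), rfl, γ.div_mul β⟩ :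
      {p : G.PathGroupoid × G.Fibre x // ∃ h : p.1.src = p.2.1.rng, p.1.mul p.2.1 h = γ.1})) := by
  constructor
  · intro β β' h
    exact congrArg (fun p => p.1.2) h
  · rintro ⟨⟨α, β⟩, h, e⟩
    refine ⟨β, Subtype.ext (Prod.ext ?_ rfl)⟩
    refine PathGroupoid.ext (show γ.1.rng = α.rng from
      (congrArg PathGroupoid.rng e).symm) ?_ h.symm
    have h1 : α.deg + β.1.deg = γ.1.deg := congrArg PathGroupoid.deg e
    change γ.1.deg + -β.1.deg = α.deg
    rw [← h1, add_neg_cancel_right]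

/-- Factorisations of `γβ⁻¹` are indexed by an intermediate `δ` in the fibre, so that convolution of
functions becomes multiplication of kernels. -/
theorem Fibre.bijective_div_div (γ β : G.Fibre x) : Function.Bijective
    (fun δ : G.Fibre x => (⟨(γ.div δ, δ.div β), rfl, γ.div_mul_div δ β⟩ :
      {p : G.PathGroupoid × G.PathGroupoid //
        ∃ h : p.1.src = p.2.rng, p.1.mul p.2 h = γ.div β})) := by
  constructor
  · intro δ δ' h
    exact β.div_injective' (congrArg (fun p => p.1.2) h)
  · rintro ⟨⟨α, α'⟩, h, e⟩
    have h1 : α.deg + α'.deg = γ.1.deg + -β.1.deg := congrArg PathGroupoid.deg e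
    have h2 : α.rng = γ.1.rng := (congrArg PathGroupoid.rng e :)
    have h3 : α'.src = β.1.rng := congrArg PathGroupoid.src e
    refine ⟨⟨α'.mul β.1 h3, β.2⟩, Subtype.ext (Prod.ext ?_ ?_)⟩
    · refine PathGroupoid.ext h2.symm ?_ h.symm
      change γ.1.deg + -(α'.deg + β.1.deg) = α.deg
      rw [eq_sub_of_add_eq h1]
      abel
    · exact PathGroupoid.ext rfl (add_neg_cancel_right α'.deg β.1.deg) h3.symm

/-- The kernel of left `σ`-convolution by `f` on `ℓ²(𝒢_x)`. -/
def regKernel (σ : ∀ g h : G.PathGroupoid, g.src = h.rng → Circle) (f : G.PathGroupoid → ℂ)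
    (x : G.InfinitePath) (γ β : G.Fibre x) : ℂ :=
  σ (γ.div β) β.1 rfl * f (γ.div β)

theorem finite_fibre_support (f : C_c(G.PathGroupoid, ℂ)) (γ : G.Fibre x) :
    {β : G.Fibre x | f (γ.div β) ≠ 0}.Finite := by
  obtain ⟨T, hT⟩ := exists_finset_support f
  refine Set.Finite.subset (T.finite_toSet.biUnion
    (t := fun p => {β : G.Fibre x | γ.div β ∈ G.cylinder p.1 p.2}) fun p _ => ?_) ?_
  · refine Set.Subsingleton.finite fun β hβ β' hβ' => ?_
    exact γ.div_injective (eq_of_rng_eq hβ hβ' rfl)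
  · intro β hβ
    obtain ⟨p, h1, h2⟩ := hT _ hβ
    exact Set.mem_biUnion h1 h2

theorem sum_norm_le_of_tsum_le {I : Type*} (f : I → ℂ) {C : ℝ≥0∞} (hC : C ≠ ∞)
    (h : ∑' i, ‖f i‖ₑ ≤ C) (S : Finset I) : ∑ i ∈ S, ‖f i‖ ≤ C.toReal := by
  rw [← ENNReal.ofReal_le_iff_le_toReal hC, ENNReal.ofReal_sum_of_nonneg fun _ _ => norm_nonneg _]
  simp only [ofReal_norm]
  exact (ENNReal.sum_le_tsum S).trans h

theorem isSchurKernel_regKernel (σ : ∀ g h : G.PathGroupoid, g.src = h.rng → Circle)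
    (f : C_c(G.PathGroupoid, ℂ)) (x : G.InfinitePath) :
    IsSchurKernel (regKernel σ f x) (iNorm f).toReal where
  nonneg := ENNReal.toReal_nonneg
  finite γ := (finite_fibre_support f γ).subset fun β hβ => right_ne_zero_of_mul hβ
  row γ S := by
    simp only [regKernel, norm_mul, Circle.norm_coe, one_mul]
    refine sum_norm_le_of_tsum_le _ (iNorm_ne_top f) (le_trans ?_ (le_max_left _ _)) S
    refine le_trans ?_ (le_iSup _ γ.1.rng)
    exact ENNReal.tsum_comp_le_tsum_of_injective
      (f := fun β : G.Fibre x => (⟨γ.div β, rfl⟩ : {g : G.PathGroupoid // g.rng = γ.1.rng}))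
      (fun β β' h => γ.div_injective (congrArg Subtype.val h)) (fun g => ‖f g.1‖ₑ)
  col β S := by
    simp only [regKernel, norm_mul, Circle.norm_coe, one_mul]
    refine sum_norm_le_of_tsum_le _ (iNorm_ne_top f) (le_trans ?_ (le_max_right _ _)) S
    refine le_trans ?_ (le_iSup _ β.1.rng)
    exact ENNReal.tsum_comp_le_tsum_of_injective
      (f := fun γ : G.Fibre x => (⟨γ.div β, rfl⟩ : {g : G.PathGroupoid // g.src = β.1.rng}))
      (fun γ γ' h => β.div_injective' (congrArg Subtype.val h)) (fun g => ‖f g.1‖ₑ)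

/-- Left `σ`-convolution by `f` on `ℓ²(𝒢_x)`. -/
def regOp (σ : ∀ g h : G.PathGroupoid, g.src = h.rng → Circle) (x : G.InfinitePath)
    (f : C_c(G.PathGroupoid, ℂ)) : G.FibreSpace x →L[ℂ] G.FibreSpace x :=
  (isSchurKernel_regKernel σ f x).op

theorem isLeftConv_regOp (σ : ∀ g h : G.PathGroupoid, g.src = h.rng → Circle)
    (x : G.InfinitePath) (f : C_c(G.PathGroupoid, ℂ)) : IsLeftConv σ f x (regOp σ x f) := by
  intro ξ γ
  exact finsum_eq_of_bijective _ (Fibre.bijective_div γ) fun β => rfl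

theorem IsLeftConv.eq_regOp {σ : ∀ g h : G.PathGroupoid, g.src = h.rng → Circle}
    {x : G.InfinitePath} {f : C_c(G.PathGroupoid, ℂ)} {T : G.FibreSpace x →L[ℂ] G.FibreSpace x}
    (h : IsLeftConv σ f x T) : T = regOp σ x f := by
  refine ContinuousLinearMap.ext fun ξ => Subtype.ext (funext fun γ => ?_)
  exact (h ξ γ).trans (isLeftConv_regOp σ x f ξ γ).symm

/-- The standard basis vectors of `ℓ²(𝒢_x)`. -/
def FibreSpace.basis (β : G.Fibre x) : G.FibreSpace x := l2Basis β

theorem regOp_basis (σ : ∀ g h : G.PathGroupoid, g.src = h.rng → Circle) (x : G.InfinitePath)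
    (f : C_c(G.PathGroupoid, ℂ)) (γ β : G.Fibre x) :
    (regOp σ x f (FibreSpace.basis β) : G.FibreSpace x) γ =
      regKernel σ f x γ β :=
  (isSchurKernel_regKernel σ f x).op_basis γ β

theorem FibreSpace.op_ext {S T : G.FibreSpace x →L[ℂ] G.FibreSpace x}
    (h : ∀ γ β : G.Fibre x,
      (S (FibreSpace.basis β) : G.FibreSpace x) γ =
        (T (FibreSpace.basis β) : G.FibreSpace x) γ) : S = T :=
  l2_ext h

theorem regOp_conv {σ : ∀ g h : G.PathGroupoid, g.src = h.rng → Circle}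
    (hσ : IsGroupoidCocycle σ) (x : G.InfinitePath) {f f' F : C_c(G.PathGroupoid, ℂ)}
    (h : ∀ γ, F γ = conv σ f f' γ) : regOp σ x F = regOp σ x f * regOp σ x f' := by
  classical
  refine FibreSpace.op_ext fun γ β => ?_
  rw [regOp_basis, ContinuousLinearMap.mul_def, ContinuousLinearMap.comp_apply]
  have h1 : (regOp σ x f (regOp σ x f' (FibreSpace.basis β)) :
      G.FibreSpace x) γ = ∑ᶠ δ, regKernel σ f x γ δ * regKernel σ f' x δ β := by
    refine ((isSchurKernel_regKernel σ f x).op_apply _ γ).trans (finsum_congr fun δ => ?_)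
    congr 1
    exact regOp_basis σ x f' δ β
  rw [h1, regKernel, h, conv, ← finsum_comp _ (Fibre.bijective_div_div γ β)]
  have hfin : (Function.support fun δ : G.Fibre x => (σ (γ.div δ) (δ.div β) rfl : ℂ) *
      f (γ.div δ) * f' (δ.div β)).Finite :=
    (finite_fibre_support f γ).subset fun δ hδ =>
      right_ne_zero_of_mul (left_ne_zero_of_mul hδ)
  refine (mul_finsum' _ _ hfin).trans (finsum_congr fun δ => ?_)
  -- The cocycle identity at `γδ⁻¹`, `δβ⁻¹`, `β` matches the two kernels entry by entry.
  have hc := hσ.mul (γ.div δ) (δ.div β) β.1 rfl rfl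
  simp only [Fibre.div_mul_div, Fibre.div_mul] at hc
  have hc' := congrArg (fun z : Circle => (z : ℂ)) hc
  simp only [Circle.coe_mul] at hc'
  rw [regKernel, regKernel]
  linear_combination (f (γ.div δ) * f' (δ.div β)) * hc'

theorem regOp_convStar {σ : ∀ g h : G.PathGroupoid, g.src = h.rng → Circle}
    (hσ : IsGroupoidCocycle σ) (x : G.InfinitePath) {f F : C_c(G.PathGroupoid, ℂ)}
    (h : ∀ γ, F γ = convStar σ f γ) : regOp σ x F = star (regOp σ x f) := by
  classical
  refine FibreSpace.op_ext fun γ β => ?_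
  refine Eq.trans ?_ (star_basis_apply (I := G.Fibre x) (regOp σ x f) γ β).symm
  rw [regOp_basis]
  refine Eq.trans ?_ (congrArg star (regOp_basis σ x f β γ).symm)
  rw [regKernel, regKernel, h, convStar, star_mul', ← mul_assoc]
  have e1 : (γ.div β).inv = β.div γ := γ.div_inv β
  -- The cocycle identity at `βγ⁻¹`, `γβ⁻¹`, `β`; normalisation removes the factor that contains a
  -- unit.
  have hc := hσ.mul (γ.div β).inv (γ.div β) β.1 rfl rfl
  have hu : σ ((γ.div β).inv.mul (γ.div β) rfl) β.1 rfl = 1 := hσ.inv_mul _ _ rfl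
  replace hc := (congrArg (σ (γ.div β).inv (γ.div β) rfl * ·) hu).symm.trans hc
  simp only [mul_one] at hc
  simp only [Fibre.div_mul] at hc
  simp only [e1] at hc ⊢
  congr 1
  rw [hc, Circle.coe_mul, star_mul', ← mul_assoc, Complex.star_def, ← Circle.coe_inv_eq_conj,
    ← Circle.coe_mul, mul_inv_cancel, Circle.coe_one, one_mul]

/-- The regular representation on `ℓ²(𝒢_x)`. -/
def regRep {σ : ∀ g h : G.PathGroupoid, g.src = h.rng → Circle} (hσ : IsGroupoidCocycle σ)
    (x : G.InfinitePath) : BoundedRep σ where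
  H := G.FibreSpace x
  L :=
    { toFun := regOp σ x
      map_add' := fun f f' => by
        classical
        refine FibreSpace.op_ext fun γ β => ?_
        rw [regOp_basis]
        refine Eq.trans ?_ (congrArg₂ (· + ·) (regOp_basis σ x f γ β).symm
          (regOp_basis σ x f' γ β).symm)
        rw [regKernel, CompactlySupportedContinuousMap.add_apply, mul_add]
        rfl
      map_smul' := fun t f => by
        classical
        refine FibreSpace.op_ext fun γ β => ?_
        rw [regOp_basis]
        refine Eq.trans ?_ (congrArg (t * ·) (regOp_basis σ x f γ β).symm)
        rw [regKernel, CompactlySupportedContinuousMap.smul_apply, smul_eq_mul, mul_left_comm]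
        rfl }
  map_conv f f' F h := regOp_conv hσ x h
  map_star f F h := regOp_convStar hσ x h
  bounded f := by
    rw [← ofReal_norm, ENNReal.ofReal_le_iff_le_toReal (iNorm_ne_top f)]
    exact (isSchurKernel_regKernel σ f x).norm_op_le

end KGraph

/-! ### Positivity in `C*`-algebras -/

/-- The norm is monotone on positive elements. Both the orthogonality of range projections and the
extraction of one gauge translate from an average rest on this. -/
theorem norm_star_mul_self_le_sum {B ι : Type*} [NonUnitalCStarAlgebra B] (S : Finset ι)
    (x : ι → B) {j : ι} (hj : j ∈ S) : ‖star (x j) * x j‖ ≤ ‖∑ i ∈ S, star (x i) * x i‖ := by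
  let _ := CStarAlgebra.spectralOrder B
  have := CStarAlgebra.spectralOrderedRing B
  exact CStarAlgebra.norm_le_norm_of_nonneg_of_le (star_mul_self_nonneg _)
    (Finset.single_le_sum (f := fun i => star (x i) * x i)
      (fun i _ => star_mul_self_nonneg (x i)) hj)

theorem eq_zero_of_sum_star_mul_self {B ι : Type*} [NonUnitalCStarAlgebra B] (S : Finset ι)
    (x : ι → B) (h : ∑ i ∈ S, star (x i) * x i = 0) {j : ι} (hj : j ∈ S) : x j = 0 := by
  have h1 := norm_star_mul_self_le_sum S x hj
  rw [h, norm_zero] at h1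
  exact CStarRing.star_mul_self_eq_zero_iff _ |>.mp (norm_le_zero_iff.mp h1)

theorem norm_eq_one_of_isStarProjection {B : Type*} [NonUnitalCStarAlgebra B] {p : B}
    (hp : IsStarProjection p) (h0 : p ≠ 0) : ‖p‖ = 1 := by
  have h : ‖p‖ * ‖p‖ = ‖p‖ := by
    rw [← CStarRing.norm_star_mul_self, hp.isSelfAdjoint.star_eq, hp.isIdempotentElem.eq]
  exact mul_right_cancel₀ (norm_ne_zero_iff.mpr h0) (h.trans (one_mul _).symm)

namespace KGraph

variable {k : ℕ} {Λ : Type u} {G : KGraph k Λ}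

/-! ### Cuntz-Krieger families -/

/-- The span of those products `t_μ t_ν^*` for which `R μ ν`. -/
def ckSpan {B : Type*} [NonUnitalCStarAlgebra B] (t : Λ → B) (R : Λ → Λ → Prop) :
    Submodule ℂ B :=
  Submodule.span ℂ {b | ∃ μ ν, R μ ν ∧ b = t μ * star (t ν)}

section

variable {B : Type*} [NonUnitalCStarAlgebra B] {t : Λ → B}

theorem mem_ckSpan {R : Λ → Λ → Prop} {μ ν : Λ} (h : R μ ν) : t μ * star (t ν) ∈ ckSpan t R :=
  Submodule.subset_span ⟨μ, ν, h, rfl⟩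

theorem ckSpan_mono {R R' : Λ → Λ → Prop} (h : ∀ μ ν, R μ ν → R' μ ν) :
    ckSpan t R ≤ ckSpan t R' :=
  Submodule.span_mono fun _ ⟨μ, ν, h1, h2⟩ => ⟨μ, ν, h μ ν h1, h2⟩

theorem ckSpan_induction {R : Λ → Λ → Prop} {p : B → Prop}
    (mem : ∀ μ ν, R μ ν → p (t μ * star (t ν))) (zero : p 0)
    (add : ∀ x y, p x → p y → p (x + y)) (smul : ∀ (z : ℂ) x, p x → p (z • x)) {b : B}
    (hb : b ∈ ckSpan t R) : p b :=
  Submodule.span_induction (p := fun b _ => p b) (by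
    rintro _ ⟨μ, ν, h, rfl⟩
    exact mem μ ν h) zero
    (fun x y _ _ => add x y) (fun z x _ => smul z x) hb

theorem star_mem_ckSpan {R R' : Λ → Λ → Prop} (h : ∀ μ ν, R μ ν → R' ν μ) {b : B}
    (hb : b ∈ ckSpan t R) : star b ∈ ckSpan t R' := by
  refine ckSpan_induction (p := fun b => star b ∈ ckSpan t R') (fun μ ν hR => ?_) ?_ ?_ ?_ hb
  · rw [star_mul, star_star]
    exact mem_ckSpan (h μ ν hR)
  · rw [star_zero]
    exact Submodule.zero_mem _
  · intro x y hx hy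
    rw [star_add]
    exact Submodule.add_mem _ hx hy
  · intro z x hx
    rw [star_smul]
    exact Submodule.smul_mem _ _ hx

theorem mul_mem_ckSpan {R R' R'' : Λ → Λ → Prop}
    (h : ∀ μ ν κ ρ, R μ ν → R' κ ρ → t μ * star (t ν) * (t κ * star (t ρ)) ∈ ckSpan t R'')
    {a b : B} (ha : a ∈ ckSpan t R) (hb : b ∈ ckSpan t R') : a * b ∈ ckSpan t R'' := by
  refine ckSpan_induction (p := fun a => a * b ∈ ckSpan t R'') (fun μ ν hR => ?_) ?_ ?_ ?_ ha
  · refine ckSpan_induction (p := fun b => t μ * star (t ν) * b ∈ ckSpan t R'')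
      (fun κ ρ hR' => h μ ν κ ρ hR hR') ?_ ?_ ?_ hb
    · rw [mul_zero]
      exact Submodule.zero_mem _
    · intro x y hx hy
      rw [mul_add]
      exact Submodule.add_mem _ hx hy
    · intro z x hx
      rw [mul_smul_comm]
      exact Submodule.smul_mem _ _ hx
  · rw [zero_mul]
    exact Submodule.zero_mem _
  · intro x y hx hy
    rw [add_mul]
    exact Submodule.add_mem _ hx hy
  · intro z x hx
    rw [smul_mul_assoc]
    exact Submodule.smul_mem _ _ hx

namespace IsCuntzKriegerFamily

variable {c : G.TwoCocycle} (ht : G.IsCuntzKriegerFamily c t)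

include ht

theorem mul_s (l : Λ) : t l * t (G.s l) = t l := by
  rw [ht.mul _ _ (G.r_s l).symm, c.normalised _ _ (G.r_s l).symm (Or.inr (isVertex_s l)),
    G.comp_s_self, Circle.coe_one, one_smul]

theorem r_mul (l : Λ) : t (G.r l) * t l = t l := by
  rw [ht.mul _ _ (G.s_r l), c.normalised _ _ (G.s_r l) (Or.inl (isVertex_r l)),
    G.r_comp_self, Circle.coe_one, one_smul]

theorem star_vertex {v : Λ} (hv : G.IsVertex v) : star (t v) = t v :=
  (ht.projection v hv).isSelfAdjoint.star_eq

theorem vertex_mul_self {v : Λ} (hv : G.IsVertex v) : t v * t v = t v :=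
  (ht.projection v hv).isIdempotentElem.eq

theorem star_mul_r (l : Λ) : star (t l) * t (G.r l) = star (t l) := by
  have h := congrArg star (ht.r_mul l)
  rwa [star_mul, ht.star_vertex (isVertex_r l)] at h

theorem s_mul_star (l : Λ) : t (G.s l) * star (t l) = star (t l) := by
  have h := congrArg star (ht.mul_s l)
  rwa [star_mul, ht.star_vertex (isVertex_s l)] at h

theorem mul_eq_zero {μ ν : Λ} (h : G.s μ ≠ G.r ν) : t μ * t ν = 0 := by
  rw [← ht.mul_s μ, ← ht.r_mul ν, mul_assoc, ← mul_assoc (t (G.s μ)),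
    ht.orthogonal _ _ (isVertex_s μ) (isVertex_r ν) h, zero_mul, mul_zero]

theorem mul_star_eq_zero {μ ν : Λ} (h : G.s μ ≠ G.s ν) : t μ * star (t ν) = 0 := by
  rw [← ht.mul_s μ, ← ht.s_mul_star ν, mul_assoc, ← mul_assoc (t (G.s μ)),
    ht.orthogonal _ _ (isVertex_s μ) (isVertex_s ν) h, zero_mul, mul_zero]

theorem star_mul_eq_zero_of_r_ne {μ ν : Λ} (h : G.r μ ≠ G.r ν) : star (t μ) * t ν = 0 := by
  rw [← ht.star_mul_r μ, ← ht.r_mul ν, mul_assoc, ← mul_assoc (t (G.r μ)),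
    ht.orthogonal _ _ (isVertex_r μ) (isVertex_r ν) h, zero_mul, mul_zero]

variable (hfin : G.RowFinite)

include hfin

theorem vertex_eq_sum {v : Λ} (hv : G.IsVertex v) (n : Fin k → ℕ) :
    t v = ∑ l ∈ (hfin v hv n).toFinset, t l * star (t l) := by
  rw [ht.sum v hv n, finsum_mem_eq_finite_toFinset_sum]

/-- Compressing `t_{r(ν)} = ∑ t_l t_l^*` by `t_ν` gives `t_{s(ν)}`, and the summand `l = ν` already
accounts for it. The other summands are the positive elements `(t_l^* t_ν)^* (t_l^* t_ν)` with sum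
zero, so each vanishes. -/
theorem star_mul_eq_zero {μ ν : Λ} (hd : G.d μ = G.d ν) (hne : μ ≠ ν) :
    star (t μ) * t ν = 0 := by
  classical
  by_cases hr : G.r μ = G.r ν
  swap
  · exact ht.star_mul_eq_zero_of_r_ne hr
  set S := (hfin (G.r ν) (isVertex_r ν) (G.d ν)).toFinset with hS
  have hν : ν ∈ S := (Set.Finite.mem_toFinset _).mpr ⟨rfl, rfl⟩
  have hμ : μ ∈ S.erase ν :=
    Finset.mem_erase.mpr ⟨hne, (Set.Finite.mem_toFinset _).mpr ⟨hr, hd⟩⟩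
  have h1 : star (t ν) * t (G.r ν) * t ν = t (G.s ν) := by
    rw [ht.star_mul_r, ht.star_mul_self]
  rw [ht.vertex_eq_sum hfin (isVertex_r ν) (G.d ν), ← hS, ← Finset.add_sum_erase _ _ hν, mul_add,
    add_mul] at h1
  have h2 : star (t ν) * (t ν * star (t ν)) * t ν = t (G.s ν) := by
    rw [← mul_assoc, ht.star_mul_self, mul_assoc, ht.star_mul_self,
      ht.vertex_mul_self (isVertex_s ν)]
  rw [h2, add_eq_left, Finset.mul_sum, Finset.sum_mul] at h1
  refine eq_zero_of_sum_star_mul_self (S.erase ν) (fun l => star (t l) * t ν) ?_ hμ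
  rw [← h1]
  refine Finset.sum_congr rfl fun l _ => ?_
  rw [star_mul, star_star]
  simp only [mul_assoc]

/-- `t_ν^* t_λ` for `d(ν) ≤ d(λ)`. -/
theorem star_mul_of_le {ν l : Λ} (h : G.d ν ≤ G.d l) :
    ∃ (z : ℂ) (δ : Λ), G.d ν + G.d δ = G.d l ∧ star (t ν) * t l = z • t δ := by
  classical
  obtain ⟨ν', δ, h1, h2, h3, h4⟩ := exists_factor l (G.d ν) h
  refine ⟨if ν = ν' then ((c ν' δ)⁻¹ : Circle) else 0, δ, by rw [h3, add_tsub_cancel_of_le h], ?_⟩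
  have h5 : t l = (((c ν' δ)⁻¹ : Circle) : ℂ) • (t ν' * t δ) := by
    rw [ht.mul _ _ h1, ← h4, smul_smul, ← Circle.coe_mul, inv_mul_cancel, Circle.coe_one, one_smul]
  rw [h5, mul_smul_comm, ← mul_assoc]
  split_ifs with hν
  · rw [hν, ht.star_mul_self, h1, ht.r_mul]
  · rw [ht.star_mul_eq_zero hfin h2.symm hν, zero_mul, smul_zero, zero_smul]

/-- Inserting the sum of `t_l t_l^*` over paths of degree `d(ν) + d(κ)` makes every `l` long enough
to absorb both `t_ν^*` and `t_κ`. The relation on degrees says that the net degree is preserved,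
written without subtraction. -/
theorem star_mul_mem (ν κ : Λ) : star (t ν) * t κ ∈
    ckSpan t fun α β => G.d ν + G.d α = G.d κ + G.d β := by
  by_cases hr : G.r ν = G.r κ
  swap
  · rw [ht.star_mul_eq_zero_of_r_ne hr]
    exact Submodule.zero_mem _
  rw [← ht.r_mul κ, ht.vertex_eq_sum hfin (isVertex_r κ) (G.d ν + G.d κ), Finset.sum_mul,
    Finset.mul_sum]
  refine Submodule.sum_mem _ fun l hl => ?_
  rw [Set.Finite.mem_toFinset] at hl
  obtain ⟨z, δ, h1, h2⟩ := ht.star_mul_of_le hfin (ν := ν) (l := l) (by rw [hl.2]; exact le_self_add)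
  obtain ⟨w, ε, h3, h4⟩ := ht.star_mul_of_le hfin (ν := κ) (l := l) (by rw [hl.2]; exact le_add_self)
  have h5 : star (t l) * t κ = star w • star (t ε) := by
    rw [← star_smul, ← h4, star_mul, star_star]
  rw [← mul_assoc, ← mul_assoc, h2, mul_assoc, h5, smul_mul_smul_comm]
  exact Submodule.smul_mem _ _ (mem_ckSpan (h1.trans h3.symm))

theorem mul_mem (μ ν κ ρ : Λ) : t μ * star (t ν) * (t κ * star (t ρ)) ∈
    ckSpan t fun a b => G.d a + (G.d ν + G.d ρ) = G.d b + (G.d μ + G.d κ) := by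
  rw [mul_assoc, ← mul_assoc (star (t ν))]
  refine ckSpan_induction (p := fun b => t μ * (b * star (t ρ)) ∈ _) (fun α β h => ?_) ?_ ?_ ?_
    (ht.star_mul_mem hfin ν κ)
  · by_cases h1 : G.s μ = G.r α
    · by_cases h2 : G.s ρ = G.r β
      · have e : t μ * (t α * star (t β) * star (t ρ)) =
            ((c μ α : ℂ) * star (c ρ β : ℂ)) • (t (G.comp μ α) * star (t (G.comp ρ β))) := by
          rw [mul_assoc, ← star_mul, ht.mul _ _ h2, ← mul_assoc, ht.mul _ _ h1, star_smul,
            smul_mul_smul_comm]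
        rw [e]
        refine Submodule.smul_mem _ _ (mem_ckSpan ?_)
        rw [G.d_comp _ _ h1, G.d_comp _ _ h2]
        calc _ = G.d μ + G.d ρ + (G.d ν + G.d α) := by abel
          _ = _ := by rw [h]; abel
      · rw [mul_assoc, ← star_mul, ht.mul_eq_zero h2, star_zero, mul_zero, mul_zero]
        exact Submodule.zero_mem _
    · rw [mul_assoc, ← mul_assoc, ht.mul_eq_zero h1, zero_mul]
      exact Submodule.zero_mem _
  · rw [zero_mul, mul_zero]
    exact Submodule.zero_mem _
  · intro x y hx hy
    rw [add_mul, mul_add]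
    exact Submodule.add_mem _ hx hy
  · intro z x hx
    rw [smul_mul_assoc, mul_smul_comm]
    exact Submodule.smul_mem _ _ hx

theorem mul_star_eq_sum {μ ν : Λ} (hs : G.s μ = G.s ν) (n : Fin k → ℕ) :
    t μ * star (t ν) = ∑ α ∈ (hfin (G.s μ) (isVertex_s μ) n).toFinset,
      (c.ratio μ ν α : ℂ) • (t (G.comp μ α) * star (t (G.comp ν α))) := by
  rw [← ht.mul_s μ, ht.vertex_eq_sum hfin (isVertex_s μ) n, Finset.mul_sum, Finset.sum_mul]
  refine Finset.sum_congr rfl fun α hα => ?_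
  rw [Set.Finite.mem_toFinset] at hα
  have h1 : G.s μ = G.r α := hα.1.symm
  have h2 : G.s ν = G.r α := hs ▸ h1
  rw [← mul_assoc, mul_assoc, ← star_mul, ht.mul _ _ h1, ht.mul _ _ h2, star_smul,
    smul_mul_smul_comm, TwoCocycle.ratio, Circle.coe_mul, Circle.coe_inv_eq_conj,
    Complex.star_def]

end IsCuntzKriegerFamily

end

end KGraph

/-! ### Elementary estimates -/

/-- If `a > C > 0`, then `(a / C) ^ 2 ^ (m + 1)` outgrows every power of `2 ^ (m + 1)`. This is how
multiplicative losses are removed from norm estimates for iterated squares. -/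
theorem le_of_forall_pow_le {a C D K : ℝ} (hC : 0 ≤ C) (hD : 0 ≤ D) (hK : 0 ≤ K)
    (k : ℕ) (h : ∀ m : ℕ, a ^ 2 ^ (m + 1) ≤ K * (2 ^ (m + 1) * D + 1) ^ k * C ^ 2 ^ (m + 1)) :
    a ≤ C := by
  rcases hC.eq_or_lt with rfl | hC
  · have h0 := h 0
    norm_num at h0
    exact h0.le
  by_contra! hlt
  set r := a / C with hr
  have hr1 : 1 < r := (one_lt_div hC).mpr hlt
  have hb : ∀ m : ℕ, 1 ≤ K * (D + 1) ^ k *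
      (((2 ^ (m + 1) : ℕ) : ℝ) ^ k / r ^ (2 ^ (m + 1))) := by
    intro m
    have hpos : 0 < r ^ 2 ^ (m + 1) := by positivity
    have h1 : r ^ 2 ^ (m + 1) ≤ K * (2 ^ (m + 1) * D + 1) ^ k := by
      rw [hr, div_pow, div_le_iff₀ (by positivity)]
      exact h m
    have h2 : (2 : ℝ) ^ (m + 1) * D + 1 ≤ (D + 1) * 2 ^ (m + 1) := by
      have : (1 : ℝ) ≤ 2 ^ (m + 1) := one_le_pow₀ (by norm_num)
      nlinarith
    rw [← mul_div_assoc, le_div_iff₀ hpos, one_mul]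
    refine h1.trans ?_
    rw [mul_assoc]
    refine mul_le_mul_of_nonneg_left ?_ hK
    rw [← mul_pow]
    push_cast
    gcongr
  have hlim := ((tendsto_pow_const_div_const_pow_of_one_lt k hr1).comp
    ((tendsto_pow_atTop_atTop_of_one_lt (one_lt_two (α := ℕ))).comp
      (Filter.tendsto_add_atTop_nat 1))).const_mul (K * (D + 1) ^ k)
  rw [mul_zero] at hlim
  have := ge_of_tendsto' hlim hb
  norm_num at this

/-- `ζ^j` for a primitive `M`-th root of unity `ζ`. -/
def rootOfUnity (M j : ℕ) : Circle := Circle.exp (2 * Real.pi / M) ^ j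

/-- A geometric sum in `ζ ^ (m - n)`; the bound on `|m - n|` prevents a nonzero exponent from being
divisible by `M`. -/
theorem sum_rootOfUnity {M m n : ℕ} (h : |(m : ℤ) - n| < M) :
    ∑ j : Fin M, ((rootOfUnity M j : ℂ) ^ m * star ((rootOfUnity M j : ℂ) ^ n)) =
      if m = n then (M : ℂ) else 0 := by
  have hM : M ≠ 0 := by
    rintro rfl
    exact absurd h (by simp)
  obtain ⟨ζ, hζ⟩ : ∃ ζ : ℂ, ζ = Circle.exp (2 * Real.pi / M) := ⟨_, rfl⟩
  have hprim : IsPrimitiveRoot ζ M := by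
    have := Complex.isPrimitiveRoot_exp M hM
    rw [hζ, Circle.coe_exp]
    convert this using 2
    push_cast
    ring
  have h0 : ζ ≠ 0 := hζ ▸ Circle.coe_ne_zero _
  have hw : ∀ j : ℕ, (rootOfUnity M j : ℂ) ^ m * star ((rootOfUnity M j : ℂ) ^ n) =
      (ζ ^ ((m : ℤ) - n)) ^ j := by
    intro j
    rw [rootOfUnity, Circle.coe_pow, ← hζ, star_pow, star_pow, Complex.star_def, hζ,
      ← Circle.coe_inv_eq_conj, Circle.coe_inv, ← hζ, zpow_sub₀ h0, div_eq_mul_inv, mul_pow,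
      zpow_natCast, zpow_natCast]
    ring
  simp only [hw]
  rw [Fin.sum_univ_eq_sum_range (fun j => (ζ ^ ((m : ℤ) - n)) ^ j) M]
  split_ifs with hmn
  · subst hmn
    simp
  · have hne : ζ ^ ((m : ℤ) - n) ≠ 1 := by
      rw [Ne, hprim.zpow_eq_one_iff_dvd]
      intro hdvd
      have := Int.eq_zero_of_abs_lt_dvd hdvd h
      omega
    have hpow : (ζ ^ ((m : ℤ) - n)) ^ M = 1 := by
      rw [← zpow_natCast, ← zpow_mul, mul_comm, zpow_mul, zpow_natCast, hprim.pow_eq_one, one_zpow]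
    have hg := geom_sum_mul (ζ ^ ((m : ℤ) - n)) M
    rw [hpow, sub_self] at hg
    exact (mul_eq_zero.mp hg).resolve_right (sub_ne_zero.mpr hne)

/-- The evaluation of an element of an `ℓ^∞`-direct sum at a coordinate. -/
def lpEval {ι : Type*} {A : ι → Type*} [∀ i, NonUnitalCStarAlgebra (A i)] (i : ι) :
    lp A ∞ →⋆ₙₐ[ℂ] A i where
  toFun a := a i
  map_smul' _ _ := rfl
  map_zero' := rfl
  map_add' _ _ := rfl
  map_mul' _ _ := rfl
  map_star' _ := rfl

theorem lpEval_apply {ι : Type*} {A : ι → Type*} [∀ i, NonUnitalCStarAlgebra (A i)] (i : ι)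
    (a : lp A ∞) : lpEval i a = a i := rfl

namespace KGraph

variable {k : ℕ} {Λ : Type u} {G : KGraph k Λ} {c : G.TwoCocycle}

/-! ### The universal family and the gauge action -/

theorem lpEval_universalFamily (i : G.CuntzKriegerFamily c) (l : Λ) :
    lpEval i (G.universalFamily c l) = i.t l := rfl

theorem lpEval_mul_star (i : G.CuntzKriegerFamily c) (μ ν : Λ) :
    lpEval i (G.universalFamily c μ * star (G.universalFamily c ν)) = i.t μ * star (i.t ν) := rfl

theorem isFamily_universalFamily (hfin : G.RowFinite) :
    G.IsCuntzKriegerFamily c (G.universalFamily c) where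
  projection v hv :=
    { isIdempotentElem := lp.ext (funext fun i =>
        ((i.isFamily.projection v hv).isIdempotentElem.eq :))
      isSelfAdjoint := lp.ext (funext fun i =>
        ((i.isFamily.projection v hv).isSelfAdjoint.star_eq :)) }
  orthogonal v w hv hw h := lp.ext (funext fun i => i.isFamily.orthogonal v w hv hw h)
  mul μ ν h := lp.ext (funext fun i => i.isFamily.mul μ ν h)
  star_mul_self l := lp.ext (funext fun i => i.isFamily.star_mul_self l)
  sum v hv n := by
    rw [finsum_mem_eq_finite_toFinset_sum _ (hfin v hv n)]
    refine lp.ext (funext fun i => ?_)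
    have h := i.isFamily.vertex_eq_sum hfin hv n
    rw [← lpEval_apply i, ← lpEval_apply i, map_sum]
    exact h

/-! ### Gauge translates and their averages -/

/-- `z^n`. -/
def zPow (z : Fin k → Circle) (n : Fin k → ℕ) : Circle := ∏ i, z i ^ n i

theorem zPow_add (z : Fin k → Circle) (m n : Fin k → ℕ) :
    zPow z (m + n) = zPow z m * zPow z n := by
  simp only [zPow, Pi.add_apply, pow_add, Finset.prod_mul_distrib]

theorem zPow_zero (z : Fin k → Circle) : zPow z 0 = 1 := by simp [zPow]

theorem circle_mul_star (w : Circle) : (w : ℂ) * star (w : ℂ) = 1 := by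
  rw [Complex.star_def, ← Circle.coe_inv_eq_conj, ← Circle.coe_mul, mul_inv_cancel, Circle.coe_one]

theorem isFamily_gauge {B : Type*} [NonUnitalCStarAlgebra B] {t : Λ → B}
    (ht : G.IsCuntzKriegerFamily c t) (z : Fin k → Circle) :
    G.IsCuntzKriegerFamily c fun l => (zPow z (G.d l) : ℂ) • t l := by
  have hv : ∀ v, G.IsVertex v → (zPow z (G.d v) : ℂ) • t v = t v := fun v hv => by
    rw [show G.d v = 0 from hv, zPow_zero, Circle.coe_one, one_smul]
  constructor
  · intro v h
    rw [hv v h]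
    exact ht.projection v h
  · intro v w h h' hne
    rw [hv v h, hv w h', ht.orthogonal v w h h' hne]
  · intro μ ν h
    rw [smul_mul_smul_comm, ht.mul μ ν h, G.d_comp μ ν h, zPow_add, Circle.coe_mul, smul_comm]
  · intro l
    rw [hv _ (isVertex_s l), star_smul, smul_mul_smul_comm, mul_comm, circle_mul_star, one_smul,
      ht.star_mul_self]
  · intro v h n
    rw [hv v h, ht.sum v h n]
    refine finsum_congr fun l => finsum_congr fun _ => ?_
    rw [star_smul, smul_mul_smul_comm, circle_mul_star, one_smul]

/-- The gauge action on Cuntz-Krieger families. -/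
abbrev CuntzKriegerFamily.gauge (i : G.CuntzKriegerFamily c) (z : Fin k → Circle) :
    G.CuntzKriegerFamily c where
  B := i.B
  t l := (zPow z (G.d l) : ℂ) • i.t l
  isFamily := isFamily_gauge i.isFamily z

/-- The evaluation at a gauge translate of `i`. -/
def gaugeEval (i : G.CuntzKriegerFamily c) (z : Fin k → Circle) :
    lp (fun i : G.CuntzKriegerFamily c => i.B) ∞ →⋆ₙₐ[ℂ] i.B :=
  lpEval (i.gauge z)

theorem gaugeEval_mul_star (i : G.CuntzKriegerFamily c) (z : Fin k → Circle) (μ ν : Λ) :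
    gaugeEval i z (G.universalFamily c μ * star (G.universalFamily c ν)) =
      ((zPow z (G.d μ) : ℂ) * star (zPow z (G.d ν) : ℂ)) • (i.t μ * star (i.t ν)) := by
  rw [map_mul, map_star]
  change ((zPow z (G.d μ) : ℂ) • i.t μ) * star ((zPow z (G.d ν) : ℂ) • i.t ν) = _
  rw [star_smul, smul_mul_smul_comm]

/-- The pairs of paths whose degrees differ by at most `D`. -/
def DegLE (G : KGraph k Λ) (D : ℕ) (μ ν : Λ) : Prop := ∀ i, |(G.d μ i : ℤ) - G.d ν i| ≤ D

/-- A generator is `t_l t_{s(l)}^*`, and degree differences add under products, so each polynomial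
in the generators has bounded degree spread. -/
theorem exists_mem_ckSpan_degLE (hfin : G.RowFinite)
    {a : lp (fun i : G.CuntzKriegerFamily c => i.B) ∞}
    (ha : a ∈ NonUnitalStarAlgebra.adjoin ℂ (Set.range (G.universalFamily c))) :
    ∃ D, a ∈ ckSpan (G.universalFamily c) (G.DegLE D) := by
  have ht := isFamily_universalFamily (c := c) hfin
  have mono : ∀ {D E : ℕ}, D ≤ E → ckSpan (G.universalFamily c) (G.DegLE D) ≤
      ckSpan (G.universalFamily c) (G.DegLE E) := fun h =>
    ckSpan_mono fun μ ν hD i => (hD i).trans (by exact_mod_cast h)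
  induction ha using NonUnitalStarAlgebra.adjoin_induction with
  | mem x hx =>
    obtain ⟨l, rfl⟩ := hx
    refine ⟨∑ i, G.d l i, ?_⟩
    have := mem_ckSpan (t := G.universalFamily c) (R := G.DegLE (∑ i, G.d l i)) (μ := l)
      (ν := G.s l) (fun i => by
        rw [G.d_s, Pi.zero_apply, Nat.cast_zero, sub_zero, Nat.abs_cast]
        exact_mod_cast Finset.single_le_sum (f := G.d l) (fun _ _ => Nat.zero_le _)
          (Finset.mem_univ i))
    rwa [ht.star_vertex (isVertex_s l), ht.mul_s] at this
  | add x y _ _ hx hy =>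
    obtain ⟨D, hD⟩ := hx
    obtain ⟨E, hE⟩ := hy
    exact ⟨max D E, Submodule.add_mem _ (mono (le_max_left _ _) hD) (mono (le_max_right _ _) hE)⟩
  | zero => exact ⟨0, Submodule.zero_mem _⟩
  | mul x y _ _ hx hy =>
    obtain ⟨D, hD⟩ := hx
    obtain ⟨E, hE⟩ := hy
    refine ⟨D + E, mul_mem_ckSpan (fun μ ν κ ρ h1 h2 => ?_) hD hE⟩
    refine ckSpan_mono (fun a b hab i => ?_) (ht.mul_mem hfin μ ν κ ρ)
    have e := congrFun hab i
    have h3 := h1 i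
    have h4 := h2 i
    simp only [Pi.add_apply] at e
    rw [abs_le] at h3 h4 ⊢
    push_cast
    omega
  | smul r x _ hx =>
    obtain ⟨D, hD⟩ := hx
    exact ⟨D, Submodule.smul_mem _ _ hD⟩
  | star x _ hx =>
    obtain ⟨D, hD⟩ := hx
    exact ⟨D, star_mem_ckSpan (fun μ ν h i => by rw [abs_sub_comm]; exact h i) hD⟩

theorem star_mul_mem_ckSpan_degLE (hfin : G.RowFinite) {D : ℕ}
    {a : lp (fun i : G.CuntzKriegerFamily c => i.B) ∞}
    (ha : a ∈ ckSpan (G.universalFamily c) (G.DegLE D)) :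
    star a * a ∈ ckSpan (G.universalFamily c) (G.DegLE (2 * D)) := by
  have ht := isFamily_universalFamily (c := c) hfin
  refine mul_mem_ckSpan (R := G.DegLE D) (R' := G.DegLE D) (fun μ ν κ ρ h1 h2 => ?_)
    (star_mem_ckSpan (fun μ ν h i => by rw [abs_sub_comm]; exact h i) ha) ha
  refine ckSpan_mono (fun a b hab i => ?_) (ht.mul_mem hfin μ ν κ ρ)
  have e := congrFun hab i
  have h3 := h1 i
  have h4 := h2 i
  simp only [Pi.add_apply] at e
  rw [abs_le] at h3 h4 ⊢
  push_cast
  omega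

theorem gaugeEval_one {R : Λ → Λ → Prop} {a : lp (fun i : G.CuntzKriegerFamily c => i.B) ∞}
    (ha : a ∈ ckSpan (G.universalFamily c) R) (i : G.CuntzKriegerFamily c) :
    gaugeEval i 1 a = a i := by
  refine ckSpan_induction (p := fun a => gaugeEval i 1 a = lpEval i a) (fun μ ν _ => ?_)
    ?_ ?_ ?_ ha
  · rw [gaugeEval_mul_star, lpEval_mul_star]
    simp [zPow]
  · rw [map_zero, map_zero]
  · intro x y hx hy
    rw [map_add, map_add, hx, hy]
  · intro z x hx
    rw [map_smul, map_smul, hx]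

/-- Averaging over the gauge translates by roots of unity picks out the part of degree `0`. -/
theorem exists_sum_gaugeEval {D M : ℕ} (hDM : D < M)
    {a : lp (fun i : G.CuntzKriegerFamily c => i.B) ∞}
    (ha : a ∈ ckSpan (G.universalFamily c) (G.DegLE D)) :
    ∃ q ∈ ckSpan (G.universalFamily c) (fun μ ν => G.d μ = G.d ν),
      ∀ i : G.CuntzKriegerFamily c,
        ∑ j : Fin k → Fin M, gaugeEval i (fun m => rootOfUnity M (j m)) a =
          ((M : ℂ) ^ k) • (q i : i.B) := by
  refine ckSpan_induction (p := fun a => ∃ q ∈ ckSpan (G.universalFamily c)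
    (fun μ ν => G.d μ = G.d ν), ∀ i : G.CuntzKriegerFamily c,
      ∑ j : Fin k → Fin M, gaugeEval i (fun m => rootOfUnity M (j m)) a =
        ((M : ℂ) ^ k) • lpEval i q) (fun μ ν h => ?_) ?_ ?_ ?_ ha
  · have hsum : ∑ j : Fin k → Fin M, ((zPow (fun m => rootOfUnity M (j m)) (G.d μ) : ℂ) *
        star (zPow (fun m => rootOfUnity M (j m)) (G.d ν) : ℂ)) =
          ∏ m : Fin k, if G.d μ m = G.d ν m then (M : ℂ) else 0 := by
      have hp : ∀ (z : Fin k → Circle) n, (zPow z n : ℂ) = ∏ m, (z m : ℂ) ^ n m := fun z n =>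
        map_prod Circle.coeHom _ _
      simp only [hp, star_prod, ← Finset.prod_mul_distrib]
      -- The sum over tuples of roots factors into one orthogonality sum per coordinate.
      rw [← Fintype.piFinset_univ, Finset.sum_prod_piFinset Finset.univ fun m (j : Fin M) =>
        (rootOfUnity M j : ℂ) ^ G.d μ m * star ((rootOfUnity M j : ℂ) ^ G.d ν m)]
      refine Finset.prod_congr rfl fun m _ => sum_rootOfUnity ?_
      exact (h m).trans_lt (by exact_mod_cast hDM)
    by_cases hd : G.d μ = G.d ν
    · refine ⟨_, mem_ckSpan hd, fun i => ?_⟩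
      simp only [gaugeEval_mul_star, ← Finset.sum_smul, hsum, lpEval_mul_star]
      simp [hd]
    · refine ⟨0, Submodule.zero_mem _, fun i => ?_⟩
      obtain ⟨m, hm⟩ := Function.ne_iff.mp hd
      simp only [gaugeEval_mul_star, ← Finset.sum_smul, hsum]
      rw [Finset.prod_eq_zero (Finset.mem_univ m) (if_neg hm), zero_smul, map_zero, smul_zero]
  · exact ⟨0, Submodule.zero_mem _, fun i => by simp⟩
  · rintro x y ⟨q, hq, e⟩ ⟨q', hq', e'⟩
    refine ⟨q + q', Submodule.add_mem _ hq hq', fun i => ?_⟩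
    simp only [map_add, Finset.sum_add_distrib, e, e', smul_add]
  · rintro z x ⟨q, hq, e⟩
    refine ⟨z • q, Submodule.smul_mem _ _ hq, fun i => ?_⟩
    simp only [map_smul, ← Finset.smul_sum, e]
    rw [smul_comm]

end KGraph

namespace KGraph

variable {k : ℕ} {Λ : Type u} {G : KGraph k Λ} {c : G.TwoCocycle}

/-! ### The gauge-invariant uniqueness theorem -/

/-- The square `star a * a`, iterated. -/
def iterSq {B : Type*} [Mul B] [Star B] (a : B) : ℕ → B
  | 0 => a
  | m + 1 => star (iterSq a m) * iterSq a m

theorem map_iterSq {A B : Type*} [NonUnitalCStarAlgebra A] [NonUnitalCStarAlgebra B]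
    (φ : A →⋆ₙₐ[ℂ] B) (a : A) (m : ℕ) : φ (iterSq a m) = iterSq (φ a) m := by
  induction m with
  | zero => rfl
  | succ m ih => rw [iterSq, map_mul, map_star, ih, iterSq]

theorem norm_iterSq {B : Type*} [NonUnitalCStarAlgebra B] (a : B) (m : ℕ) :
    ‖iterSq a m‖ = ‖a‖ ^ 2 ^ m := by
  induction m with
  | zero => simp [iterSq]
  | succ m ih => rw [iterSq, CStarRing.norm_star_mul_self, ih, pow_succ, pow_mul, sq]

theorem norm_iterSq_apply {ι : Type*} {A : ι → Type*} [∀ i, NonUnitalCStarAlgebra (A i)]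
    (a : lp A ∞) (m : ℕ) (i : ι) : ‖iterSq a m i‖ = ‖a i‖ ^ 2 ^ m := by
  rw [← lpEval_apply, map_iterSq, norm_iterSq, lpEval_apply]

section

variable {B : Type*} [NonUnitalCStarAlgebra B] {t : Λ → B}

/-- The pairs of paths in `F` with equal sources. -/
def PairIn (G : KGraph k Λ) (F : Finset Λ) (μ ν : Λ) : Prop := μ ∈ F ∧ ν ∈ F ∧ G.s μ = G.s ν

/-- The pairs of paths of degree `N` with equal sources. -/
def PairOfDeg (G : KGraph k Λ) (N : Fin k → ℕ) (μ ν : Λ) : Prop :=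
  G.d μ = N ∧ G.d ν = N ∧ G.s μ = G.s ν

theorem exists_mem_pairIn {N : Fin k → ℕ} {q : B}
    (hq : q ∈ ckSpan t (G.PairOfDeg N)) :
    ∃ F : Finset Λ, (∀ l ∈ F, G.d l = N) ∧ q ∈ ckSpan t (G.PairIn F) := by
  classical
  have mono : ∀ {F F' : Finset Λ}, F ⊆ F' → ckSpan t (G.PairIn F) ≤ ckSpan t (G.PairIn F') :=
    fun h => ckSpan_mono fun μ ν h' => ⟨h h'.1, h h'.2.1, h'.2.2⟩
  refine ckSpan_induction (p := fun q => ∃ F : Finset Λ, (∀ l ∈ F, G.d l = N) ∧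
    q ∈ ckSpan t (G.PairIn F)) (fun μ ν hd => ⟨{μ, ν}, ?_, mem_ckSpan ?_⟩)
    ⟨∅, by simp, Submodule.zero_mem _⟩ ?_ ?_ hq
  · intro l hl
    rcases Finset.mem_insert.mp hl with rfl | hl
    · exact hd.1
    · rw [Finset.mem_singleton.mp hl]
      exact hd.2.1
  · exact ⟨by simp, by simp, hd.2.2⟩
  · rintro x y ⟨F, hF, h⟩ ⟨F', hF', h'⟩
    refine ⟨F ∪ F', fun l hl => ?_, Submodule.add_mem _ (mono Finset.subset_union_left h)
      (mono Finset.subset_union_right h')⟩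
    exact (Finset.mem_union.mp hl).elim (hF l) (hF' l)
  · rintro z x ⟨F, hF, h⟩
    exact ⟨F, hF, Submodule.smul_mem _ _ h⟩

namespace IsCuntzKriegerFamily

variable (ht : G.IsCuntzKriegerFamily c t) (hfin : G.RowFinite)

include ht hfin

/-- Each `t_μ t_ν^*` with `d(μ) = d(ν)` and equal sources expands over paths of every larger degree,
so finitely many can be brought to one common degree; with unequal sources it vanishes. -/
theorem exists_mem_pairOfDeg {q : B} (hq : q ∈ ckSpan t fun μ ν => G.d μ = G.d ν) :
    ∃ N, q ∈ ckSpan t (G.PairOfDeg N) := by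
  suffices ∃ N₀, ∀ N, N₀ ≤ N → q ∈ ckSpan t (G.PairOfDeg N) from
    this.imp fun N h => h N le_rfl
  refine ckSpan_induction (p := fun q => ∃ N₀, ∀ N, N₀ ≤ N → q ∈ ckSpan t (G.PairOfDeg N))
    (fun μ ν hd => ⟨G.d μ, fun N hN => ?_⟩) ⟨0, fun N _ => Submodule.zero_mem _⟩ ?_ ?_ hq
  · by_cases hs : G.s μ = G.s ν
    · rw [ht.mul_star_eq_sum hfin hs (N - G.d μ)]
      refine Submodule.sum_mem _ fun α hα => Submodule.smul_mem _ _ (mem_ckSpan ?_)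
      rw [Set.Finite.mem_toFinset] at hα
      have h1 : G.s μ = G.r α := hα.1.symm
      have h2 : G.s ν = G.r α := hs ▸ h1
      refine ⟨?_, ?_, ?_⟩
      · rw [G.d_comp _ _ h1, hα.2, add_tsub_cancel_of_le hN]
      · rw [G.d_comp _ _ h2, hα.2, ← hd, add_tsub_cancel_of_le hN]
      · rw [G.s_comp _ _ h1, G.s_comp _ _ h2]
    · rw [ht.mul_star_eq_zero hs]
      exact Submodule.zero_mem _
  · rintro x y ⟨N, hN⟩ ⟨N', hN'⟩
    exact ⟨N ⊔ N', fun M hM => Submodule.add_mem _ (hN M (le_sup_left.trans hM))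
      (hN' M (le_sup_right.trans hM))⟩
  · rintro z x ⟨N, hN⟩
    exact ⟨N, fun M hM => Submodule.smul_mem _ _ (hN M hM)⟩

theorem mul_mem_pairIn {F : Finset Λ} {N : Fin k → ℕ} (hF : ∀ l ∈ F, G.d l = N) {a b : B}
    (ha : a ∈ ckSpan t (G.PairIn F)) (hb : b ∈ ckSpan t (G.PairIn F)) :
    a * b ∈ ckSpan t (G.PairIn F) := by
  refine mul_mem_ckSpan (fun μ ν κ ρ h1 h2 => ?_) ha hb
  rw [mul_assoc, ← mul_assoc (star (t ν))]
  by_cases h : ν = κ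
  · subst h
    rw [ht.star_mul_self, ← mul_assoc, ← h1.2.2, ht.mul_s]
    exact mem_ckSpan ⟨h1.1, h2.2.1, h1.2.2.trans h2.2.2⟩
  · rw [ht.star_mul_eq_zero hfin ((hF _ h1.2.1).trans (hF _ h2.1).symm) h, zero_mul, mul_zero]
    exact Submodule.zero_mem _

theorem iterSq_mem_pairIn {F : Finset Λ} {N : Fin k → ℕ} (hF : ∀ l ∈ F, G.d l = N) {q : B}
    (hq : q ∈ ckSpan t (G.PairIn F)) (m : ℕ) : iterSq q m ∈ ckSpan t (G.PairIn F) := by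
  induction m with
  | zero => exact hq
  | succ m ih =>
    exact ht.mul_mem_pairIn hfin hF
      (star_mem_ckSpan (fun μ ν h => ⟨h.2.1, h.1, h.2.2.symm⟩) ih) ih

/-- Orthogonality makes the `t_l t_κ^*` behave as matrix units, and the compression `t_l^* q t_κ`
picks out the matrix coefficient. -/
theorem eq_sum_of_mem_pairIn {F : Finset Λ} {N : Fin k → ℕ} (hF : ∀ l ∈ F, G.d l = N) {q : B}
    (hq : q ∈ ckSpan t (G.PairIn F)) :
    q = ∑ l ∈ F, ∑ κ ∈ F, t l * (star (t l) * q * t κ) * star (t κ) := by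
  refine ckSpan_induction (p := fun q => q = ∑ l ∈ F, ∑ κ ∈ F,
    t l * (star (t l) * q * t κ) * star (t κ)) (fun μ ν h => ?_) ?_ ?_ ?_ hq
  · have h0 : ∀ l ∈ F, ∀ κ, l ≠ μ →
        t l * (star (t l) * (t μ * star (t ν)) * t κ) * star (t κ) = 0 := fun l hl κ hne => by
      rw [← mul_assoc (star (t l)), ht.star_mul_eq_zero hfin ((hF l hl).trans (hF μ h.1).symm) hne,
        zero_mul, zero_mul, mul_zero, zero_mul]
    have h0' : ∀ κ ∈ F, ∀ l, κ ≠ ν →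
        t l * (star (t l) * (t μ * star (t ν)) * t κ) * star (t κ) = 0 := fun κ hκ l hne => by
      rw [← mul_assoc (star (t l)), mul_assoc _ _ (t κ),
        ht.star_mul_eq_zero hfin ((hF ν h.2.1).trans (hF κ hκ).symm) hne.symm,
        mul_zero, mul_zero, zero_mul]
    rw [Finset.sum_eq_single_of_mem μ h.1 fun l hl hne =>
      Finset.sum_eq_zero fun κ _ => h0 l hl κ hne,
      Finset.sum_eq_single_of_mem ν h.2.1 fun κ hκ hne => h0' κ hκ μ hne]
    rw [← mul_assoc (star (t μ)), ht.star_mul_self, mul_assoc (t (G.s μ)), ht.star_mul_self,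
      ← h.2.2, ht.vertex_mul_self (isVertex_s μ), ht.mul_s]
  · simp
  · intro x y hx hy
    simp only [mul_add, add_mul, Finset.sum_add_distrib, ← hx, ← hy]
  · intro z x hx
    simp only [mul_smul_comm, smul_mul_assoc, ← Finset.smul_sum, ← hx]

theorem exists_compress_eq {F : Finset Λ} {N : Fin k → ℕ} (hF : ∀ l ∈ F, G.d l = N) {q : B}
    (hq : q ∈ ckSpan t (G.PairIn F)) {l κ : Λ} (hl : l ∈ F) (hκ : κ ∈ F) :
    ∃ z : ℂ, star (t l) * q * t κ = z • t (G.s l) := by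
  refine ckSpan_induction (p := fun q => ∃ z : ℂ, star (t l) * q * t κ = z • t (G.s l))
    (fun μ ν h => ?_) ⟨0, by simp⟩ ?_ ?_ hq
  · by_cases h1 : l = μ
    · by_cases h2 : ν = κ
      · refine ⟨1, ?_⟩
        rw [one_smul, ← mul_assoc, mul_assoc, h1, h2, ht.star_mul_self, ht.star_mul_self, ← h2,
          ← h.2.2, ht.vertex_mul_self (isVertex_s μ)]
      · refine ⟨0, ?_⟩
        rw [← mul_assoc, mul_assoc,
          ht.star_mul_eq_zero hfin ((hF ν h.2.1).trans (hF κ hκ).symm) h2, mul_zero, zero_smul]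
    · refine ⟨0, ?_⟩
      rw [← mul_assoc, ht.star_mul_eq_zero hfin ((hF l hl).trans (hF μ h.1).symm) h1,
        zero_mul, zero_mul, zero_smul]
  · rintro x y ⟨z, hz⟩ ⟨w, hw⟩
    exact ⟨z + w, by rw [mul_add, add_mul, hz, hw, add_smul]⟩
  · rintro w x ⟨z, hz⟩
    exact ⟨w * z, by rw [mul_smul_comm, smul_mul_assoc, hz, smul_smul]⟩

end IsCuntzKriegerFamily

end

variable {ι : Type*} {j : ι → G.CuntzKriegerFamily c}

/-- On the part of degree `0`, families with nonzero vertex projections are faithful. -/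
theorem norm_le_of_deg_zero (hfin : G.RowFinite)
    (hj : ∀ v, G.IsVertex v → ∃ x, (j x).t v ≠ 0)
    {q : lp (fun i : G.CuntzKriegerFamily c => i.B) ∞}
    (hq : q ∈ ckSpan (G.universalFamily c) fun μ ν => G.d μ = G.d ν) {C : ℝ} (hC0 : 0 ≤ C)
    (hC : ∀ x, ‖q (j x)‖ ≤ C) (i : G.CuntzKriegerFamily c) : ‖q i‖ ≤ C := by
  have hu := isFamily_universalFamily (c := c) hfin
  obtain ⟨N, hN⟩ := hu.exists_mem_pairOfDeg hfin hq
  obtain ⟨F, hF, hqF⟩ := exists_mem_pairIn hN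
  -- A crude bound, each of the `|F|²` coefficients being estimated separately; the constant
  -- disappears below by passing to iterated squares.
  have key : ∀ q' ∈ ckSpan (G.universalFamily c) (G.PairIn F), ∀ C', 0 ≤ C' →
      (∀ x, ‖q' (j x)‖ ≤ C') → ‖q' i‖ ≤ (F.card * F.card : ℝ) * C' := by
    intro q' hq' C' hC0' hC'
    have h1 := congrArg (lpEval i) (hu.eq_sum_of_mem_pairIn hfin hF hq')
    rw [← lpEval_apply, h1, map_sum]
    have hle : ∀ l ∈ F, ∀ κ ∈ F, ‖lpEval i (G.universalFamily c l *
        (star (G.universalFamily c l) * q' * G.universalFamily c κ) *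
          star (G.universalFamily c κ))‖ ≤ C' := by
      intro l hl κ hκ
      obtain ⟨z, hz⟩ := hu.exists_compress_eq hfin hF hq' hl hκ
      -- The scalar `z` is the same in every family, so it can be measured in one where the vertex
      -- projection is nonzero and hence has norm one.
      obtain ⟨x, hx⟩ := hj _ (isVertex_s l)
      have hz1 : ‖z‖ ≤ C' := by
        have h2 := congrArg (fun b => ‖lpEval (j x) b‖) hz
        simp only [map_mul, map_star, map_smul, lpEval_universalFamily] at h2
        rw [norm_smul, norm_eq_one_of_isStarProjection
          ((j x).isFamily.projection _ (isVertex_s l)) hx, mul_one] at h2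
        rw [← h2]
        have h3 := (j x).isFamily.norm_le_one l
        have h4 := (j x).isFamily.norm_le_one κ
        calc _ ≤ ‖star ((j x).t l)‖ * ‖q' (j x)‖ * ‖(j x).t κ‖ :=
              (norm_mul_le _ _).trans (mul_le_mul_of_nonneg_right (norm_mul_le _ _)
                (norm_nonneg _))
          _ ≤ 1 * C' * 1 := by
            rw [norm_star]
            gcongr
            exact hC' x
          _ = C' := by ring
      rw [hz]
      simp only [map_mul, map_star, map_smul, lpEval_universalFamily]
      have h3 := i.isFamily.norm_le_one l
      have h4 := i.isFamily.norm_le_one κ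
      have h5 := i.isFamily.norm_le_one (G.s l)
      calc _ ≤ ‖i.t l‖ * ‖z • i.t (G.s l)‖ * ‖star (i.t κ)‖ :=
            (norm_mul_le _ _).trans (mul_le_mul_of_nonneg_right (norm_mul_le _ _)
              (norm_nonneg _))
        _ ≤ 1 * (C' * 1) * 1 := by
          rw [norm_star, norm_smul]
          gcongr
        _ = C' := by ring
    refine (norm_sum_le_of_le F (f := fun l => lpEval i (∑ κ ∈ F, G.universalFamily c l *
        (star (G.universalFamily c l) * q' * G.universalFamily c κ) *
          star (G.universalFamily c κ))) (n := fun _ => F.card * C') fun l hl => ?_).trans_eq ?_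
    · rw [map_sum]
      refine (norm_sum_le_of_le F (hle l hl)).trans_eq ?_
      rw [Finset.sum_const, nsmul_eq_mul]
    · rw [Finset.sum_const, nsmul_eq_mul, mul_assoc]
  refine le_of_forall_pow_le (D := 0) (K := F.card * F.card) hC0 le_rfl (by positivity) 0
    fun m => ?_
  have h := key _ (hu.iterSq_mem_pairIn hfin hF hqF (m + 1)) (C ^ 2 ^ (m + 1)) (by positivity)
    fun x => by
      rw [norm_iterSq_apply]
      exact pow_le_pow_left₀ (norm_nonneg _) (hC x) _
  rw [norm_iterSq_apply] at h
  simpa using h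

/-- A form of the gauge-invariant uniqueness theorem: a collection of families with nonzero
vertex projections, the norms of which are gauge-invariant, determines all norms. -/
theorem norm_le_of_gauge (hfin : G.RowFinite) (hj : ∀ v, G.IsVertex v → ∃ x, (j x).t v ≠ 0)
    (hg : ∀ b ∈ NonUnitalStarAlgebra.adjoin ℂ (Set.range (G.universalFamily c)), ∀ x z,
      ‖gaugeEval (j x) z b‖ ≤ ‖b (j x)‖)
    {a : lp (fun i : G.CuntzKriegerFamily c => i.B) ∞}
    (ha : a ∈ NonUnitalStarAlgebra.adjoin ℂ (Set.range (G.universalFamily c))) {C : ℝ}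
    (hC0 : 0 ≤ C) (hC : ∀ x, ‖a (j x)‖ ≤ C) (i : G.CuntzKriegerFamily c) : ‖a i‖ ≤ C := by
  obtain ⟨D, hD⟩ := exists_mem_ckSpan_degLE hfin ha
  have hmem : ∀ m, iterSq a m ∈ NonUnitalStarAlgebra.adjoin ℂ (Set.range (G.universalFamily c)) ∧
      iterSq a m ∈ ckSpan (G.universalFamily c) (G.DegLE (2 ^ m * D)) := by
    intro m
    induction m with
    | zero => exact ⟨ha, by simpa [iterSq] using hD⟩
    | succ m ih =>
      refine ⟨mul_mem (star_mem ih.1) ih.1, ?_⟩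
      have := star_mul_mem_ckSpan_degLE hfin ih.2
      rwa [← mul_assoc, ← pow_succ'] at this
  refine le_of_forall_pow_le (D := D) (K := 1) hC0 (Nat.cast_nonneg _) zero_le_one k fun m => ?_
  -- One more than the degree spread of the iterated square, so the average leaves exactly its
  -- degree-zero part.
  set M := 2 ^ (m + 1) * D + 1 with hM
  have hMpos : 0 < M := Nat.succ_pos _
  obtain ⟨q, hq, hsum⟩ := exists_sum_gaugeEval (M := M) (Nat.lt_succ_self _) (hmem (m + 1)).2
  have hqC : ∀ i, ‖q i‖ ≤ C ^ 2 ^ (m + 1) := by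
    refine norm_le_of_deg_zero hfin hj hq (by positivity) fun x => ?_
    have h1 := congrArg norm (hsum (j x))
    rw [norm_smul, norm_pow, Complex.norm_natCast] at h1
    have h2 : ‖∑ l : Fin k → Fin M, gaugeEval (j x) (fun m => rootOfUnity M (l m))
        (iterSq a (m + 1))‖ ≤ ∑ _l : Fin k → Fin M, C ^ 2 ^ (m + 1) := by
      refine norm_sum_le_of_le _ fun l _ => (hg _ (hmem (m + 1)).1 x _).trans ?_
      rw [norm_iterSq_apply]
      exact pow_le_pow_left₀ (norm_nonneg _) (hC x) _
    rw [Finset.sum_const, Finset.card_univ, Fintype.card_fun, Fintype.card_fin, Fintype.card_fin,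
      nsmul_eq_mul, Nat.cast_pow] at h2
    refine le_of_mul_le_mul_left (h1.symm.trans_le h2) (by positivity)
  -- The tuple of zero exponents is the trivial translate.
  have h1 : ‖a i‖ ^ 2 ^ (m + 1) = ‖gaugeEval i (fun m => rootOfUnity M
      ((fun _ => ⟨0, hMpos⟩ : Fin k → Fin M) m)) (iterSq a (m + 1))‖ := by
    have hone : (fun m : Fin k => rootOfUnity M ((fun _ => ⟨0, hMpos⟩ : Fin k → Fin M) m)) = 1 := by
      funext m
      simp [rootOfUnity]
    rw [hone, gaugeEval_one (hmem (m + 1)).2, norm_iterSq_apply]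
  -- The trivial translate is dominated by the sum of all of them; this takes the place of a
  -- faithful conditional expectation.
  have h2 := norm_star_mul_self_le_sum Finset.univ
    (fun l : Fin k → Fin M => gaugeEval i (fun m => rootOfUnity M (l m)) (iterSq a m))
    (Finset.mem_univ (fun _ => ⟨0, hMpos⟩))
  simp only [← map_star, ← map_mul] at h2
  change ‖gaugeEval i _ (iterSq a (m + 1))‖ ≤ ‖∑ l : Fin k → Fin M, gaugeEval i
    (fun m => rootOfUnity M (l m)) (iterSq a (m + 1))‖ at h2
  rw [← h1, hsum i, norm_smul, norm_pow, Complex.norm_natCast] at h2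
  refine h2.trans ?_
  rw [one_mul]
  have hMr : (M : ℝ) = 2 ^ (m + 1) * D + 1 := by
    rw [hM]
    push_cast
    rfl
  rw [← hMr]
  exact mul_le_mul_of_nonneg_left (hqC i) (by positivity)

end KGraph

/-! ### Isomorphisms of generated `C*`-algebras -/

/-- The homomorphism to an `ℓ^∞`-direct sum with given coordinates. -/
def lpPi {ι E : Type*} {A : ι → Type*} [NonUnitalCStarAlgebra E]
    [∀ i, NonUnitalCStarAlgebra (A i)] (e : ∀ i, E →⋆ₙₐ[ℂ] A i) : E →⋆ₙₐ[ℂ] lp A ∞ where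
  toFun a := ⟨fun i => e i a, memℓp_infty ⟨‖a‖, by
    rintro _ ⟨i, rfl⟩
    exact NonUnitalStarAlgHom.norm_apply_le (e i) a⟩⟩
  map_smul' z a := lp.ext (funext fun i => map_smul (e i) z a)
  map_zero' := lp.ext (funext fun i => map_zero (e i))
  map_add' a b := lp.ext (funext fun i => map_add (e i) a b)
  map_mul' a b := lp.ext (funext fun i => map_mul (e i) a b)
  map_star' a := lp.ext (funext fun i => map_star (e i) a)

theorem NonUnitalStarAlgHom.continuous_of_cStar {E F : Type*} [NonUnitalCStarAlgebra E]
    [NonUnitalCStarAlgebra F] (φ : E →⋆ₙₐ[ℂ] F) : Continuous φ :=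
  AddMonoidHomClass.continuous_of_bound φ 1 fun a => by
    rw [one_mul]
    exact NonUnitalStarAlgHom.norm_apply_le φ a

theorem NonUnitalStarAlgebra.adjoin_subset_closure {E : Type*} [NonUnitalCStarAlgebra E]
    {S : Set E} {B : NonUnitalStarSubalgebra ℂ E} (h : S ⊆ closure (B : Set E)) :
    (NonUnitalStarAlgebra.adjoin ℂ S : Set E) ⊆ closure (B : Set E) :=
  (NonUnitalStarAlgebra.adjoin_le h : NonUnitalStarAlgebra.adjoin ℂ S ≤ B.topologicalClosure)

/-- Isometry on the dense set `D` passes to its closure, so the image is complete and therefore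
fills the closure of `Θ '' D`. Allowing a general `D` lets the image of one comparison map be the
dense set for the next. -/
theorem nonempty_generatedCStar_equiv {ι ι' : Type*} {A : ι → Type*} {A' : ι' → Type*}
    [∀ i, NonUnitalCStarAlgebra (A i)] [∀ i, NonUnitalCStarAlgebra (A' i)] (S : Set (lp A ∞))
    (S' : Set (lp A' ∞)) (Θ : lp A ∞ →⋆ₙₐ[ℂ] lp A' ∞) (D : Set (lp A ∞))
    (hD : closure D = closure (NonUnitalStarAlgebra.adjoin ℂ S))
    (hΘ : ∀ a ∈ D, ‖Θ a‖ = ‖a‖)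
    (hD' : closure (Θ '' D) = closure (NonUnitalStarAlgebra.adjoin ℂ S')) :
    Nonempty (GeneratedCStar S ≃⋆ₐ[ℂ] GeneratedCStar S') := by
  set T := (NonUnitalStarAlgebra.adjoin ℂ S).topologicalClosure with hT
  set T' := (NonUnitalStarAlgebra.adjoin ℂ S').topologicalClosure with hT'
  have hTc : (T : Set (lp A ∞)) = closure D := by
    rw [hD]
    rfl
  have hTc' : (T' : Set (lp A' ∞)) = closure (Θ '' D) := by
    rw [hD']
    rfl
  have hcont : Continuous Θ := Θ.continuous_of_cStar
  have hnorm : ∀ a ∈ T, ‖Θ a‖ = ‖a‖ := by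
    intro a ha
    have hcl : IsClosed {a | ‖Θ a‖ = ‖a‖} := isClosed_eq hcont.norm continuous_norm
    exact closure_minimal hΘ hcl (hTc ▸ ha : a ∈ closure D)
  have hmaps : ∀ a : T, (Θ.comp (NonUnitalStarSubalgebraClass.subtype T)) a ∈ T' := by
    intro a
    have ha : (a : lp A ∞) ∈ closure D := hTc ▸ a.2
    change _ ∈ (T' : Set (lp A' ∞))
    rw [hTc']
    exact image_closure_subset_closure_image hcont ⟨a, ha, rfl⟩
  have hcomplete : CompleteSpace T :=
    (NonUnitalStarSubalgebra.isClosed_topologicalClosure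
      (NonUnitalStarAlgebra.adjoin ℂ S)).completeSpace_coe
  have hisom : Isometry (Θ.comp (NonUnitalStarSubalgebraClass.subtype T)) :=
    AddMonoidHomClass.isometry_of_norm _ fun a => hnorm a a.2
  let φ := NonUnitalStarAlgHom.codRestrict (Θ.comp (NonUnitalStarSubalgebraClass.subtype T)) T'
    hmaps
  have hbij : Function.Bijective φ := by
    constructor
    · intro a b hab
      exact hisom.injective (congrArg Subtype.val hab)
    · intro b
      have hb : (b : lp A' ∞) ∈ closure (Θ '' D) := hTc' ▸ b.2
      have hsub : closure (Θ '' D) ⊆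
          Set.range (Θ.comp (NonUnitalStarSubalgebraClass.subtype T)) := by
        refine closure_minimal ?_ hisom.isClosedEmbedding.isClosed_range
        rintro _ ⟨d, hd, rfl⟩
        exact ⟨⟨d, (hTc ▸ subset_closure hd : d ∈ (T : Set (lp A ∞)))⟩, rfl⟩
      obtain ⟨a, ha⟩ := hsub hb
      exact ⟨a, Subtype.ext ha⟩
  exact ⟨StarAlgEquiv.ofBijective φ hbij⟩

namespace KGraph

variable {k : ℕ} {Λ : Type u} {G : KGraph k Λ} {P : Set (Λ × Λ)}

/-! ### Cuntz-Krieger families from representations of the groupoid -/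

section

variable (hfin : G.RowFinite) (hP : G.IsPartition P) (c : G.TwoCocycle)

theorem rep_mul (i : BoundedRep (groupoidCocycle hP c)) {μ ν κ : Λ} (hs : G.s ν = G.s μ) :
    i.L (cylCc hfin hP c μ ν) * i.L (cylCc hfin hP c ν κ) = i.L (cylCc hfin hP c μ κ) :=
  (i.map_conv _ _ _ fun γ => (congrFun (conv_cylFun hP c hs) γ).symm).symm

theorem rep_mul_eq_zero (i : BoundedRep (groupoidCocycle hP c)) {μ ν κ ρ : Λ}
    (hd : G.d ν = G.d κ) (hne : ν ≠ κ) :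
    i.L (cylCc hfin hP c μ ν) * i.L (cylCc hfin hP c κ ρ) = 0 := by
  rw [← map_zero i.L]
  exact (i.map_conv _ _ _ fun γ => (congrFun (conv_cylFun_eq_zero hP c hd hne) γ).symm).symm

theorem rep_star (i : BoundedRep (groupoidCocycle hP c)) (μ ν : Λ) :
    star (i.L (cylCc hfin hP c μ ν)) = i.L (cylCc hfin hP c ν μ) :=
  (i.map_star _ _ fun γ => (congrFun (convStar_cylFun hP c μ ν) γ).symm).symm

theorem rep_eq_sum (i : BoundedRep (groupoidCocycle hP c)) {μ ν : Λ} (hs : G.s μ = G.s ν)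
    (n : Fin k → ℕ) :
    i.L (cylCc hfin hP c μ ν) = ∑ α ∈ (hfin (G.s μ) (isVertex_s μ) n).toFinset,
      (c.ratio μ ν α : ℂ) • i.L (cylCc hfin hP c (G.comp μ α) (G.comp ν α)) := by
  rw [cylCc_eq_sum hfin hP c hs n, map_sum]
  simp only [map_smul]

theorem rep_mul_star (i : BoundedRep (groupoidCocycle hP c)) {μ ν : Λ} (hs : G.s μ = G.s ν) :
    i.L (cylCc hfin hP c μ (G.s μ)) * star (i.L (cylCc hfin hP c ν (G.s ν))) =
      i.L (cylCc hfin hP c μ ν) := by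
  rw [rep_star, ← hs]
  exact rep_mul hfin hP c i (G.s_s μ)

theorem isFamily_rep (i : BoundedRep (groupoidCocycle hP c)) :
    G.IsCuntzKriegerFamily c fun l => i.L (cylCc hfin hP c l (G.s l)) where
  projection v hv := by
    rw [hv.s_eq]
    exact ⟨rep_mul hfin hP c i rfl, rep_star hfin hP c i v v⟩
  orthogonal v w hv hw hne := by
    rw [hv.s_eq, hw.s_eq]
    exact rep_mul_eq_zero hfin hP c i (hv.trans hw.symm) hne
  mul μ ν h := by
    have hr : ∀ α ∈ (hfin (G.s μ) (isVertex_s μ) (G.d ν)).toFinset,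
        G.r α = G.s μ ∧ G.d α = G.d ν := fun α hα => by
      rw [Set.Finite.mem_toFinset] at hα
      exact hα
    have hcomp : ∀ α, G.r α = G.s μ → G.comp (G.s μ) α = α := fun α hα => by
      rw [← hα, G.r_comp_self]
    have hν : ν ∈ (hfin (G.s μ) (isVertex_s μ) (G.d ν)).toFinset := by
      rw [Set.Finite.mem_toFinset]
      exact ⟨h.symm, rfl⟩
    -- Expanding the first factor over paths of degree `d(ν)` leaves only the term `α = ν`; its
    -- coefficient is `c(μ, ν)` because `c(s(μ), ν) = 1`.
    rw [rep_eq_sum hfin hP c i (G.s_s μ).symm (G.d ν), Finset.sum_mul,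
      Finset.sum_eq_single_of_mem ν hν]
    · have hs : G.s ν = G.s (G.comp μ ν) := (G.s_comp _ _ h).symm
      rw [hcomp ν h.symm, smul_mul_assoc, rep_mul hfin hP c i hs, ← hs, TwoCocycle.ratio,
        c.normalised (G.s μ) ν (by rw [G.s_s, h]) (Or.inl (isVertex_s μ)), inv_one, mul_one]
    · intro α hα hne
      rw [hcomp α (hr α hα).1, smul_mul_assoc, rep_mul_eq_zero hfin hP c i (hr α hα).2 hne,
        smul_zero]
  star_mul_self l := by
    rw [rep_star, rep_mul hfin hP c i (G.s_s l).symm, G.s_s]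
  sum v hv n := by
    rw [finsum_mem_eq_finite_toFinset_sum _ (hfin v hv n), hv.s_eq,
      rep_eq_sum hfin hP c i (rfl : G.s v = G.s v) n]
    simp only [hv.s_eq]
    refine Finset.sum_congr rfl fun α hα => ?_
    have hα' : G.r α = v := ((Set.Finite.mem_toFinset _).mp hα).1
    have hvα : G.comp v α = α := by rw [← hα', G.r_comp_self]
    rw [rep_mul_star hfin hP c i rfl, c.ratio_self, Circle.coe_one, one_smul, hvα]

/-- The Cuntz-Krieger family given by a representation of the groupoid. -/
abbrev repFamily (i : BoundedRep (groupoidCocycle hP c)) : G.CuntzKriegerFamily c where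
  B := i.H →L[ℂ] i.H
  t l := i.L (cylCc hfin hP c l (G.s l))
  isFamily := isFamily_rep hfin hP c i

/-- The homomorphism that restricts the sum over all families to the families given by
representations of the groupoid. -/
def toFull : lp (fun i : G.CuntzKriegerFamily c => i.B) ∞ →⋆ₙₐ[ℂ]
    lp (fun i : BoundedRep (groupoidCocycle hP c) => i.H →L[ℂ] i.H) ∞ :=
  lpPi fun i => lpEval (repFamily hfin hP c i)

/-- The homomorphism that restricts the sum over all representations of the groupoid to the
regular ones. -/
def toReduced : lp (fun i : BoundedRep (groupoidCocycle hP c) => i.H →L[ℂ] i.H) ∞ →⋆ₙₐ[ℂ]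
    lp (fun x : G.InfinitePath => G.FibreSpace x →L[ℂ] G.FibreSpace x) ∞ :=
  lpPi fun x => lpEval (regRep (isGroupoidCocycle_groupoidCocycle hP c) x)

/-- The Cuntz-Krieger family given by a regular representation. -/
abbrev regFamily (x : G.InfinitePath) : G.CuntzKriegerFamily c :=
  repFamily hfin hP c (regRep (isGroupoidCocycle_groupoidCocycle hP c) x)

/-- For an infinite path `x` starting at the vertex, the diagonal matrix entry at an element of
`Z(r(x), r(x))` with source `x` is a product of circle values. -/
theorem exists_regFamily_ne_zero (hsrc : G.NoSources) (v : Λ) (hv : G.IsVertex v) :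
    ∃ x, (regFamily hfin hP c x).t v ≠ 0 := by
  obtain ⟨x, rfl⟩ := exists_infinitePath hsrc v hv
  obtain ⟨g, hg, -, hs⟩ := exists_groupoid_elem x.isConcat_range x.isConcat_range
  refine ⟨x, fun h0 => ?_⟩
  have h1 : regOp (groupoidCocycle hP c) x (cylCc hfin hP c x.range (G.s x.range)) = 0 := h0
  have h2 := regOp_basis (groupoidCocycle hP c) x (cylCc hfin hP c x.range (G.s x.range))
    ⟨g, hs⟩ ⟨g, hs⟩
  have hm : (Fibre.div ⟨g, hs⟩ ⟨g, hs⟩ : G.PathGroupoid) ∈ G.cylinder x.range x.range :=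
    mul_mem_cylinder hg (inv_mem_cylinder hg) rfl
  rw [h1, hv.s_eq, regKernel, coe_cylCc, cylFun_of_mem hP c hm] at h2
  exact mul_ne_zero (Circle.coe_ne_zero _) (Circle.coe_ne_zero _) h2.symm

/-! ### Gauge invariance of the regular families -/

/-- `z^n` for `n ∈ ℤ^k`. -/
def zZPow (z : Fin k → Circle) (n : Fin k → ℤ) : Circle := ∏ i, z i ^ n i

theorem zZPow_sub (z : Fin k → Circle) (m n : Fin k → ℤ) :
    zZPow z (m - n) = zZPow z m * (zZPow z n)⁻¹ := by
  simp only [zZPow, Pi.sub_apply, zpow_sub, Finset.prod_mul_distrib, Finset.prod_inv_distrib]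

theorem zZPow_toInt (z : Fin k → Circle) (n : Fin k → ℕ) : zZPow z (toInt n) = zPow z n := by
  simp only [zZPow, zPow, toInt, zpow_natCast]

/-- The kernel of `cylCc μ ν` has nonzero entries only where the degrees of `γ` and `β` differ by
`d(μ) - d(ν)`, so conjugation by the diagonal operator with entries `z^{deg γ}` multiplies it by the
gauge factor. -/
theorem exists_gauge_unitary (x : G.InfinitePath) (z : Fin k → Circle) :
    ∃ U V : G.FibreSpace x →L[ℂ] G.FibreSpace x, ‖U‖ ≤ 1 ∧ ‖V‖ ≤ 1 ∧ ∀ μ ν,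
      U * regOp (groupoidCocycle hP c) x (cylCc hfin hP c μ ν) * V =
        ((zPow z (G.d μ) : ℂ) * star (zPow z (G.d ν) : ℂ)) •
          regOp (groupoidCocycle hP c) x (cylCc hfin hP c μ ν) := by
  let w : G.Fibre x → Circle := fun γ => zZPow z γ.1.deg
  refine ⟨diagOp w, diagOp fun γ => (w γ)⁻¹, norm_diagOp_le _, norm_diagOp_le _, fun μ ν => ?_⟩
  refine FibreSpace.op_ext fun γ β => ?_
  refine (diagOp_conj_basis w (fun γ => (w γ)⁻¹)
    (regOp (groupoidCocycle hP c) x (cylCc hfin hP c μ ν)) γ β).trans ?_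
  have h1 := regOp_basis (groupoidCocycle hP c) x (cylCc hfin hP c μ ν) γ β
  refine Eq.trans (congrArg (((w γ : Circle) : ℂ) * (((w β)⁻¹ : Circle) : ℂ) * ·) h1) ?_
  refine Eq.trans ?_ (congrArg (((zPow z (G.d μ) : ℂ) * star (zPow z (G.d ν) : ℂ)) * ·) h1.symm)
  by_cases hm : γ.div β ∈ G.cylinder μ ν
  · have h2 : γ.1.deg - β.1.deg = toInt (G.d μ) - toInt (G.d ν) := by
      rw [← hm.1]
      exact sub_eq_add_neg _ _
    have h3 : w γ * (w β)⁻¹ = zPow z (G.d μ) * (zPow z (G.d ν))⁻¹ := by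
      rw [← zZPow_sub, h2, zZPow_sub, zZPow_toInt, zZPow_toInt]
    beta_reduce
    rw [← Circle.coe_mul, h3, Circle.coe_mul, Circle.coe_inv_eq_conj, Complex.star_def]
  · have h2 : regKernel (groupoidCocycle hP c) (cylCc hfin hP c μ ν) x γ β = 0 := by
      rw [regKernel, coe_cylCc, cylFun_of_notMem hP c hm, mul_zero]
    beta_reduce
    rw [h2, mul_zero, mul_zero]

theorem norm_gaugeEval_regFamily_le {b : lp (fun i : G.CuntzKriegerFamily c => i.B) ∞}
    (hb : b ∈ NonUnitalStarAlgebra.adjoin ℂ (Set.range (G.universalFamily c)))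
    (x : G.InfinitePath) (z : Fin k → Circle) :
    ‖gaugeEval (regFamily hfin hP c x) z b‖ ≤ ‖b (regFamily hfin hP c x)‖ := by
  obtain ⟨D, hD⟩ := exists_mem_ckSpan_degLE hfin hb
  obtain ⟨U, V, hU, hV, hUV⟩ := exists_gauge_unitary hfin hP c x z
  let e : lp (fun i : G.CuntzKriegerFamily c => i.B) ∞ →⋆ₙₐ[ℂ]
    (G.FibreSpace x →L[ℂ] G.FibreSpace x) := lpEval (regFamily hfin hP c x)
  let e' : lp (fun i : G.CuntzKriegerFamily c => i.B) ∞ →⋆ₙₐ[ℂ]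
    (G.FibreSpace x →L[ℂ] G.FibreSpace x) := gaugeEval (regFamily hfin hP c x) z
  have key : e' b = U * e b * V := by
    refine ckSpan_induction (p := fun b => e' b = U * e b * V) (fun μ ν _ => ?_) ?_ ?_ ?_ hD
    · refine (gaugeEval_mul_star (regFamily hfin hP c x) z μ ν).trans ?_
      by_cases hs : G.s μ = G.s ν
      · have h1 : (regFamily hfin hP c x).t μ * star ((regFamily hfin hP c x).t ν) =
            regOp (groupoidCocycle hP c) x (cylCc hfin hP c μ ν) :=
          rep_mul_star hfin hP c _ hs
        have h2 : e (G.universalFamily c μ * star (G.universalFamily c ν)) =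
            regOp (groupoidCocycle hP c) x (cylCc hfin hP c μ ν) := h1
        rw [h1, h2]
        exact (hUV μ ν).symm
      · have h1 := (regFamily hfin hP c x).isFamily.mul_star_eq_zero hs
        have h2 : e (G.universalFamily c μ * star (G.universalFamily c ν)) = 0 := h1
        rw [h1, h2, smul_zero, mul_zero, zero_mul]
        rfl
    · rw [map_zero, map_zero, mul_zero, zero_mul]
    · intro a b ha hb
      rw [map_add, map_add, ha, hb, mul_add, add_mul]
    · intro w a ha
      rw [map_smul, map_smul, ha, mul_smul_comm, smul_mul_assoc]
  change ‖e' b‖ ≤ ‖e b‖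
  rw [key]
  refine (norm_mul_le _ _).trans ?_
  refine (mul_le_mul (norm_mul_le _ _) hV (norm_nonneg _) (by positivity)).trans ?_
  rw [mul_one]
  exact mul_le_of_le_one_left (norm_nonneg _) hU

/-! ### The isomorphisms -/

/-- Restricting index sets cannot increase the norm; the reverse inequality is gauge-invariant
uniqueness for the regular families. -/
theorem norm_toReduced_toFull (hsrc : G.NoSources)
    {a : lp (fun i : G.CuntzKriegerFamily c => i.B) ∞}
    (ha : a ∈ NonUnitalStarAlgebra.adjoin ℂ (Set.range (G.universalFamily c))) :
    ‖toReduced hP c (toFull hfin hP c a)‖ = ‖a‖ := by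
  refine le_antisymm ((NonUnitalStarAlgHom.norm_apply_le _ _).trans
    (NonUnitalStarAlgHom.norm_apply_le _ _)) ?_
  refine lp.norm_le_of_forall_le (norm_nonneg _) fun i => ?_
  exact norm_le_of_gauge (j := regFamily hfin hP c) hfin
    (exists_regFamily_ne_zero hfin hP c hsrc)
    (fun b hb x z => norm_gaugeEval_regFamily_le hfin hP c hb x z) ha (norm_nonneg _)
    (fun x => lp.norm_apply_le_norm ENNReal.top_ne_zero
      (toReduced hP c (toFull hfin hP c a)) x) i

theorem norm_toFull (hsrc : G.NoSources)
    {a : lp (fun i : G.CuntzKriegerFamily c => i.B) ∞}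
    (ha : a ∈ NonUnitalStarAlgebra.adjoin ℂ (Set.range (G.universalFamily c))) :
    ‖toFull hfin hP c a‖ = ‖a‖ := by
  refine le_antisymm (NonUnitalStarAlgHom.norm_apply_le _ _) ?_
  rw [← norm_toReduced_toFull hfin hP c hsrc ha]
  exact NonUnitalStarAlgHom.norm_apply_le _ _

theorem exists_toFull_eq {h : C_c(G.PathGroupoid, ℂ)} (hh : h ∈ cylSpan hfin hP c) :
    ∃ d ∈ NonUnitalStarAlgebra.adjoin ℂ (Set.range (G.universalFamily c)),
      ∀ i : BoundedRep (groupoidCocycle hP c), toFull hfin hP c d i = i.L h := by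
  refine Submodule.span_induction (p := fun (h : C_c(G.PathGroupoid, ℂ)) _ =>
    ∃ d ∈ NonUnitalStarAlgebra.adjoin ℂ (Set.range (G.universalFamily c)),
      ∀ i : BoundedRep (groupoidCocycle hP c), toFull hfin hP c d i = i.L h) ?_ ?_ ?_ ?_ hh
  · rintro _ ⟨⟨μ, ν⟩, rfl⟩
    by_cases hs : G.s μ = G.s ν
    · exact ⟨G.universalFamily c μ * star (G.universalFamily c ν),
        mul_mem (NonUnitalStarAlgebra.subset_adjoin _ _ ⟨μ, rfl⟩)
          (star_mem (NonUnitalStarAlgebra.subset_adjoin _ _ ⟨ν, rfl⟩)),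
        fun i => rep_mul_star hfin hP c i hs⟩
    · refine ⟨0, zero_mem _, fun i => ?_⟩
      have h0 : cylCc hfin hP c μ ν = 0 := by
        ext g
        exact cylFun_of_notMem hP c fun h => hs (s_eq_of_mem_cylinder h)
      change _ = i.L (cylCc hfin hP c μ ν)
      rw [map_zero, h0, map_zero]
      rfl
  · exact ⟨0, zero_mem _, fun i => by rw [map_zero, map_zero]; rfl⟩
  · rintro f f' _ _ ⟨d, hd, e⟩ ⟨d', hd', e'⟩
    refine ⟨d + d', add_mem hd hd', fun i => ?_⟩
    exact (congrArg₂ (· + ·) (e i) (e' i)).trans (map_add i.L f f').symm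
  · rintro w f _ ⟨d, hd, e⟩
    refine ⟨w • d, SMulMemClass.smul_mem w hd, fun i => ?_⟩
    exact (congrArg (w • ·) (e i)).trans (map_smul i.L w f).symm

theorem mem_closure_toFull {f : C_c(G.PathGroupoid, ℂ)}
    {b : lp (fun i : BoundedRep (groupoidCocycle hP c) => i.H →L[ℂ] i.H) ∞}
    (hb : ∀ i, b i = i.L f) :
    b ∈ closure (toFull hfin hP c ''
      (NonUnitalStarAlgebra.adjoin ℂ (Set.range (G.universalFamily c)) : Set _)) := by
  rw [Metric.mem_closure_iff]
  intro ε hε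
  -- The `I`-norm bounds all representations at once, so an `I`-norm approximation is one in the
  -- direct sum.
  obtain ⟨h, hh, hfh⟩ := exists_iNorm_sub_le hfin hP c f (half_pos hε)
  obtain ⟨d, hd, e⟩ := exists_toFull_eq hfin hP c hh
  refine ⟨_, ⟨d, hd, rfl⟩, ?_⟩
  rw [dist_eq_norm]
  refine lt_of_le_of_lt (lp.norm_le_of_forall_le (half_pos hε).le fun i => ?_) (half_lt_self hε)
  have h1 : (b - toFull hfin hP c d) i = i.L (f - h) := by
    rw [map_sub, ← hb, ← e]
    rfl
  rw [h1, ← ENNReal.ofReal_le_ofReal_iff (half_pos hε).le, ofReal_norm]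
  exact (i.bounded _).trans hfh

theorem closure_toFull :
    closure (toFull hfin hP c ''
      (NonUnitalStarAlgebra.adjoin ℂ (Set.range (G.universalFamily c)) : Set _)) =
    closure (NonUnitalStarAlgebra.adjoin ℂ
      {a : lp (fun i : BoundedRep (groupoidCocycle hP c) => i.H →L[ℂ] i.H) ∞ |
        ∃ f : C_c(G.PathGroupoid, ℂ), ∀ i, a i = i.L f} : Set _) := by
  refine Set.Subset.antisymm (closure_mono ?_) (closure_minimal ?_ isClosed_closure)
  · rw [← NonUnitalStarSubalgebra.coe_map, NonUnitalStarAlgHom.map_adjoin]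
    refine NonUnitalStarAlgebra.adjoin_mono ?_
    rintro _ ⟨_, ⟨l, rfl⟩, rfl⟩
    exact ⟨cylCc hfin hP c l (G.s l), fun i => rfl⟩
  · rw [← NonUnitalStarSubalgebra.coe_map]
    refine NonUnitalStarAlgebra.adjoin_subset_closure ?_
    rintro b ⟨f, hf⟩
    exact mem_closure_toFull hfin hP c hf

theorem closure_toReduced_toFull :
    closure (toReduced hP c '' (toFull hfin hP c ''
      (NonUnitalStarAlgebra.adjoin ℂ (Set.range (G.universalFamily c)) : Set _))) =
    closure (NonUnitalStarAlgebra.adjoin ℂ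
      {a : lp (fun x : G.InfinitePath => G.FibreSpace x →L[ℂ] G.FibreSpace x) ∞ |
        ∃ f : C_c(G.PathGroupoid, ℂ), ∀ x, IsLeftConv (groupoidCocycle hP c) f x (a x)} :
          Set _) := by
  refine Set.Subset.antisymm (closure_mono ?_) (closure_minimal ?_ isClosed_closure)
  · rw [← NonUnitalStarSubalgebra.coe_map, ← NonUnitalStarSubalgebra.coe_map,
      NonUnitalStarAlgHom.map_adjoin, NonUnitalStarAlgHom.map_adjoin]
    refine NonUnitalStarAlgebra.adjoin_mono ?_
    rintro _ ⟨_, ⟨_, ⟨l, rfl⟩, rfl⟩, rfl⟩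
    exact ⟨cylCc hfin hP c l (G.s l), fun x => isLeftConv_regOp _ x _⟩
  · rw [← NonUnitalStarSubalgebra.coe_map, ← NonUnitalStarSubalgebra.coe_map]
    refine NonUnitalStarAlgebra.adjoin_subset_closure ?_
    rintro a ⟨f, hf⟩
    -- The regular image of `f` is lifted to its image under all bounded representations, which is
    -- known to lie in the closure; continuity of `toReduced` carries it back.
    let b : lp (fun i : BoundedRep (groupoidCocycle hP c) => i.H →L[ℂ] i.H) ∞ :=
      ⟨fun i => i.L f, memℓp_infty ⟨(iNorm f).toReal, by
        rintro _ ⟨i, rfl⟩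
        rw [← ENNReal.ofReal_le_iff_le_toReal (iNorm_ne_top f), ofReal_norm]
        exact i.bounded f⟩⟩
    have hb : b ∈ closure _ := mem_closure_toFull hfin hP c (f := f) fun i => rfl
    have hab : a = toReduced hP c b := lp.ext (funext fun x => (hf x).eq_regOp)
    rw [hab]
    exact image_closure_subset_closure_image (toReduced hP c).continuous_of_cStar ⟨b, hb, rfl⟩

end

end KGraph

end

theorem mainTheorem6 {k : ℕ} {Λ : Type*} (G : KGraph k Λ) (hfin : G.RowFinite)
    (hsrc : G.NoSources) (P : Set (Λ × Λ)) (hP : G.IsPartition P) (c : G.TwoCocycle) :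
    Nonempty (G.TwistedAlgebra c ≃⋆ₐ[ℂ] KGraph.FullAlgebra (KGraph.groupoidCocycle hP c)) ∧
    Nonempty (KGraph.FullAlgebra (KGraph.groupoidCocycle hP c) ≃⋆ₐ[ℂ]
      KGraph.ReducedAlgebra (KGraph.groupoidCocycle hP c)) := by
  constructor
  · exact nonempty_generatedCStar_equiv _ _ (KGraph.toFull hfin hP c) _ rfl
      (fun a ha => KGraph.norm_toFull hfin hP c hsrc ha) (KGraph.closure_toFull hfin hP c)
  · refine nonempty_generatedCStar_equiv _ _ (KGraph.toReduced hP c) _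
      (KGraph.closure_toFull hfin hP c) ?_ (KGraph.closure_toReduced_toFull hfin hP c)
    rintro _ ⟨a, ha, rfl⟩
    rw [KGraph.norm_toReduced_toFull hfin hP c hsrc ha, KGraph.norm_toFull hfin hP c hsrc ha]
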